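/- **Setting.** Let $T=(\mathbb C^\times)^g$, let $\Gamma\subset T$ be a discrete subgroup with basis $\gamma_1,\dots,\gamma_g$ (free of rank $g$), $X=T/\Gamma$, $\hat T=\operatorname{Hom}(T,\mathbb C^\times)\cong\mathbb Z^g$ and $\hat\Gamma=\operatorname{Hom}(\Gamma,\mathbb C^\times)\cong(\mathbb C^\times)^g$. Let $\lambda\in Z^2(\hat T,\mu_N)$, $N\ge 1$, be a 2-cocycle with values in the $N$-th roots of unity, $\Lambda(s,t)=\lambda(s,t)\lambda(t,s)^{-1}$, $\hat H=\{t\in\hat T:\Lambda(t,t')=1\ \forall t'\in\hat T\}$, and let $\hat K=\hat T/\hat H$, a finite abelian group. Fix a bilinear map $\hat K\times\hat K\to\mu_N$, again written $\lambda$, whose pull-back to $\hat T$ is cohomologous in $Z^2(\hat T,U(1))$ to the given cocycle. Let $K=\operatorname{Hom}(\hat K,\mathbb C^\times)=\{x\in T:h(x)=1\ \forall h\in\hat H\}$, $$Y=T/\Gamma K,\qquad \hat Y=\hat\Gamma/\hat H,\qquad \hat X=\hat\Gamma/\hat T,$$ so that $\hat K$ acts on $\hat Y$ by translations with quotient $\hat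 X$. For $k\in\hat K$ let $L_k$ be the line bundle on $Y$ whose sections are the $\Gamma$-invariant holomorphic functions $f$ on $T$ with $f(x\kappa)=k(\kappa)f(x)$ for $\kappa\in K$; multiplication of functions gives $m_{k,l}:L_k\otimes L_l\cong L_{kl}$. Let $Q$ be the Poincaré bundle on $Y\times\hat Y$, whose sections are the holomorphic functions $\varphi(x,\chi)$ on (open subsets of) $T\times\hat\Gamma$ with $\varphi(x\gamma,\chi)=\chi(\gamma)^{-1}\varphi(x,\chi)$, $\varphi(x\kappa,\chi)=\varphi(x,\chi)$, $\varphi(x,\chi h)=h(x)^{-1}\varphi(x,\chi)$ for $\gamma\in\Gamma$, $\kappa\in K$, $h\in\hat H$. Let $p,q$ be the projections of $Y\times\hat Y$ to $Y$ and $\hat Y$. The functor $$\mathrm{FM}^{ab}_Q(M)=p_*(q^*M\otimes Q)$$ sends sheaves of $\mathcal O_{\hat Y}$-modules to sheaves of $\mathcal O_Y$-modules. **Group actions.** The group $\hat K$ acts on $\operatorname{Mod}\hat Y$ by the functors $R_k^*$ ($R_k$ = translation by $k$) and on $\operatorname{Mod}Y$ by the functors $(-)\otimes L_k^{-1}$,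 with coherence isomorphisms induced by the $m_{k,l}$. For a $\mathbb C$-linear category $\mathcal C$ with an action $(k_*,c_{k,l})$ of $\hat K$, a $\lambda$-twisted equivariant object is an object $A$ with isomorphisms $\rho_k:A\to k_*A$ such that $c_{k,l}\circ k_*(\rho_l)\circ\rho_k=\lambda(k,l)\rho_{kl}$; morphisms are the morphisms commuting with all $\rho_k$, and the category is written $\mathcal C^{\hat K,\lambda}$. An equivariant structure on a $\mathbb C$-linear functor $F:\mathcal C\to\mathcal D$ is a family of natural isomorphisms $a_k:F k_*\cong k_*F$ compatible with the coherence isomorphisms: the composites $Fk_*l_*\to k_*Fl_*\to k_*l_*F\to (kl)_*F$ and $Fk_*l_*\to F(kl)_*\to(kl)_*F$ agree. It induces a functor $F^{\hat K,\lambda}:\mathcal C^{\hat K,\lambda}\to\mathcal D^{\hat K,\lambda}$, $(A,\rho)\mapsto(F(A),(a_k)_A\circ F(\rho_k))$. **Deformations.** Sheaves on the gerby torus $\hat X^\lambda$ are the $\lambda$-twisted $\hat K$-equivariant sheaves on $\hat Y$: $\operatorname{Mod}\hat X^\lambda=(\operatorname{Mod}\hat Y)^{\hat K,\lambda}$. The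 noncommutative torus $X_\lambda$ is the ringed space $Y$ with structure sheaf $\bigoplus_{k\in\hat K}L_k$ and the product $(\varphi\star_\lambda\psi)_k=\sum_{k_1k_2=k}\lambda(k_1,k_2)\,m_{k_1,k_2}(\varphi_{k_1}\otimes\psi_{k_2})$; $\operatorname{Mod}X_\lambda$ is the category of sheaves of right $\mathcal O_{X_\lambda}$-modules. It is identified with $(\operatorname{Mod}Y)^{\hat K,\lambda}$ by letting a section $a=(a_k)_k$ of $\bigoplus L_k$ act on a $\lambda$-twisted equivariant sheaf $(M,\rho)$ by $m\cdot a=\sum_k\rho_k(m)(a_k)$, where $\rho_k(m)\in M\otimes L_k^{-1}=\mathcal Hom(L_k,M)$. The deformed Poincaré bundle is $$P_\lambda=\bigoplus_{k\in\hat K}Q\otimes p^*L_k$$ with the right action of $p^*\mathcal O_{X_\lambda}$ given by the $\lambda$-twisted product, and with the $\lambda^{-1}$-twisted linearization $\sigma_k:P_\lambda\to R_{(1,k)}^*P_\lambda$, $\ \sigma_k(\psi)_s(x,\chi)=\lambda(k,s)^{-1}\,t(x)^{-1}\,\psi_{sk}(x,\chi t^{-1})$, where $t\in\hat T$ represents $k$.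 For $(M,\rho)\in\operatorname{Mod}\hat X^\lambda$ the $\mathcal O_{Y\times\hat Y}$-module $q^*M\otimes P_\lambda$ with the linearization $\rho_k\otimes\sigma_k$ is $\hat K$-equivariant, i.e. it is a sheaf on $Y\times\hat X$, and $$\mathrm{FM}^{ab}_\lambda:\operatorname{Mod}\hat X^\lambda\to\operatorname{Mod}X_\lambda,\qquad \mathrm{FM}^{ab}_\lambda(M)=\text{direct image to }Y\text{ of this sheaf}=\bigl(p_*(q^*M\otimes P_\lambda)\bigr)^{\hat K}.$$ **Statement.** The functor $\mathrm{FM}^{ab}_Q$ is $\hat K$-equivariant: it has an equivariant structure whose isomorphisms $$a_k:\ \mathrm{FM}^{ab}_Q(R_k^*M)\ \cong\ \mathrm{FM}^{ab}_Q(M)\otimes L_k^{-1}=\mathcal Hom(L_k,\mathrm{FM}^{ab}_Q(M))$$ are the canonical ones, induced by $q^*R_k^*M\cong R_{(1,k)}^*q^*M$ and $R_{(1,k^{-1})}^*Q\cong Q\otimes p^*L_k^{-1}$: if a section $s$ is locally $\sum_i n_i\otimes\psi_i$, then $a_k(s)(u)$ is locally $\sum_i n_i\otimes u(x)t(x)^{-1}\psi_i(x,\chi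 t^{-1})$ (with $n_i$ viewed as a section of $R_{(1,k)}^*q^*M$). With this structure, and the identification $(\operatorname{Mod}Y)^{\hat K,\lambda}=\operatorname{Mod}X_\lambda$ above, the induced functor $(\mathrm{FM}^{ab}_Q)^{\hat K,\lambda}$ is naturally isomorphic to $\mathrm{FM}^{ab}_\lambda$, as functors $\operatorname{Mod}\hat X^\lambda\to\operatorname{Mod}X_\lambda$. Moreover, for every $(M,\rho)\in\operatorname{Mod}\hat X^\lambda$, the $\mathcal O_{X_\lambda}$-module $\mathrm{FM}^{ab}_\lambda(M,\rho)$ is coherent if and only if the $\mathcal O_Y$-module $\mathrm{FM}^{ab}_Q(M)$ is coherent. So the isomorphism restricts to the full subcategories of coherent sheaves, where it is an isomorphism of the functors $(\mathrm{FM}^{ab}_Q)^{\hat K,\lambda}$ and $\mathrm{FM}^{ab}_\lambda$ from $\operatorname{coh}\hat X^\lambda$ to $\operatorname{coh}X_\lambda$ (coherence of $\mathrm{FM}^{ab}_Q(M)$ for coherent $M$ being the classical direct image theorem). -/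

import Mathlib

set_option linter.unusedVariables false
set_option linter.unusedSectionVars false
open CategoryTheory Opposite TopologicalSpace TensorProduct Topology

noncomputable section

namespace NCTorus

/-! ### Ringed spaces with not necessarily commutative structure sheaf -/

/-- A ringed space (in `Type`), with not necessarily commutative structure sheaf. -/
structure RSpace where
  top : TopCat.{0}
  sh : Sheaf (Opens.grothendieckTopology top) RingCat.{0}

/-- The category of sheaves of (left) modules on a ringed space. Right modules over a sheaf of rings
are modules on the opposite ringed space. -/
abbrev RSpace.Mod (X : RSpace) := SheafOfModules.{0} X.sh

/-- The sections of a sheaf of modules over an open set. -/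
abbrev RSpace.Mod.Sec {X : RSpace} (M : X.Mod) (U : Opens X.top) : Type := M.val.obj (op U)

/-- The restriction map between sections of a sheaf of modules. -/
def RSpace.Mod.res {X : RSpace} (M : X.Mod) {U V : Opens X.top} (h : U ≤ V) :
    RSpace.Mod.Sec M V → RSpace.Mod.Sec M U := fun m => M.val.map (homOfLE h).op m

/-- A morphism of ringed spaces. -/
structure RHom (X Y : RSpace) where
  base : X.top ⟶ Y.top
  sh : Y.sh ⟶ ((Opens.map base).sheafPushforwardContinuous RingCat.{0}
    (Opens.grothendieckTopology Y.top) (Opens.grothendieckTopology X.top)).obj X.sh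

/-- The direct image functor. -/
def RHom.push {X Y : RSpace} (f : RHom X Y) : X.Mod ⥤ Y.Mod := SheafOfModules.pushforward f.sh

theorem RHom.isRightAdjoint_push {X Y : RSpace} (f : RHom X Y) :
    (SheafOfModules.pushforward.{0} f.sh).IsRightAdjoint :=
  haveI : (PresheafOfModules.pushforward.{0} f.sh.hom).IsRightAdjoint :=
    PresheafOfModules.instIsRightAdjointPushforward (F := Opens.map f.base) (R := X.sh.obj)
      (S := Y.sh.obj) f.sh.hom
  inferInstance

/-- The inverse image functor `f^* = f^{-1}(-) ⊗ O_X`, left adjoint to the direct image. -/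
def RHom.pull {X Y : RSpace} (f : RHom X Y) : Y.Mod ⥤ X.Mod :=
  haveI := f.isRightAdjoint_push
  SheafOfModules.pullback f.sh

def RHom.adj {X Y : RSpace} (f : RHom X Y) : f.pull ⊣ f.push :=
  haveI := f.isRightAdjoint_push
  SheafOfModules.pullbackPushforwardAdjunction f.sh

/-- If `h = g ∘ f` as morphisms of ringed spaces, then `g_* f_* = h_*`. -/
def RHom.pushIso {X Y Z : RSpace} (f : RHom X Y) (g : RHom Y Z) (h : RHom X Z)
    (hb : f.base ≫ g.base = h.base)
    (hs : ∀ (U : Opens Z.top) (a : Z.sh.obj.obj (op U)),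
      X.sh.obj.map (eqToHom (by rw [← hb]; rfl) :
        (Opens.map h.base).obj U ⟶ (Opens.map f.base).obj ((Opens.map g.base).obj U)).op
          (f.sh.hom.app (op ((Opens.map g.base).obj U)) (g.sh.hom.app (op U) a)) =
        h.sh.hom.app (op U) a) :
    f.push ⋙ g.push ≅ h.push :=
  haveI : Functor.IsContinuous (Opens.map g.base ⋙ Opens.map f.base)
    (Opens.grothendieckTopology Z.top) (Opens.grothendieckTopology X.top) :=
    Functor.isContinuous_comp _ _ _ (Opens.grothendieckTopology Y.top) _
  SheafOfModules.pushforwardComp g.sh f.sh ≪≫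
    SheafOfModules.pushforwardCongr₂ _
      (NatIso.ofComponents (fun U => eqToIso (by rw [← hb]; rfl)) (fun _ => rfl) :
        Opens.map h.base ≅ Opens.map g.base ⋙ Opens.map f.base) (by
      ext U a
      exact hs U.unop a)

theorem RHom.pushIso_hom {X Y Z : RSpace} (f : RHom X Y) (g : RHom Y Z) (h : RHom X Z)
    (hb hs) (M : X.Mod) (U : (Opens Z.top)ᵒᵖ)
    (x : M.val.obj (op ((Opens.map f.base).obj ((Opens.map g.base).obj U.unop)))) :
    (((f.pushIso g h hb hs).hom.app M).val.app U : _ → _) x =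
      M.val.map (eqToHom (by rw [← hb]; rfl) : (Opens.map h.base).obj U.unop ⟶
        (Opens.map f.base).obj ((Opens.map g.base).obj U.unop)).op x := rfl


/-! ### Sheaves from explicit sections -/

/-- A sheaf of rings on a topological space, given by its sections, restrictions and gluing. -/
structure RingSheafData (X : TopCat.{0}) where
  sec : Opens X → Type
  [ring : ∀ U, Ring (sec U)]
  res : ∀ {U V : Opens X}, U ≤ V → sec V →+* sec U
  res_self : ∀ (U : Opens X) (a : sec U), res le_rfl a = a
  res_res : ∀ {U V W : Opens X} (h : U ≤ V) (h' : V ≤ W) (a : sec W),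
    res h (res h' a) = res (h.trans h') a
  glue : ∀ {ι : Type} (U : ι → Opens X) (s : ∀ i, sec (U i)),
    (∀ i j, res (inf_le_left : U i ⊓ U j ≤ U i) (s i) = res inf_le_right (s j)) →
    ∃! t : sec (iSup U), ∀ i, res (le_iSup U i) t = s i

attribute [instance] RingSheafData.ring

abbrev RingSheafData.toRSpace {X : TopCat.{0}} (D : RingSheafData X) : RSpace where
  top := X
  sh :=
    { obj :=
        { obj := fun U => RingCat.of (D.sec U.unop)
          map := fun f => RingCat.ofHom (D.res f.unop.le)
          map_id := fun U => by ext a; exact D.res_self _ a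
          map_comp := fun f g => by ext a; exact (D.res_res _ _ a).symm }
      property := by
        refine (TopCat.Presheaf.isSheaf_iff_isSheafUniqueGluing (C := RingCat.{0}) (X := X) _).2 ?_
        intro ι U s hs
        exact D.glue U s hs }

/-- A presheaf of modules, given by its sections and restrictions. -/
structure ModPresheafData (X : RSpace) where
  sec : Opens X.top → Type
  [grp : ∀ U, AddCommGroup (sec U)]
  [mod : ∀ U, Module (X.sh.obj.obj (op U)) (sec U)]
  res : ∀ {U V : Opens X.top}, U ≤ V → sec V →+ sec U
  res_self : ∀ (U : Opens X.top) (a : sec U), res le_rfl a = a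
  res_res : ∀ {U V W : Opens X.top} (h : U ≤ V) (h' : V ≤ W) (a : sec W),
    res h (res h' a) = res (h.trans h') a
  res_smul : ∀ {U V : Opens X.top} (h : U ≤ V) (r : X.sh.obj.obj (op V)) (a : sec V),
    res h (r • a) = (X.sh.obj.map (homOfLE h).op r : X.sh.obj.obj (op U)) • res h a

attribute [instance] ModPresheafData.grp ModPresheafData.mod

def ModPresheafData.toPresheaf {X : RSpace} (D : ModPresheafData X) :
    PresheafOfModules.{0} X.sh.obj :=
  letI F : (Opens X.top)ᵒᵖ ⥤ Ab.{0} :=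
    { obj := fun U => AddCommGrpCat.of (D.sec U.unop)
      map := fun f => AddCommGrpCat.ofHom (D.res f.unop.le)
      map_id := fun U => by ext a; exact D.res_self _ a
      map_comp := fun f g => by ext a; exact (D.res_res _ _ a).symm }
  letI : ∀ U, Module (X.sh.obj.obj U) (F.obj U) := fun U => D.mod U.unop
  PresheafOfModules.ofPresheaf F (fun U V f r m => D.res_smul f.unop.le r m)

def ModPresheafData.toMod {X : RSpace} (D : ModPresheafData X)
    (glue : ∀ {ι : Type} (U : ι → Opens X.top) (s : ∀ i, D.sec (U i)),
      (∀ i j, D.res (inf_le_left : U i ⊓ U j ≤ U i) (s i) = D.res inf_le_right (s j)) →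
      ∃! t : D.sec (iSup U), ∀ i, D.res (le_iSup U i) t = s i) : X.Mod where
  val := D.toPresheaf
  isSheaf := by
    refine (TopCat.Presheaf.isSheaf_iff_isSheafUniqueGluing (C := Ab.{0}) (X := X.top) _).2 ?_
    intro ι U s hs
    exact glue U s hs

/-! ### Quotients of complex manifolds with global coordinates, and multiplier line bundles -/

/-- A space `base`, presented as a quotient by the transformations `move i` of a space `P` which is
embedded by `co` as an open subset of `ℂ^ι`. -/
structure Cover where
  ι : Type
  [fin : Fintype ι]
  P : Type
  [topP : TopologicalSpace P]
  base : TopCat.{0}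
  π : P → base
  cont : Continuous π
  co : P → ι → ℂ
  I : Type
  move : I → P → P
  π_move : ∀ i z, π (move i z) = π z

attribute [instance] Cover.fin Cover.topP

namespace Cover

variable (C : Cover)

/-- The preimage in `P` of an open set of the base. -/
abbrev Pre (W : Opens C.base) : Type := {z : C.P // C.π z ∈ W}

/-- Holomorphic functions on the preimage of `W`. -/
def Up (W : Opens C.base) : Subalgebra ℂ (C.Pre W → ℂ) where
  carrier := {f | ∀ z : C.Pre W, ∃ F : (C.ι → ℂ) → ℂ, AnalyticAt ℂ F (C.co z) ∧
    ∀ᶠ z' in 𝓝 (z : C.P), ∀ h : C.π z' ∈ W, f ⟨z', h⟩ = F (C.co z')}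
  mul_mem' := by
    intro f g hf hg z
    obtain ⟨F, hF, hf⟩ := hf z
    obtain ⟨G, hG, hg⟩ := hg z
    refine ⟨F * G, hF.mul hG, ?_⟩
    filter_upwards [hf, hg] with z' h1 h2 h
    simp [h1 h, h2 h]
  add_mem' := by
    intro f g hf hg z
    obtain ⟨F, hF, hf⟩ := hf z
    obtain ⟨G, hG, hg⟩ := hg z
    refine ⟨F + G, hF.add hG, ?_⟩
    filter_upwards [hf, hg] with z' h1 h2 h
    simp [h1 h, h2 h]
  algebraMap_mem' := by
    intro c z
    exact ⟨fun _ => c, analyticAt_const, Filter.Eventually.of_forall fun _ _ => rfl⟩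

variable {C} in
/-- Pull-back of functions on `W` to its preimage. -/
def lift (W : Opens C.base) : (W → ℂ) →ₐ[ℂ] (C.Pre W → ℂ) where
  toFun a := fun z => a ⟨C.π z, z.2⟩
  map_one' := rfl
  map_mul' _ _ := rfl
  map_zero' := rfl
  map_add' _ _ := rfl
  commutes' _ := rfl

/-- Holomorphic functions on `W`: those which become holomorphic on the preimage of `W`. -/
def O (W : Opens C.base) : Subalgebra ℂ (W → ℂ) := (C.Up W).comap (lift W)

instance (W : Opens C.base) : Algebra (C.O W) (C.Up W) :=
  (((lift W).comp (C.O W).val).codRestrict (C.Up W) fun a => a.2).toRingHom.toAlgebra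

theorem algebraMap_apply (W : Opens C.base) (a : C.O W) (z : C.Pre W) :
    (algebraMap (C.O W) (C.Up W) a).1 z = a.1 ⟨C.π z, z.2⟩ := rfl

theorem smul_apply (W : Opens C.base) (a : C.O W) (f : C.Up W) (z : C.Pre W) :
    (a • f).1 z = a.1 ⟨C.π z, z.2⟩ * f.1 z := rfl

/-- The holomorphic functions `f` on the preimage of `W` with `f (move i z) = e i z * f z`, i.e.
the sections over `W` of the line bundle with multipliers `e`. -/
def line (e : C.I → C.P → ℂ) (W : Opens C.base) : Submodule (C.O W) (C.Up W) where
  carrier := {f | ∀ (i : C.I) (z z' : C.Pre W), (z' : C.P) = C.move i z → f.1 z' = e i z * f.1 z}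
  zero_mem' := by intro i z z' _; simp
  add_mem' := by
    intro f g hf hg i z z' h
    simp [hf i z z' h, hg i z z' h, mul_add]
  smul_mem' := by
    intro a f hf i z z' h
    have : (⟨C.π z', z'.2⟩ : W) = ⟨C.π z, z.2⟩ := Subtype.ext ((congrArg C.π h).trans (C.π_move i z))
    rw [C.smul_apply, C.smul_apply, hf i z z' h, this]
    ring

variable {C}

theorem mul_mem_line {e e' e'' : C.I → C.P → ℂ} (he : e * e' = e'') {W : Opens C.base}
    {f f' : C.Up W} (hf : f ∈ C.line e W) (hf' : f' ∈ C.line e' W) : f * f' ∈ C.line e'' W := by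
  intro i z z' h
  subst he
  simp only [MulMemClass.coe_mul, Pi.mul_apply]
  rw [hf i z z' h, hf' i z z' h]
  ring

theorem smul_mem_line (c : ℂ) {e : C.I → C.P → ℂ} {W : Opens C.base}
    {f : C.Up W} (hf : f ∈ C.line e W) : c • f ∈ C.line e W := by
  intro i z z' h
  change c * f.1 z' = e i z * (c * f.1 z)
  rw [hf i z z' h]
  ring

/-- Restriction of functions on preimages. -/
def resUp {U V : Opens C.base} (h : U ≤ V) : C.Up V →ₐ[ℂ] C.Up U where
  toFun f := ⟨fun z => f.1 ⟨z.1, h z.2⟩, fun z => by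
    obtain ⟨F, hF, hf⟩ := f.2 ⟨z.1, h z.2⟩
    exact ⟨F, hF, hf.mono fun z' h1 h2 => h1 (h h2)⟩⟩
  map_one' := rfl
  map_mul' _ _ := rfl
  map_zero' := rfl
  map_add' _ _ := rfl
  commutes' _ := rfl

def resO {U V : Opens C.base} (h : U ≤ V) : C.O V →ₐ[ℂ] C.O U where
  toFun f := ⟨fun z => f.1 ⟨z.1, h z.2⟩, fun z => by
    obtain ⟨F, hF, hf⟩ := f.2 ⟨z.1, h z.2⟩
    exact ⟨F, hF, hf.mono fun z' h1 h2 => h1 (h h2)⟩⟩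
  map_one' := rfl
  map_mul' _ _ := rfl
  map_zero' := rfl
  map_add' _ _ := rfl
  commutes' _ := rfl

theorem resUp_smul {U V : Opens C.base} (h : U ≤ V) (a : C.O V) (f : C.Up V) :
    resUp h (a • f) = resO h a • resUp h f := rfl

theorem resUp_mem {U V : Opens C.base} (h : U ≤ V) {e : C.I → C.P → ℂ} {f : C.Up V}
    (hf : f ∈ C.line e V) : resUp h f ∈ C.line e U :=
  fun i z z' hz => hf i ⟨z.1, h z.2⟩ ⟨z'.1, h z'.2⟩ hz

theorem glueUp {κ : Type} (U : κ → Opens C.base) (s : ∀ i, C.Up (U i))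
    (hs : ∀ i j, resUp (inf_le_left : U i ⊓ U j ≤ U i) (s i) = resUp inf_le_right (s j)) :
    ∃! t : C.Up (iSup U), ∀ i, resUp (le_iSup U i) t = s i := by
  have key : ∀ (i j) (z : C.P) (hi : C.π z ∈ U i) (hj : C.π z ∈ U j),
      (s i).1 ⟨z, hi⟩ = (s j).1 ⟨z, hj⟩ := fun i j z hi hj =>
    congrFun (congrArg Subtype.val (hs i j)) ⟨z, hi, hj⟩
  have ex : ∀ z : C.Pre (iSup U), ∃ i, C.π z ∈ U i := fun z => Opens.mem_iSup.1 z.2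
  choose c hc using ex
  refine ⟨⟨fun z => (s (c z)).1 ⟨z.1, hc z⟩, ?_⟩, ?_, ?_⟩
  · intro z
    obtain ⟨F, hF, hf⟩ := (s (c z)).2 ⟨z.1, hc z⟩
    refine ⟨F, hF, ?_⟩
    filter_upwards [hf, C.cont.continuousAt.preimage_mem_nhds ((U (c z)).2.mem_nhds (hc z))]
      with z' h1 h2 h
    rw [← h1 h2]
    exact key _ _ _ _ _
  · intro i
    ext z
    exact key _ _ _ _ _
  · intro t ht
    ext z
    exact congrFun (congrArg Subtype.val (ht (c z))) ⟨z.1, hc z⟩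

theorem glueO {κ : Type} (U : κ → Opens C.base) (s : ∀ i, C.O (U i))
    (hs : ∀ i j, resO (inf_le_left : U i ⊓ U j ≤ U i) (s i) = resO inf_le_right (s j)) :
    ∃! t : C.O (iSup U), ∀ i, resO (le_iSup U i) t = s i := by
  have key : ∀ (i j) (z : C.base) (hi : z ∈ U i) (hj : z ∈ U j),
      (s i).1 ⟨z, hi⟩ = (s j).1 ⟨z, hj⟩ := fun i j z hi hj =>
    congrFun (congrArg Subtype.val (hs i j)) ⟨z, hi, hj⟩
  have ex : ∀ z : (iSup U : Opens C.base), ∃ i, z.1 ∈ U i := fun z => Opens.mem_iSup.1 z.2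
  choose c hc using ex
  refine ⟨⟨fun z => (s (c z)).1 ⟨z.1, hc z⟩, ?_⟩, ?_, ?_⟩
  · intro z
    obtain ⟨F, hF, hf⟩ := (s (c ⟨C.π z, z.2⟩)).2 ⟨z.1, hc ⟨C.π z, z.2⟩⟩
    refine ⟨F, hF, ?_⟩
    filter_upwards [hf, C.cont.continuousAt.preimage_mem_nhds
      ((U (c ⟨C.π z, z.2⟩)).2.mem_nhds (hc ⟨C.π z, z.2⟩))] with z' h1 h2 h
    rw [← h1 h2]
    exact key _ _ _ _ _
  · intro i
    ext z
    exact key _ _ _ _ _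
  · intro t ht
    ext z
    exact congrFun (congrArg Subtype.val (ht (c z))) ⟨z.1, hc z⟩

theorem glueUp_mem {κ : Type} (U : κ → Opens C.base) (e : C.I → C.P → ℂ) (t : C.Up (iSup U))
    (ht : ∀ i, resUp (le_iSup U i) t ∈ C.line e (U i)) : t ∈ C.line e (iSup U) := by
  intro i z z' h
  obtain ⟨j, hj⟩ := Opens.mem_iSup.1 z.2
  have hj' : C.π z' ∈ U j := by rw [h, C.π_move]; exact hj
  exact ht j i ⟨z.1, hj⟩ ⟨z'.1, hj'⟩ h

variable (C)

def ringData : RingSheafData C.base where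
  sec := fun U => C.O U
  res := fun h => (resO h : _ →+* _)
  res_self := fun _ _ => rfl
  res_res := fun _ _ _ => rfl
  glue := fun U s hs => glueO U s hs

/-- The base, as a ringed space with its sheaf of holomorphic functions. -/
abbrev space : RSpace := C.ringData.toRSpace

variable {C}

variable (C) in
/-- The sections over `W` of the line bundle with multipliers `e`. -/
def Line (e : C.I → C.P → ℂ) (W : Opens C.base) : Type := C.line e W

instance (e : C.I → C.P → ℂ) (W : Opens C.base) : AddCommGroup (C.Line e W) :=
  Submodule.addCommGroup (C.line e W)

instance (e : C.I → C.P → ℂ) (W : Opens C.base) : Module (C.O W) (C.Line e W) :=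
  Submodule.module (C.line e W)

def resLine {e : C.I → C.P → ℂ} {U V : Opens C.base} (h : U ≤ V) : C.Line e V →+ C.Line e U where
  toFun f := ⟨resUp h f.1, resUp_mem h f.2⟩
  map_zero' := rfl
  map_add' _ _ := rfl

theorem glueLine (e : C.I → C.P → ℂ) {κ : Type} (U : κ → Opens C.base) (s : ∀ i, C.Line e (U i))
    (hs : ∀ i j, resLine (inf_le_left : U i ⊓ U j ≤ U i) (s i) = resLine inf_le_right (s j)) :
    ∃! t : C.Line e (iSup U), ∀ i, resLine (le_iSup U i) t = s i := by
  obtain ⟨t, ht, hu⟩ := glueUp U (fun i => (s i).1) (fun i j => congrArg Subtype.val (hs i j))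
  refine ⟨⟨t, glueUp_mem U e t fun i => ?_⟩, fun i => Subtype.ext (ht i), ?_⟩
  · rw [ht i]
    exact (s i).2
  · intro t' ht'
    exact Subtype.ext (hu t'.1 fun i => congrArg Subtype.val (ht' i))

end Cover


/-! ### Twisted convolution -/

/-- A bilinear map `G × G → ℂˣ`. -/
structure Bilin (G : Type) [CommGroup G] where
  toFun : G → G → ℂˣ
  mul_left : ∀ a b c, toFun (a * b) c = toFun a c * toFun b c
  mul_right : ∀ a b c, toFun a (b * c) = toFun a b * toFun a c

namespace Bilin

variable {G : Type} [CommGroup G] (l : Bilin G)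

theorem one_left (a : G) : l.toFun 1 a = 1 := by
  have := l.mul_left 1 1 a
  simpa using this

theorem one_right (a : G) : l.toFun a 1 = 1 := by
  have := l.mul_right a 1 1
  simpa using this

/-- Families of elements of a commutative algebra `R` indexed by `G`, with the product
`(a * b) k = ∑ λ(k₁, k₂) a k₁ b k₂` over all `k₁ k₂ = k`. -/
def Twisted (_l : Bilin G) (R : Type) : Type := G → R

variable [Fintype G] {R : Type} [CommRing R] [Algebra ℂ R]

instance : AddCommGroup (l.Twisted R) := inferInstanceAs (AddCommGroup (G → R))

instance {S : Type} [CommRing S] [Algebra S R] : Module S (l.Twisted R) :=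
  inferInstanceAs (Module S (G → R))

instance : Mul (l.Twisted R) :=
  ⟨fun a b k => ∑ j : G, (l.toFun j (j⁻¹ * k) : ℂ) • (a j * b (j⁻¹ * k))⟩

instance : One (l.Twisted R) := ⟨by classical exact fun k => if k = 1 then 1 else 0⟩

theorem mul_apply (a b : l.Twisted R) (k : G) :
    (a * b) k = ∑ j : G, (l.toFun j (j⁻¹ * k) : ℂ) • (a j * b (j⁻¹ * k)) := rfl

theorem one_apply [DecidableEq G] (k : G) :
    (1 : l.Twisted R) k = if k = 1 then 1 else 0 := by
  change (@ite _ (k = 1) (Classical.propDecidable _) 1 0) = _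
  split_ifs <;> rfl

theorem add_apply (a b : l.Twisted R) (k : G) : (a + b) k = a k + b k := rfl

theorem zero_apply (k : G) : (0 : l.Twisted R) k = 0 := rfl

instance : Ring (l.Twisted R) where
  left_distrib a b c := by
    funext k
    simp only [mul_apply, add_apply, mul_add, smul_add, Finset.sum_add_distrib]
  right_distrib a b c := by
    funext k
    simp only [mul_apply, add_apply, add_mul, smul_add, Finset.sum_add_distrib]
  zero_mul a := by
    funext k
    simp only [mul_apply, zero_apply, zero_mul, smul_zero, Finset.sum_const_zero]
  mul_zero a := by
    funext k
    simp only [mul_apply, zero_apply, mul_zero, smul_zero, Finset.sum_const_zero]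
  mul_assoc a b c := by
    classical
    funext k
    simp only [mul_apply, Finset.sum_mul, Finset.mul_sum, Finset.smul_sum]
    rw [Finset.sum_comm]
    refine Finset.sum_congr rfl fun i _ => ?_
    rw [← Equiv.sum_comp (Equiv.mulLeft i)]
    refine Finset.sum_congr rfl fun j _ => ?_
    have e1 : i⁻¹ * (i * j) = j := by group
    have e2 : (i * j)⁻¹ * k = j⁻¹ * (i⁻¹ * k) := by group
    simp only [Equiv.coe_mulLeft, e1, e2]
    obtain ⟨y, hy⟩ : ∃ y, y = j⁻¹ * (i⁻¹ * k) := ⟨_, rfl⟩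
    have e3 : i⁻¹ * k = j * y := by rw [hy, mul_inv_cancel_left]
    have h : (l.toFun (i * j) y * l.toFun i j : ℂˣ) = l.toFun i (i⁻¹ * k) * l.toFun j y := by
      rw [e3, l.mul_left, l.mul_right, mul_right_comm, mul_comm (l.toFun i y)]
    rw [← hy]
    have h' := congrArg (fun u : ℂˣ => (u : ℂ)) h
    simp only [Units.val_mul] at h'
    simp only [smul_mul_assoc, mul_smul_comm, smul_smul, h', mul_assoc]
  one_mul a := by
    classical
    funext k
    rw [mul_apply, Finset.sum_eq_single 1]
    · simp [one_apply, l.one_left]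
    · intro j _ hj
      simp [one_apply, hj]
    · simp
  mul_one a := by
    classical
    funext k
    rw [mul_apply, Finset.sum_eq_single k]
    · simp [one_apply, l.one_right]
    · intro j _ hj
      have : j⁻¹ * k ≠ 1 := fun h => hj (by rw [inv_mul_eq_one] at h; exact h)
      simp [one_apply, this]
    · simp
  neg_add_cancel a := neg_add_cancel a
  zsmul := fun n a => n • a
  zsmul_zero' := fun a => zero_smul ℤ a
  zsmul_succ' := fun n a => SubNegMonoid.zsmul_succ' n a
  zsmul_neg' := fun n a => SubNegMonoid.zsmul_neg' n a
  nsmul := fun n a => n • a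
  nsmul_zero := fun a => zero_smul ℕ a
  nsmul_succ := fun n a => AddMonoid.nsmul_succ n a
  sub := fun a b => a - b
  sub_eq_add_neg := fun a b => sub_eq_add_neg a b
  
/-- Functoriality of the twisted product in the coefficients. -/
def Twisted.map {R' : Type} [CommRing R'] [Algebra ℂ R'] (f : R →ₐ[ℂ] R') :
    l.Twisted R →+* l.Twisted R' where
  toFun a := fun k => f (a k)
  map_one' := by
    classical
    funext k
    simp only [one_apply]
    split_ifs <;> simp
  map_mul' a b := by
    funext k
    change f (∑ j : G, _) = ∑ j : G, _
    simp only [map_sum, map_smul, map_mul]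
  map_zero' := by funext k; exact map_zero f
  map_add' a b := by funext k; exact map_add f _ _

end Bilin

namespace Cover

variable (C : Cover) {G : Type} [CommGroup G] [Fintype G] (l : Bilin G)
  (e : G →* (C.I → C.P → ℂ))

/-- The sections over `W` of the sheaf of algebras `⨁ k, L k` with product twisted by `l`, where
`L k` is the line bundle with multipliers `e k`. -/
def Star (W : Opens C.base) : Subring (l.Twisted (C.Up W)) where
  carrier := {a | ∀ k, a k ∈ C.line (e k) W}
  mul_mem' := by
    intro a b ha hb k
    refine Submodule.sum_mem _ fun j _ => smul_mem_line _ (mul_mem_line ?_ (ha j) (hb _))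
    rw [← map_mul, mul_inv_cancel_left]
  one_mem' := by
    classical
    intro k
    rw [Bilin.one_apply]
    split_ifs with h
    · intro i z z' _
      simp [h]
    · exact Submodule.zero_mem _
  add_mem' := fun ha hb k => Submodule.add_mem _ (ha k) (hb k)
  zero_mem' := fun k => Submodule.zero_mem _
  neg_mem' := fun ha k => Submodule.neg_mem _ (ha k)

/-- The sections over `W` of `⨁ k, Q ⊗ L k`, where `Q` is the line bundle with multipliers `q` and
`L k` is the line bundle with multipliers `e k`. -/
def StarMod (q : C.I → C.P → ℂ) (W : Opens C.base) : Submodule (C.O W) (l.Twisted (C.Up W)) where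
  carrier := {a | ∀ k, a k ∈ C.line (q * e k) W}
  add_mem' := fun ha hb k => Submodule.add_mem _ (ha k) (hb k)
  zero_mem' := fun k => Submodule.zero_mem _
  smul_mem' := fun c _ ha _ => Submodule.smul_mem _ c (ha _)

variable {C l e}

theorem mul_mem_starMod {q : C.I → C.P → ℂ} {W : Opens C.base} {a b : l.Twisted (C.Up W)}
    (ha : a ∈ C.StarMod l e q W) (hb : b ∈ C.Star l e W) : a * b ∈ C.StarMod l e q W := by
  intro k
  refine Submodule.sum_mem _ fun j _ => smul_mem_line _ (mul_mem_line ?_ (ha j) (hb _))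
  rw [mul_assoc, ← map_mul, mul_inv_cancel_left]

variable (C l e) in
/-- The sections of the sheaf of algebras opposite to `⨁ k, L k`. -/
def StarOp (W : Opens C.base) : Type := (C.Star l e W)ᵐᵒᵖ

instance (W : Opens C.base) : Ring (C.StarOp l e W) :=
  inferInstanceAs (Ring (C.Star l e W)ᵐᵒᵖ)

def StarOp.val {W : Opens C.base} (a : C.StarOp l e W) : l.Twisted (C.Up W) :=
  (MulOpposite.unop (α := C.Star l e W) a).1

theorem StarOp.val_mem {W : Opens C.base} (a : C.StarOp l e W) : a.val ∈ C.Star l e W :=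
  (MulOpposite.unop (α := C.Star l e W) a).2

variable (C l e) in
def StarModSec (q : C.I → C.P → ℂ) (W : Opens C.base) : Type := C.StarMod l e q W

instance (q : C.I → C.P → ℂ) (W : Opens C.base) : AddCommGroup (C.StarModSec l e q W) :=
  Submodule.addCommGroup (C.StarMod l e q W)

instance (q : C.I → C.P → ℂ) (W : Opens C.base) : Module (C.O W) (C.StarModSec l e q W) :=
  Submodule.module (C.StarMod l e q W)

/-- Right multiplication makes `⨁ k, Q ⊗ L k` a right module over `⨁ k, L k`. -/
instance (q : C.I → C.P → ℂ) (W : Opens C.base) :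
    Module (C.StarOp l e W) (C.StarModSec l e q W) where
  smul a x := ⟨x.1 * a.val, mul_mem_starMod x.2 a.val_mem⟩
  one_smul x := Subtype.ext (mul_one x.1)
  mul_smul a b x := Subtype.ext (mul_assoc x.1 b.val a.val).symm
  smul_zero a := Subtype.ext (zero_mul a.val)
  smul_add a x y := Subtype.ext (add_mul x.1 y.1 a.val)
  add_smul a b x := Subtype.ext (mul_add x.1 a.val b.val)
  zero_smul x := Subtype.ext (mul_zero x.1)

theorem op_smul_val {q : C.I → C.P → ℂ} {W : Opens C.base} (a : C.StarOp l e W)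
    (x : C.StarModSec l e q W) : (a • x).1 = x.1 * a.val := rfl

theorem smul_smul_mul {W : Opens C.base} (r : ℂ) (c : C.O W) (f f' : C.Up W) :
    c • (r • (f * f')) = r • ((c • f) * f') := by
  refine Subtype.ext (funext fun z => ?_)
  change c.1 _ * (r * (f.1 z * f'.1 z)) = r * (c.1 _ * f.1 z * f'.1 z)
  ring

instance (q : C.I → C.P → ℂ) (W : Opens C.base) :
    SMulCommClass (C.O W) (C.StarOp l e W) (C.StarModSec l e q W) where
  smul_comm c a x := by
    refine Subtype.ext ?_
    funext k
    change c • (∑ j : G, _) = ∑ j : G, (_ : ℂ) • ((c • x.1 j) * _)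
    rw [Finset.smul_sum]
    refine Finset.sum_congr rfl fun j _ => ?_
    exact smul_smul_mul _ c _ _

def resTw {U V : Opens C.base} (h : U ≤ V) : l.Twisted (C.Up V) →+* l.Twisted (C.Up U) :=
  Bilin.Twisted.map l (resUp h)

def resStar {U V : Opens C.base} (h : U ≤ V) : C.Star l e V →+* C.Star l e U :=
  (resTw h).restrict _ _ fun _ ha k => resUp_mem h (ha k)

theorem glueTw {κ : Type} (U : κ → Opens C.base) (s : ∀ i, l.Twisted (C.Up (U i)))
    (hs : ∀ i j, resTw (inf_le_left : U i ⊓ U j ≤ U i) (s i) = resTw inf_le_right (s j)) :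
    ∃! t : l.Twisted (C.Up (iSup U)), ∀ i, resTw (le_iSup U i) t = s i := by
  have := fun k => glueUp U (fun i => s i k) fun i j => congrFun (hs i j) k
  choose t ht hu using this
  refine ⟨t, fun i => funext fun k => ht k i, fun t' ht' => funext fun k => ?_⟩
  exact hu k (t' k) fun i => congrFun (ht' i) k

variable (C l e)

def starData : RingSheafData C.base where
  sec := fun U => C.StarOp l e U
  res := fun h => RingHom.op (resStar h)
  res_self := fun _ _ => rfl
  res_res := fun _ _ _ => rfl
  glue := by
    intro κ U s hs
    obtain ⟨t, ht, hu⟩ := glueTw U (fun i => (s i).unop.1)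
      (fun i j => congrArg (fun a => a.unop.1) (hs i j))
    refine ⟨MulOpposite.op ⟨t, fun k => glueUp_mem U _ _ fun i => ?_⟩, fun i => ?_, ?_⟩
    · have := congrFun (ht i) k
      change resUp (le_iSup U i) (t k) = _ at this
      rw [this]
      exact (s i).unop.2 k
    · exact MulOpposite.unop_injective (Subtype.ext (ht i))
    · intro t' ht'
      exact MulOpposite.unop_injective (Subtype.ext
        (hu t'.unop.1 fun i => congrArg (fun a => a.unop.1) (ht' i)))

/-- The base with the opposite of the sheaf of algebras `⨁ k, L k`, twisted by `l`: modules over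
this ringed space are *right* modules over the twisted algebra. -/
abbrev starSpace : RSpace := (C.starData l e).toRSpace

end Cover


/-! ### Tensor products with presheaves of bimodules -/

section Hom

variable {X : RSpace}

/-- A morphism of presheaves of modules, given on sections. -/
def ModPresheafData.mkHom (D : ModPresheafData X) (M : PresheafOfModules.{0} X.sh.obj)
    (φ : ∀ U : Opens X.top, D.sec U →+ M.obj (op U))
    (hs : ∀ (U) (r : X.sh.obj.obj (op U)) (a : D.sec U), φ U (r • a) = r • φ U a)
    (hn : ∀ {U V : Opens X.top} (h : U ≤ V) (a : D.sec V),
      φ U (D.res h a) = M.map (homOfLE h).op (φ V a)) : D.toPresheaf ⟶ M :=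
  PresheafOfModules.homMk
    { app := fun U => AddCommGrpCat.ofHom (φ U.unop)
      naturality := fun U V f => by
        ext a
        exact hn f.unop.le a }
    (fun U r a => hs U.unop r a)

theorem ModPresheafData.mkHom_apply (D : ModPresheafData X) (M : PresheafOfModules.{0} X.sh.obj)
    (φ : ∀ U : Opens X.top, D.sec U →+ M.obj (op U)) (hs hn) (U : Opens X.top) (a : D.sec U) :
    (D.mkHom M φ hs hn).app (op U) a = φ U a := rfl

namespace RSpace.Mod

/-- A morphism of sheaves of modules, as a map on sections over an open set. -/
def app {M N : X.Mod} (f : M ⟶ N) (U : Opens X.top) : M.Sec U →+ N.Sec U :=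
  ((f.val.app (op U)).hom : _ →ₗ[_] _).toAddMonoidHom

theorem app_res {M N : X.Mod} (f : M ⟶ N) {U V : Opens X.top} (h : U ≤ V) (m : M.Sec V) :
    app f U (M.res h m) = N.res h (app f V m) :=
  PresheafOfModules.naturality_apply f.val (homOfLE h).op m

theorem app_smul {M N : X.Mod} (f : M ⟶ N) (U : Opens X.top) (r : X.sh.obj.obj (op U))
    (m : M.Sec U) : app f U (r • m) = r • app f U m :=
  map_smul (f.val.app (op U)).hom r m

theorem hom_ext {M N : X.Mod} {f g : M ⟶ N} (h : ∀ U (m : M.Sec U), app f U m = app g U m) :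
    f = g := by
  apply SheafOfModules.Hom.ext
  ext U m
  exact h U.unop m

theorem app_comp {M N L : X.Mod} (f : M ⟶ N) (g : N ⟶ L) (U : Opens X.top) (m : M.Sec U) :
    app (f ≫ g) U m = app g U (app f U m) := rfl

theorem app_id {M : X.Mod} (U : Opens X.top) (m : M.Sec U) : app (𝟙 M) U m = m := rfl

theorem app_add {M N : X.Mod} (f g : M ⟶ N) (U : Opens X.top) (m : M.Sec U) :
    app (f + g) U m = app f U m + app g U m := rfl

theorem res_add {M : X.Mod} {U V : Opens X.top} (h : U ≤ V) (m n : M.Sec V) :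
    M.res h (m + n) = M.res h m + M.res h n := map_add (M.val.map (homOfLE h).op).hom m n

theorem res_zero {M : X.Mod} {U V : Opens X.top} (h : U ≤ V) :
    M.res h (0 : M.Sec V) = 0 := map_zero (M.val.map (homOfLE h).op).hom

theorem res_smul {M : X.Mod} {U V : Opens X.top} (h : U ≤ V) (r : X.sh.obj.obj (op V))
    (m : M.Sec V) :
    M.res h (r • m) = (X.sh.obj.map (homOfLE h).op r : X.sh.obj.obj (op U)) • M.res h m :=
  PresheafOfModules.map_smul M.val (homOfLE h).op r m

theorem res_res {M : X.Mod} {U V W : Opens X.top} (h : U ≤ V) (h' : V ≤ W) (m : M.Sec W) :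
    M.res h (M.res h' m) = M.res (h.trans h') m := by
  have := PresheafOfModules.map_comp M.val (homOfLE h').op (homOfLE h).op
  exact (congrArg (fun f => f.hom m) this).symm

theorem res_self {M : X.Mod} {U : Opens X.top} (m : M.Sec U) : M.res le_rfl m = m := by
  have := PresheafOfModules.map_id M.val (op U)
  exact congrArg (fun f => f.hom m) this

end RSpace.Mod

end Hom

instance Cover.modSec (C : Cover) (F : C.space.Mod) (W : Opens C.base) :
    Module (C.O W) (RSpace.Mod.Sec (X := C.space) F W) :=
  inferInstanceAs (Module (C.space.sh.obj.obj (op W)) (RSpace.Mod.Sec (X := C.space) F W))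

theorem Cover.res_smul {C : Cover} {F : C.space.Mod} {U V : Opens C.base} (h : U ≤ V) (r : C.O V)
    (m : RSpace.Mod.Sec (X := C.space) F V) :
    RSpace.Mod.res (X := C.space) F h (r • m) =
      Cover.resO h r • RSpace.Mod.res (X := C.space) F h m :=
  RSpace.Mod.res_smul (X := C.space) h r m

theorem Cover.app_smul {C : Cover} {F F' : C.space.Mod} (f : F ⟶ F') {U : Opens C.base} (r : C.O U)
    (m : RSpace.Mod.Sec (X := C.space) F U) :
    RSpace.Mod.app (X := C.space) f U (r • m) = r • RSpace.Mod.app (X := C.space) f U m :=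
  RSpace.Mod.app_smul (X := C.space) f U r m

/-- A presheaf of modules over the functions on the base of `C` and over another sheaf of rings. -/
structure BiPresheaf (C : Cover) (D : RingSheafData C.base) where
  sec : Opens C.base → Type
  [grp : ∀ W, AddCommGroup (sec W)]
  [modO : ∀ W, Module (C.O W) (sec W)]
  [modS : ∀ W, Module (D.sec W) (sec W)]
  [comm : ∀ W, SMulCommClass (C.O W) (D.sec W) (sec W)]
  res : ∀ {U V : Opens C.base}, U ≤ V → sec V →+ sec U
  res_self : ∀ (U : Opens C.base) (a : sec U), res le_rfl a = a
  res_res : ∀ {U V W : Opens C.base} (h : U ≤ V) (h' : V ≤ W) (a : sec W),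
    res h (res h' a) = res (h.trans h') a
  res_smulO : ∀ {U V : Opens C.base} (h : U ≤ V) (r : C.O V) (a : sec V),
    res h (r • a) = Cover.resO h r • res h a
  res_smulS : ∀ {U V : Opens C.base} (h : U ≤ V) (r : D.sec V) (a : sec V),
    res h (r • a) = D.res h r • res h a

namespace BiPresheaf

attribute [instance] grp modO modS comm

variable {C : Cover} {D : RingSheafData C.base} (B : BiPresheaf C D)

/-- The group `B(W) ⊗ F(W)`, the tensor product being over the functions on `W`. -/
abbrev TSec (F : C.space.Mod) (W : Opens C.base) : Type :=
  B.sec W ⊗[C.O W] RSpace.Mod.Sec (X := C.space) F W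

def tres (F : C.space.Mod) {U V : Opens C.base} (h : U ≤ V) : B.TSec F V →+ B.TSec F U :=
  TensorProduct.liftAddHom
    (AddMonoidHom.mk' (fun b => AddMonoidHom.mk'
        (fun n => B.res h b ⊗ₜ[C.O U] RSpace.Mod.res (X := C.space) F h n)
        (fun n n' => by rw [RSpace.Mod.res_add, TensorProduct.tmul_add]))
      (fun b b' => by ext n; simp [TensorProduct.add_tmul]))
    (fun r b n => by
      simp only [AddMonoidHom.mk'_apply]
      rw [Cover.res_smul, B.res_smulO, TensorProduct.smul_tmul])

theorem tres_tmul (F : C.space.Mod) {U V : Opens C.base} (h : U ≤ V) (b : B.sec V)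
    (n : RSpace.Mod.Sec (X := C.space) F V) : B.tres F h (b ⊗ₜ n) =
      B.res h b ⊗ₜ[C.O U] RSpace.Mod.res (X := C.space) F h n := rfl

theorem tres_self (F : C.space.Mod) (U : Opens C.base) (a : B.TSec F U) :
    B.tres F le_rfl a = a := by
  induction a using TensorProduct.induction_on with
  | zero => exact map_zero _
  | tmul b n => rw [tres_tmul, B.res_self, RSpace.Mod.res_self]
  | add x y hx hy => rw [map_add, hx, hy]

theorem tres_tres (F : C.space.Mod) {U V W : Opens C.base} (h : U ≤ V) (h' : V ≤ W)
    (a : B.TSec F W) : B.tres F h (B.tres F h' a) = B.tres F (h.trans h') a := by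
  induction a using TensorProduct.induction_on with
  | zero => simp only [map_zero]
  | tmul b n => rw [tres_tmul, tres_tmul, tres_tmul, B.res_res, RSpace.Mod.res_res]
  | add x y hx hy => simp only [map_add, hx, hy]

theorem tres_smul (F : C.space.Mod) {U V : Opens C.base} (h : U ≤ V) (r : D.sec V)
    (a : B.TSec F V) : B.tres F h (r • a) = D.res h r • B.tres F h a := by
  induction a using TensorProduct.induction_on with
  | zero => simp only [smul_zero, map_zero]
  | tmul b n =>
    rw [tres_tmul, TensorProduct.smul_tmul', tres_tmul, TensorProduct.smul_tmul', B.res_smulS]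
  | add x y hx hy => simp only [smul_add, map_add, hx, hy]

/-- The presheaf `W ↦ B(W) ⊗ F(W)`. -/
def preTensor (F : C.space.Mod) : ModPresheafData D.toRSpace where
  sec W := B.TSec F W
  grp W := inferInstanceAs (AddCommGroup (B.TSec F W))
  mod W := inferInstanceAs (Module (D.sec W) (B.TSec F W))
  res h := B.tres F h
  res_self U a := B.tres_self F U a
  res_res h h' a := B.tres_tres F h h' a
  res_smul h r a := B.tres_smul F h r a

theorem tsec_ext {F : C.space.Mod} {W : Opens C.base} {A : Type} [AddCommGroup A]
    (f f' : B.TSec F W → A) (hf : ∀ x y, f (x + y) = f x + f y)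
    (hf' : ∀ x y, f' (x + y) = f' x + f' y) (h : ∀ b n, f (b ⊗ₜ n) = f' (b ⊗ₜ n)) (x) :
    f x = f' x := by
  induction x using TensorProduct.induction_on with
  | zero =>
    have h0 := hf 0 0
    have h0' := hf' 0 0
    rw [add_zero] at h0 h0'
    rw [left_eq_add.1 h0, left_eq_add.1 h0']
  | tmul b n => exact h b n
  | add x y hx hy => rw [hf, hf', hx, hy]

/-- A compatible family of balanced biadditive maps out of `B(W) × F(W)`. -/
structure Balanced (F : C.space.Mod) (N : D.toRSpace.Mod) where
  φ : ∀ W : Opens C.base,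
    B.sec W →+ RSpace.Mod.Sec (X := C.space) F W →+ RSpace.Mod.Sec (X := D.toRSpace) N W
  hO : ∀ (W : Opens C.base) (r : C.O W) (b) (n), φ W (r • b) n = φ W b (r • n)
  hS : ∀ (W : Opens C.base) (r : D.toRSpace.sh.obj.obj (op W)) (b) (n),
    φ W ((show D.sec W from r) • b) n = r • φ W b n
  hn : ∀ {U V : Opens C.base} (h : U ≤ V) (b) (n),
    φ U (B.res h b) (RSpace.Mod.res (X := C.space) F h n) = N.res h (φ V b n)

def Balanced.lift {F : C.space.Mod} {N : D.toRSpace.Mod} (β : B.Balanced F N)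
    (W : Opens C.base) : B.TSec F W →+ RSpace.Mod.Sec (X := D.toRSpace) N W :=
  TensorProduct.liftAddHom (β.φ W) (β.hO W)

/-- The tensor product `B ⊗ F`, as a sheaf. -/
def tensorObj (F : C.space.Mod) : D.toRSpace.Mod :=
  (PresheafOfModules.sheafification (𝟙 D.toRSpace.sh.obj)).obj (B.preTensor F).toPresheaf

def Balanced.preDesc {F : C.space.Mod} {N : D.toRSpace.Mod} (β : B.Balanced F N) :
    (B.preTensor F).toPresheaf ⟶ (PresheafOfModules.restrictScalars (𝟙 D.toRSpace.sh.obj)).obj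
      ((SheafOfModules.forget _).obj N) :=
  (B.preTensor F).mkHom _ (fun W => β.lift B W)
    (fun W r a => B.tsec_ext (A := RSpace.Mod.Sec (X := D.toRSpace) N W)
      (fun a => β.lift B W ((show D.sec W from r) • a)) (fun a => r • β.lift B W a)
      (fun x y => by rw [smul_add, map_add]) (fun x y => by rw [map_add, smul_add])
      (fun b n => β.hS W r b n) a)
    (fun {U V} h a => B.tsec_ext (A := RSpace.Mod.Sec (X := D.toRSpace) N U)
      (fun a => β.lift B U (B.tres F h a)) (fun a => N.res h (β.lift B V a))
      (fun x y => by rw [map_add, map_add]) (fun x y => by rw [map_add, RSpace.Mod.res_add])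
      (fun b n => β.hn h b n) a)

/-- The morphism out of `B ⊗ F` given by a family of balanced maps. -/
def Balanced.desc {F : C.space.Mod} {N : D.toRSpace.Mod} (β : B.Balanced F N) :
    B.tensorObj F ⟶ N :=
  ((PresheafOfModules.sheafificationAdjunction (𝟙 D.toRSpace.sh.obj)).homEquiv _ _).symm
    (β.preDesc B)

/-- The section of `B ⊗ F` represented by an element of `B(W) ⊗ F(W)`. -/
def toTensor (F : C.space.Mod) (W : Opens C.base) :
    B.TSec F W →+ RSpace.Mod.Sec (X := D.toRSpace) (B.tensorObj F) W :=
  ((((PresheafOfModules.sheafificationAdjunction (𝟙 D.toRSpace.sh.obj)).unit.app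
    (B.preTensor F).toPresheaf).app (op W)).hom : _ →ₗ[_] _).toAddMonoidHom

theorem toTensor_res (F : C.space.Mod) {U V : Opens C.base} (h : U ≤ V) (a : B.TSec F V) :
    B.toTensor F U (B.tres F h a) = (B.tensorObj F).res h (B.toTensor F V a) :=
  PresheafOfModules.naturality_apply
    ((PresheafOfModules.sheafificationAdjunction (𝟙 D.toRSpace.sh.obj)).unit.app
    (B.preTensor F).toPresheaf) (homOfLE h).op a

theorem toTensor_smul (F : C.space.Mod) {W : Opens C.base} (r : D.toRSpace.sh.obj.obj (op W))
    (a : B.TSec F W) :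
    B.toTensor F W ((show D.sec W from r) • a) = r • B.toTensor F W a :=
  map_smul (((PresheafOfModules.sheafificationAdjunction (𝟙 D.toRSpace.sh.obj)).unit.app
    (B.preTensor F).toPresheaf).app (op W)).hom r a

theorem Balanced.desc_toTensor {F : C.space.Mod} {N : D.toRSpace.Mod} (β : B.Balanced F N)
    (W : Opens C.base) (a : B.TSec F W) :
    RSpace.Mod.app (X := D.toRSpace) (β.desc B) W (B.toTensor F W a) = β.lift B W a := by
  have := ((PresheafOfModules.sheafificationAdjunction (𝟙 D.toRSpace.sh.obj)).homEquiv
    (B.preTensor F).toPresheaf N).apply_symm_apply (β.preDesc B)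
  rw [Adjunction.homEquiv_unit] at this
  exact congrArg (fun f => f.app (op W) a) this

theorem tensor_hom_ext {F : C.space.Mod} {N : D.toRSpace.Mod} {f f' : B.tensorObj F ⟶ N}
    (h : ∀ (W : Opens C.base) b n,
      RSpace.Mod.app (X := D.toRSpace) f W (B.toTensor F W (b ⊗ₜ n)) =
      RSpace.Mod.app (X := D.toRSpace) f' W (B.toTensor F W (b ⊗ₜ n))) : f = f' := by
  apply ((PresheafOfModules.sheafificationAdjunction (𝟙 D.toRSpace.sh.obj)).homEquiv
    (B.preTensor F).toPresheaf N).injective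
  refine (Adjunction.homEquiv_unit _ _ _ _).trans
    (Eq.trans ?_ (Adjunction.homEquiv_unit _ _ _ _).symm)
  ext W a
  exact B.tsec_ext (A := RSpace.Mod.Sec (X := D.toRSpace) N W.unop)
    (fun a => RSpace.Mod.app (X := D.toRSpace) f W.unop (B.toTensor F W.unop a))
    (fun a => RSpace.Mod.app (X := D.toRSpace) f' W.unop (B.toTensor F W.unop a))
    (fun x y => by rw [map_add, map_add]) (fun x y => by rw [map_add, map_add]) (h W.unop) a

def mapBalanced {F F' : C.space.Mod} (f : F ⟶ F') : B.Balanced F (B.tensorObj F') where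
  φ W := AddMonoidHom.mk' (fun b => AddMonoidHom.mk'
      (fun n => B.toTensor F' W (b ⊗ₜ RSpace.Mod.app (X := C.space) f W n))
      (fun n n' => by rw [map_add, TensorProduct.tmul_add, map_add]))
    (fun b b' => by
      ext n
      exact (congrArg (B.toTensor F' W) (TensorProduct.add_tmul _ _ _)).trans
        (map_add (B.toTensor F' W) _ _))
  hO W r b n := by
    refine congrArg (B.toTensor F' W) ?_
    rw [Cover.app_smul, TensorProduct.smul_tmul]
  hS W r b n := B.toTensor_smul F' r (b ⊗ₜ RSpace.Mod.app (X := C.space) f W n)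
  hn {U V} h b n := by
    refine (congrArg (B.toTensor F' U) ?_).trans (B.toTensor_res F' h _)
    rw [tres_tmul]
    exact congrArg _ (RSpace.Mod.app_res (X := C.space) f h n)

/-- The functor `B ⊗ -`. -/
def tensor : C.space.Mod ⥤ D.toRSpace.Mod where
  obj F := B.tensorObj F
  map f := (B.mapBalanced f).desc B
  map_id F := B.tensor_hom_ext fun W b n => by
    rw [Balanced.desc_toTensor]
    rfl
  map_comp f f' := B.tensor_hom_ext fun W b n => by
    rw [Balanced.desc_toTensor, RSpace.Mod.app_comp, Balanced.desc_toTensor]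
    exact (Balanced.desc_toTensor B (B.mapBalanced f') W
      (b ⊗ₜ RSpace.Mod.app (X := C.space) f W n)).symm

end BiPresheaf

/-! ### More on sheaves of modules -/

namespace RSpace.Mod

variable {X : RSpace}

/-- A morphism of sheaves of modules, given on sections. -/
def mkHom (M N : X.Mod) (φ : ∀ U : Opens X.top, M.Sec U →+ N.Sec U)
    (hs : ∀ (U) (r : X.sh.obj.obj (op U)) (a : M.Sec U), φ U (r • a) = r • φ U a)
    (hn : ∀ {U V : Opens X.top} (h : U ≤ V) (a : M.Sec V), φ U (M.res h a) = N.res h (φ V a)) :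
    M ⟶ N where
  val := PresheafOfModules.homMk
    { app := fun U => AddCommGrpCat.ofHom (φ U.unop)
      naturality := fun U V f => by
        ext a
        exact hn f.unop.le a }
    (fun U r a => hs U.unop r a)

theorem mkHom_app (M N : X.Mod) (φ : ∀ U : Opens X.top, M.Sec U →+ N.Sec U) (hs hn) (U) (a) :
    app (mkHom M N φ hs hn) U a = φ U a := rfl

theorem glue (M : X.Mod) {ι : Type} (U : ι → Opens X.top) {V : Opens X.top}
    (hU : ∀ i, U i ≤ V) (hV : V ≤ iSup U) (s : ∀ i, M.Sec (U i))
    (hs : ∀ i j, M.res (inf_le_left : U i ⊓ U j ≤ U i) (s i) = M.res inf_le_right (s j)) :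
    ∃! t : M.Sec V, ∀ i, M.res (hU i) t = s i := by
  obtain rfl : V = iSup U := le_antisymm hV (iSup_le hU)
  have h := (TopCat.Presheaf.isSheaf_iff_isSheafUniqueGluing (C := Ab.{0}) (X := X.top) _).1
    M.isSheaf
  exact h U s hs

theorem eq_of_res (M : X.Mod) {ι : Type} (U : ι → Opens X.top) {V : Opens X.top}
    (hU : ∀ i, U i ≤ V) (hV : V ≤ iSup U) (s t : M.Sec V)
    (h : ∀ i, M.res (hU i) s = M.res (hU i) t) : s = t := by
  refine (M.glue U hU hV (fun i => M.res (hU i) t) fun i j => ?_).unique h fun _ => rfl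
  rw [res_res, res_res]

/-- A morphism of sheaves of modules which is bijective on sections is an isomorphism. -/
def isoOfBij {M N : X.Mod} (f : M ⟶ N) (h : ∀ U, Function.Bijective (app f U)) : M ≅ N where
  hom := f
  inv := mkHom N M (fun U => ((AddEquiv.ofBijective (app f U) (h U)).symm : N.Sec U →+ M.Sec U))
    (fun U r a => by
      apply (h U).1
      have e := fun x => (AddEquiv.ofBijective (app f U) (h U)).apply_symm_apply x
      refine (e _).trans ?_
      rw [app_smul]
      exact congrArg _ (e a).symm)
    (fun {U V} k a => by
      apply (h U).1
      have e := fun U x => (AddEquiv.ofBijective (app f U) (h U)).apply_symm_apply x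
      refine (e U _).trans ?_
      rw [app_res]
      exact congrArg _ (e V a).symm)
  hom_inv_id := hom_ext fun U m => (AddEquiv.ofBijective (app f U) (h U)).symm_apply_apply m
  inv_hom_id := hom_ext fun U m => (AddEquiv.ofBijective (app f U) (h U)).apply_symm_apply m

end RSpace.Mod

namespace Cover

variable {C : Cover}

/-- Multiplication by a complex number. -/
def scal (z : ℂ) (M : C.space.Mod) : M ⟶ M :=
  RSpace.Mod.mkHom (X := C.space) M M
    (fun U => AddMonoidHom.mk' (fun m => algebraMap ℂ (C.O U) z • m) fun m n => smul_add _ m n)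
    (fun U r a => smul_comm (M := C.O U) (N := C.O U) (α := RSpace.Mod.Sec (X := C.space) M U) _ r a)
    (fun {U V} h a => (res_smul h (algebraMap ℂ (C.O V) z) a).symm)

theorem scal_app (z : ℂ) (M : C.space.Mod) (U : Opens C.base)
    (m : RSpace.Mod.Sec (X := C.space) M U) :
    RSpace.Mod.app (X := C.space) (scal z M) U m = algebraMap ℂ (C.O U) z • m := rfl

instance (M N : C.space.Mod) : Module ℂ (M ⟶ N) where
  smul z f := f ≫ scal z N
  one_smul f := RSpace.Mod.hom_ext (X := C.space) fun U m => by
    refine (scal_app 1 N U (RSpace.Mod.app (X := C.space) f U m)).trans ?_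
    rw [map_one, one_smul]
  mul_smul z w f := RSpace.Mod.hom_ext (X := C.space) fun U m => by
    refine (scal_app (z * w) N U (RSpace.Mod.app (X := C.space) f U m)).trans ?_
    rw [map_mul, mul_smul]
    rfl
  smul_zero z := Limits.zero_comp
  smul_add z f g := Preadditive.add_comp _ _ _ _ _ _
  add_smul z w f := RSpace.Mod.hom_ext (X := C.space) fun U m => by
    refine (scal_app (z + w) N U (RSpace.Mod.app (X := C.space) f U m)).trans ?_
    rw [map_add, add_smul]
    rfl
  zero_smul f := RSpace.Mod.hom_ext (X := C.space) fun U m => by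
    refine (scal_app 0 N U (RSpace.Mod.app (X := C.space) f U m)).trans ?_
    rw [map_zero, zero_smul]
    rfl

theorem smul_hom_app {M N : C.space.Mod} (z : ℂ) (f : M ⟶ N) (U : Opens C.base)
    (m : RSpace.Mod.Sec (X := C.space) M U) :
    RSpace.Mod.app (X := C.space) (z • f) U m =
      algebraMap ℂ (C.O U) z • RSpace.Mod.app (X := C.space) f U m := rfl

instance : Linear ℂ C.space.Mod where
  smul_comp M N L z f g := RSpace.Mod.hom_ext (X := C.space) fun U m => by
    rw [RSpace.Mod.app_comp, smul_hom_app, smul_hom_app, RSpace.Mod.app_comp]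
    exact app_smul g (algebraMap ℂ (C.O U) z) (RSpace.Mod.app (X := C.space) f U m)
  comp_smul M N L f z g := rfl

end Cover

/-! ### Group actions on categories and twisted equivariant objects -/

section Act

variable {G : Type} [Group G]

/-- An action of a group on a `ℂ`-linear category, by `ℂ`-linear autoequivalences, with its coherence
data `c : g_* ∘ h_* ≅ (g h)_*`. -/
structure CatAction (G : Type) [Group G] (𝒞 : Type*) [Category 𝒞] [Preadditive 𝒞]
    [Linear ℂ 𝒞] where
  act : G → 𝒞 ⥤ 𝒞
  isEquivalence : ∀ g, (act g).IsEquivalence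
  additive : ∀ g, (act g).Additive
  linear : ∀ (g : G) {A B : 𝒞} (z : ℂ) (f : A ⟶ B), (act g).map (z • f) = z • (act g).map f
  c : ∀ {g h k : G}, g * h = k → (act h ⋙ act g ≅ act k)
  assoc : ∀ {g h k gh hk ghk : G} (e₁ : g * h = gh) (e₂ : h * k = hk) (e₃ : gh * k = ghk)
    (e₄ : g * hk = ghk) (A : 𝒞),
    (c e₁).hom.app ((act k).obj A) ≫ (c e₃).hom.app A =
      (act g).map ((c e₂).hom.app A) ≫ (c e₄).hom.app A

variable {𝒞 𝒟 : Type*} [Category 𝒞] [Category 𝒟] [Preadditive 𝒞] [Preadditive 𝒟]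
  [Linear ℂ 𝒞] [Linear ℂ 𝒟]

theorem isEquivalence_of_unit (act : G → 𝒞 ⥤ 𝒞)
    (c : ∀ {g h k : G}, g * h = k → (act h ⋙ act g ≅ act k)) (u : act 1 ≅ 𝟭 𝒞) (g : G) :
    (act g).IsEquivalence :=
  (CategoryTheory.Equivalence.mk (act g) (act g⁻¹) (u.symm ≪≫ (c (inv_mul_cancel g)).symm)
    (c (mul_inv_cancel g) ≪≫ u)).isEquivalence_functor

/-- An object with a `φ`-twisted linearization. -/
structure TwistedEquivariant (α : CatAction G 𝒞) (φ : G → G → ℂˣ) where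
  obj : 𝒞
  rho : ∀ g, obj ≅ (α.act g).obj obj
  rho_rho : ∀ {g h k : G} (e : g * h = k), (rho g).hom ≫ (α.act g).map (rho h).hom ≫
    (α.c e).hom.app obj = (φ g h : ℂ) • (rho k).hom

namespace TwistedEquivariant

variable {α : CatAction G 𝒞} {β : CatAction G 𝒟} {φ : G → G → ℂˣ}

@[ext]
structure Hom (A B : TwistedEquivariant α φ) where
  hom : A.obj ⟶ B.obj
  comm : ∀ g, (A.rho g).hom ≫ (α.act g).map hom = hom ≫ (B.rho g).hom

instance : Category (TwistedEquivariant α φ) where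
  Hom := Hom
  id A := ⟨𝟙 _, fun g => by simp⟩
  comp f f' := ⟨f.hom ≫ f'.hom, fun g => by
    rw [Functor.map_comp, reassoc_of% f.comm g, f'.comm g, Category.assoc]⟩

@[ext]
theorem hom_ext {A B : TwistedEquivariant α φ} {f f' : A ⟶ B} (h : f.hom = f'.hom) : f = f' :=
  Hom.ext h

theorem comp_hom {A B D : TwistedEquivariant α φ} (f : A ⟶ B) (f' : B ⟶ D) :
    (f ≫ f').hom = f.hom ≫ f'.hom := rfl

theorem id_hom (A : TwistedEquivariant α φ) : Hom.hom (𝟙 A) = 𝟙 A.obj := rfl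

end TwistedEquivariant

/-- The structure of a `G`-equivariant functor on a `ℂ`-linear functor. -/
structure EquivariantStructure (α : CatAction G 𝒞) (β : CatAction G 𝒟) (F : 𝒞 ⥤ 𝒟) where
  a : ∀ g, α.act g ⋙ F ≅ F ⋙ β.act g
  pentagon : ∀ {g h k : G} (e : g * h = k) (A : 𝒞),
    (a g).hom.app ((α.act h).obj A) ≫ (β.act g).map ((a h).hom.app A) ≫
      (β.c e).hom.app (F.obj A) = F.map ((α.c e).hom.app A) ≫ (a k).hom.app A
  linear : ∀ {A B : 𝒞} (z : ℂ) (f : A ⟶ B), F.map (z • f) = z • F.map f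

/-- The functor between categories of `φ`-twisted equivariant objects induced by an equivariant
functor. -/
def EquivariantStructure.induced {α : CatAction G 𝒞} {β : CatAction G 𝒟} {F : 𝒞 ⥤ 𝒟}
    (s : EquivariantStructure α β F) (φ : G → G → ℂˣ) :
    TwistedEquivariant α φ ⥤ TwistedEquivariant β φ where
  obj A :=
    { obj := F.obj A.obj
      rho := fun g => F.mapIso (A.rho g) ≪≫ (s.a g).app A.obj
      rho_rho := fun {g h k} e => by
        have h1 := (s.a g).hom.naturality (A.rho h).hom
        have h2 := s.pentagon e A.obj
        have h3 := congrArg F.map (A.rho_rho e)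
        simp only [Functor.comp_map, Functor.comp_obj] at h1 h2
        simp only [Iso.trans_hom, Functor.mapIso_hom, Iso.app_hom, Functor.map_comp,
          Category.assoc]
        rw [← reassoc_of% h1, h2, ← Linear.smul_comp, ← s.linear, ← h3]
        simp only [Functor.map_comp, Category.assoc] }
  map f := ⟨F.map f.hom, fun g => by
    have h1 := (s.a g).hom.naturality f.hom
    simp only [Functor.comp_map, Functor.comp_obj] at h1
    simp only [Iso.trans_hom, Functor.mapIso_hom, Iso.app_hom, Category.assoc]
    rw [← h1, ← Functor.map_comp_assoc, f.comm, Functor.map_comp_assoc]⟩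
  map_id A := TwistedEquivariant.hom_ext (F.map_id _)
  map_comp f f' := TwistedEquivariant.hom_ext (F.map_comp _ _)

end Act

/-! ### The functors `Hom(L, -) = - ⊗ L⁻¹` for a line bundle `L` -/

namespace Cover

variable {C : Cover}

abbrev MSec (M : C.space.Mod) (U : Opens C.base) : Type := RSpace.Mod.Sec (X := C.space) M U

abbrev mres (M : C.space.Mod) {U V : Opens C.base} (h : U ≤ V) (m : MSec M V) : MSec M U :=
  RSpace.Mod.res (X := C.space) M h m

abbrev mapp {M N : C.space.Mod} (f : M ⟶ N) (U : Opens C.base) : MSec M U →+ MSec N U :=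
  RSpace.Mod.app (X := C.space) f U

def mulLine {e e' e'' : C.I → C.P → ℂ} (he : e * e' = e'') {W : Opens C.base}
    (u : C.Line e W) (v : C.Line e' W) : C.Line e'' W :=
  ⟨u.1 * v.1, mul_mem_line he u.2 v.2⟩

theorem resLine_self {e : C.I → C.P → ℂ} {W : Opens C.base} (u : C.Line e W) :
    resLine le_rfl u = u := rfl

theorem resLine_resLine {e : C.I → C.P → ℂ} {U V W : Opens C.base} (h : U ≤ V) (h' : V ≤ W)
    (u : C.Line e W) : resLine h (resLine h' u) = resLine (h.trans h') u := rfl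

theorem resLine_smul {e : C.I → C.P → ℂ} {U V : Opens C.base} (h : U ≤ V) (r : C.O V)
    (u : C.Line e V) : resLine h (r • u) = resO h r • resLine h u := rfl

theorem resLine_mulLine {e e' e'' : C.I → C.P → ℂ} (he : e * e' = e'') {U V : Opens C.base}
    (h : U ≤ V) (u : C.Line e V) (v : C.Line e' V) :
    resLine h (mulLine he u v) = mulLine he (resLine h u) (resLine h v) := rfl

theorem mulLine_add {e e' e'' : C.I → C.P → ℂ} (he : e * e' = e'') {W : Opens C.base}
    (u : C.Line e W) (v v' : C.Line e' W) :
    mulLine he u (v + v') = mulLine he u v + mulLine he u v' := Subtype.ext (mul_add u.1 v.1 v'.1)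

theorem add_mulLine {e e' e'' : C.I → C.P → ℂ} (he : e * e' = e'') {W : Opens C.base}
    (u u' : C.Line e W) (v : C.Line e' W) :
    mulLine he (u + u') v = mulLine he u v + mulLine he u' v := Subtype.ext (add_mul u.1 u'.1 v.1)

theorem mulLine_smul {e e' e'' : C.I → C.P → ℂ} (he : e * e' = e'') {W : Opens C.base} (r : C.O W)
    (u : C.Line e W) (v : C.Line e' W) :
    mulLine he u (r • v) = r • mulLine he u v :=
  Subtype.ext (Subtype.ext (funext fun z =>
    mul_left_comm (u.1.1 z) (r.1 ⟨C.π z, z.2⟩) (v.1.1 z)))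

theorem smul_mulLine {e e' e'' : C.I → C.P → ℂ} (he : e * e' = e'') {W : Opens C.base} (r : C.O W)
    (u : C.Line e W) (v : C.Line e' W) :
    mulLine he (r • u) v = r • mulLine he u v :=
  Subtype.ext (Subtype.ext (funext fun z =>
    mul_assoc (r.1 ⟨C.π z, z.2⟩) (u.1.1 z) (v.1.1 z)))

/-- The sections over `U` of the sheaf `Hom(L, M)`, where `L` has multipliers `e`. -/
@[ext]
structure HomSec (e : C.I → C.P → ℂ) (M : C.space.Mod) (U : Opens C.base) where
  ev : ∀ V : Opens C.base, V ≤ U → C.Line e V → MSec M V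
  map_add : ∀ (V) (h : V ≤ U) (u v), ev V h (u + v) = ev V h u + ev V h v
  map_smul : ∀ (V) (h : V ≤ U) (r : C.O V) (u), ev V h (r • u) = r • ev V h u
  nat : ∀ {V V' : Opens C.base} (h : V ≤ U) (k : V' ≤ V) (u),
    ev V' (k.trans h) (resLine k u) = mres M k (ev V h u)

variable {e : C.I → C.P → ℂ} {M : C.space.Mod} {U : Opens C.base}

instance : Zero (HomSec e M U) :=
  ⟨⟨fun _ _ _ => 0, by simp, by simp, fun h k _ => (RSpace.Mod.res_zero (X := C.space) k).symm⟩⟩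

instance : Add (HomSec e M U) :=
  ⟨fun f f' => ⟨fun V h u => f.ev V h u + f'.ev V h u,
    fun V h u v => by rw [f.map_add, f'.map_add]; abel,
    fun V h r u => by rw [f.map_smul, f'.map_smul, smul_add],
    fun h k u => by
      rw [f.nat, f'.nat]
      exact (RSpace.Mod.res_add (X := C.space) k _ _).symm⟩⟩

instance : SMul (C.O U) (HomSec e M U) :=
  ⟨fun r f => ⟨fun V h u => resO h r • f.ev V h u,
    fun V h u v => by rw [f.map_add, smul_add],
    fun V h s u => by rw [f.map_smul, smul_comm],
    fun h k u => by
      rw [f.nat]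
      exact (Cover.res_smul k (resO h r) _).symm⟩⟩

theorem HomSec.add_ev (f f' : HomSec e M U) (V : Opens C.base) (h : V ≤ U) (u) :
    (f + f').ev V h u = f.ev V h u + f'.ev V h u := rfl

theorem HomSec.smul_ev (r : C.O U) (f : HomSec e M U) (V : Opens C.base) (h : V ≤ U) (u) :
    (r • f).ev V h u = resO h r • f.ev V h u := rfl

theorem HomSec.zero_ev (V : Opens C.base) (h : V ≤ U) (u) :
    (0 : HomSec e M U).ev V h u = 0 := rfl

instance : Neg (HomSec e M U) := ⟨fun f => (-1 : C.O U) • f⟩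

instance : AddCommGroup (HomSec e M U) where
  add_assoc f f' f'' := HomSec.ext (by funext V h u; exact add_assoc _ _ _)
  zero_add f := HomSec.ext (by funext V h u; exact zero_add _)
  add_zero f := HomSec.ext (by funext V h u; exact add_zero _)
  add_comm f f' := HomSec.ext (by funext V h u; exact add_comm _ _)
  neg_add_cancel f := HomSec.ext (by
    funext V h u
    change resO h (-1) • f.ev V h u + f.ev V h u = 0
    rw [_root_.map_neg, _root_.map_one, neg_one_smul, neg_add_cancel])
  nsmul := nsmulRec
  zsmul := zsmulRec

instance : Module (C.O U) (HomSec e M U) where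
  one_smul f := HomSec.ext (by funext V h u; rw [HomSec.smul_ev, _root_.map_one, one_smul])
  mul_smul r s f := HomSec.ext (by
    funext V h u; rw [HomSec.smul_ev, _root_.map_mul, mul_smul]; rfl)
  smul_zero r := HomSec.ext (by
    funext V h u; rw [HomSec.smul_ev, HomSec.zero_ev, smul_zero])
  smul_add r f f' := HomSec.ext (by
    funext V h u; rw [HomSec.smul_ev, HomSec.add_ev, smul_add]; rfl)
  add_smul r s f := HomSec.ext (by
    funext V h u; rw [HomSec.smul_ev, _root_.map_add, add_smul]; rfl)
  zero_smul f := HomSec.ext (by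
    funext V h u; rw [HomSec.smul_ev, _root_.map_zero, zero_smul]; rfl)

def HomSec.res {U V : Opens C.base} (h : U ≤ V) : HomSec e M V →+ HomSec e M U where
  toFun f := ⟨fun V k u => f.ev V (k.trans h) u, fun V k => f.map_add V _, fun V k => f.map_smul V _,
    fun k k' u => f.nat (k.trans h) k' u⟩
  map_zero' := rfl
  map_add' _ _ := rfl

variable (e M) in
def homData : ModPresheafData C.space where
  sec U := HomSec e M U
  grp U := inferInstanceAs (AddCommGroup (HomSec e M U))
  mod U := inferInstanceAs (Module (C.O U) (HomSec e M U))
  res h := HomSec.res h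
  res_self _ _ := rfl
  res_res _ _ _ := rfl
  res_smul _ _ _ := rfl

theorem glueHom {ι : Type} (U : ι → Opens C.base) (s : ∀ i, HomSec e M (U i))
    (hs : ∀ i j, HomSec.res (inf_le_left : U i ⊓ U j ≤ U i) (s i) = HomSec.res inf_le_right (s j)) :
    ∃! t : HomSec e M (iSup U), ∀ i, HomSec.res (le_iSup U i) t = s i := by
  have key : ∀ (i j) (V : Opens C.base) (hi : V ≤ U i) (hj : V ≤ U j) (u),
      (s i).ev V hi u = (s j).ev V hj u := fun i j V hi hj u =>
    congrFun (congrFun (congrFun (congrArg HomSec.ev (hs i j)) V) (le_inf hi hj)) u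
  have cov : ∀ V : Opens C.base, V ≤ iSup U → V ≤ ⨆ i, V ⊓ U i := fun V h => by
    rw [← inf_iSup_eq]; exact le_inf le_rfl h
  have ex : ∀ (V : Opens C.base) (h : V ≤ iSup U) (u : C.Line e V), ∃! t : MSec M V, ∀ i,
      mres M (inf_le_left : V ⊓ U i ≤ V) t = (s i).ev (V ⊓ U i) inf_le_right
        (resLine inf_le_left u) := fun V h u =>
    RSpace.Mod.glue (X := C.space) M (fun i => V ⊓ U i) (fun i => inf_le_left) (cov V h) _
      fun i j => by
        refine ((s i).nat _ _ _).symm.trans (Eq.trans ?_ ((s j).nat _ _ _))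
        exact key _ _ _ _ _ _
  choose t ht hu using ex
  refine ⟨⟨t, fun V h u v => ?_, fun V h r u => ?_, fun {V V'} h k u => ?_⟩, fun i => ?_, ?_⟩
  · refine (hu V h _ _ fun i => ?_).symm
    refine (RSpace.Mod.res_add (X := C.space) _ _ _).trans ?_
    rw [_root_.map_add, (s i).map_add]
    exact congrArg₂ _ (ht V h u i) (ht V h v i)
  · refine (hu V h _ _ fun i => ?_).symm
    refine (Cover.res_smul _ _ _).trans ?_
    rw [resLine_smul, (s i).map_smul]
    exact congrArg _ (ht V h u i)
  · refine (hu V' (k.trans h) _ _ fun i => ?_).symm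
    refine (RSpace.Mod.res_res (X := C.space) _ _ _).trans ?_
    have h1 := congrArg (mres M (inf_le_inf_right _ k : V' ⊓ U i ≤ V ⊓ U i)) (ht V h u i)
    rw [← (s i).nat] at h1
    refine Eq.trans ?_ h1
    exact (RSpace.Mod.res_res (X := C.space) _ _ _).symm
  · refine HomSec.ext ?_
    funext V h u
    refine (hu V (h.trans (le_iSup U i)) u _ fun j => ?_).symm
    refine ((s i).nat _ _ _).symm.trans ?_
    exact key _ _ _ _ _ _
  · intro t' ht'
    refine HomSec.ext ?_
    funext V h u
    refine hu V h u _ fun i => ?_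
    refine (t'.nat _ _ _).symm.trans ?_
    exact congrFun (congrFun (congrFun (congrArg HomSec.ev (ht' i)) (V ⊓ U i)) inf_le_right) _

variable (e M) in
/-- The sheaf `Hom(L, M) = M ⊗ L⁻¹`, where `L` is the line bundle with multipliers `e`. -/
def homMod : C.space.Mod := (homData e M).toMod fun U s hs => glueHom U s hs

/-- The value of a section of `Hom(L, M)` over `U` at a section of `L` over `V ⊆ U`. -/
def hev {U : Opens C.base} (f : MSec (homMod e M) U) {V : Opens C.base} (h : V ≤ U)
    (u : C.Line e V) : MSec M V := HomSec.ev (M := M) (show HomSec e M U from f) V h u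

theorem hom_sec_ext {f f' : MSec (homMod e M) U}
    (h : ∀ (V : Opens C.base) (k : V ≤ U) u, hev f k u = hev f' k u) : f = f' :=
  HomSec.ext (by funext V k u; exact h V k u)

def mkSec (f : HomSec e M U) : MSec (homMod e M) U := f

theorem hev_mkSec (f : HomSec e M U) {V : Opens C.base} (h : V ≤ U) (u : C.Line e V) :
    hev (mkSec f) h u = f.ev V h u := rfl

theorem hev_add (f f' : MSec (homMod e M) U) {V : Opens C.base} (h : V ≤ U) (u) :
    hev (f + f') h u = hev f h u + hev f' h u := rfl

theorem hev_smul (r : C.O U) (f : MSec (homMod e M) U) {V : Opens C.base} (h : V ≤ U) (u) :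
    hev (r • f) h u = resO h r • hev f h u := rfl

theorem hev_map_add (f : MSec (homMod e M) U) {V : Opens C.base} (h : V ≤ U) (u v) :
    hev f h (u + v) = hev f h u + hev f h v := HomSec.map_add _ _ _ _ _

theorem hev_map_smul (f : MSec (homMod e M) U) {V : Opens C.base} (h : V ≤ U) (r : C.O V) (u) :
    hev f h (r • u) = r • hev f h u := HomSec.map_smul _ _ _ _ _

theorem hev_nat (f : MSec (homMod e M) U) {V V' : Opens C.base} (h : V ≤ U) (k : V' ≤ V) (u) :
    hev f (k.trans h) (resLine k u) = mres M k (hev f h u) := HomSec.nat _ _ _ _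

theorem hev_res {U' : Opens C.base} (k : U' ≤ U) (f : MSec (homMod e M) U) {V : Opens C.base}
    (h : V ≤ U') (u) : hev (mres (homMod e M) k f) h u = hev f (h.trans k) u := rfl

def homMap {M N : C.space.Mod} (f : M ⟶ N) : homMod e M ⟶ homMod e N :=
  RSpace.Mod.mkHom (X := C.space) (homMod e M) (homMod e N)
    (fun U => AddMonoidHom.mk' (fun s => mkSec
      { ev := fun V h u => mapp f V (hev s h u)
        map_add := fun V h u v => by rw [hev_map_add, _root_.map_add]
        map_smul := fun V h r u => by rw [hev_map_smul, app_smul]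
        nat := fun h k u => by
          rw [hev_nat]
          exact RSpace.Mod.app_res (X := C.space) f k _ })
      (fun s t => hom_sec_ext fun V k u =>
        (congrArg (mapp f V) (hev_add s t k u)).trans (_root_.map_add (mapp f V) _ _)))
    (fun U r s => hom_sec_ext fun V k u =>
      (congrArg (mapp f V) (hev_smul r s k u)).trans (app_smul f (resO k r) _))
    (fun h s => rfl)

theorem hev_homMap {M N : C.space.Mod} (f : M ⟶ N) (s : MSec (homMod e M) U) {V : Opens C.base}
    (h : V ≤ U) (u) : hev (mapp (homMap f) U s) h u = mapp f V (hev s h u) := rfl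

variable (e) in
/-- The functor `Hom(L, -) = - ⊗ L⁻¹`, where `L` is the line bundle with multipliers `e`. -/
def homFunctor : C.space.Mod ⥤ C.space.Mod where
  obj M := homMod e M
  map f := homMap f
  map_id M := RSpace.Mod.hom_ext (X := C.space) fun U m => rfl
  map_comp f f' := RSpace.Mod.hom_ext (X := C.space) fun U m => rfl

end Cover

namespace Cover

variable (C : Cover)

/-- The base is the quotient of `P` by the transformations `move i`. -/
structure Exact : Prop where
  surj : Function.Surjective C.π
  orbit : ∀ z z', C.π z = C.π z' → Relation.EqvGen (fun a b => ∃ i, b = C.move i a) z z'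

/-- A nowhere vanishing section and its inverse. -/
structure Frame (e : C.I → C.P → ℂ) (V : Opens C.base) where
  u : C.Line e V
  v : C.Line e⁻¹ V
  inv : ∀ z, u.1.1 z * v.1.1 z = 1

/-- The line bundle with multipliers `e` is locally trivial. -/
def LocTriv (e : C.I → C.P → ℂ) : Prop :=
  ∀ y : C.base, ∃ V : Opens C.base, y ∈ V ∧ Nonempty (C.Frame e V)

variable {C}

theorem Exact.descend (hC : C.Exact) {W : Opens C.base} (f : C.Line 1 W) :
    ∃ a : C.O W, ∀ z : C.Pre W, f.1.1 z = a.1 ⟨C.π z, z.2⟩ := by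
  have key : ∀ z z' : C.P, Relation.EqvGen (fun a b => ∃ i, b = C.move i a) z z' →
      C.π z = C.π z' ∧ ∀ (h : C.π z ∈ W) (h' : C.π z' ∈ W), f.1.1 ⟨z, h⟩ = f.1.1 ⟨z', h'⟩ := by
    intro z z' hz
    induction hz with
    | rel a b hab =>
      obtain ⟨i, rfl⟩ := hab
      refine ⟨(C.π_move i a).symm, fun h h' => ?_⟩
      rw [f.2 i ⟨a, h⟩ ⟨_, h'⟩ rfl]
      simp
    | refl a => exact ⟨rfl, fun _ _ => rfl⟩
    | symm a b _ ih => exact ⟨ih.1.symm, fun h h' => (ih.2 h' h).symm⟩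
    | trans a b c _ _ ih1 ih2 =>
      refine ⟨ih1.1.trans ih2.1, fun h h' => ?_⟩
      have hb : C.π b ∈ W := ih1.1 ▸ h
      exact (ih1.2 h hb).trans (ih2.2 hb h')
  choose c hc using hC.surj
  have val : ∀ z : C.Pre W, f.1.1 z = f.1.1 ⟨c (C.π z), by rw [hc]; exact z.2⟩ := fun z =>
    (key _ _ (hC.orbit _ _ (hc _).symm)).2 _ _
  refine ⟨⟨fun y => f.1.1 ⟨c y, by rw [hc]; exact y.2⟩, ?_⟩, val⟩
  change lift W (fun y => f.1.1 ⟨c y, by rw [hc]; exact y.2⟩) ∈ C.Up W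
  convert f.1.2 using 1
  funext z
  exact (val z).symm

def Frame.res {e : C.I → C.P → ℂ} {U V : Opens C.base} (h : U ≤ V) (F : C.Frame e V) :
    C.Frame e U := ⟨resLine h F.u, resLine h F.v, fun z => F.inv ⟨z.1, h z.2⟩⟩

variable {e e' e'' : C.I → C.P → ℂ} (he : e * e' = e'') {M : C.space.Mod}

/-- The inverse of the coherence isomorphism. -/
def splitSec {U : Opens C.base} (f : MSec (homMod e'' M) U) : MSec (homMod e (homMod e' M)) U :=
  mkSec
    { ev := fun V h u => mkSec
        { ev := fun V' k v => hev f (k.trans h) (mulLine he (resLine k u) v)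
          map_add := fun V' k v v' => by rw [mulLine_add, hev_map_add]
          map_smul := fun V' k r v => by rw [mulLine_smul, hev_map_smul]
          nat := fun k k' v => by rw [← hev_nat, resLine_mulLine, resLine_resLine] }
      map_add := fun V h u u' => hom_sec_ext fun V' k v => by
        exact (congrArg (hev f (k.trans h))
          ((congrArg (fun x => mulLine he x v) (_root_.map_add (resLine k) u u')).trans
            (add_mulLine he _ _ _))).trans (hev_map_add _ _ _ _)
      map_smul := fun V h r u => hom_sec_ext fun V' k v => by
        exact (congrArg (hev f (k.trans h))
          ((congrArg (fun x => mulLine he x v) (resLine_smul k r u)).trans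
            (smul_mulLine he _ _ _))).trans (hev_map_smul _ _ _ _)
      nat := fun h k u => hom_sec_ext fun V' k' v => rfl }

theorem hev_hev_splitSec {U : Opens C.base} (f : MSec (homMod e'' M) U) {V V' : Opens C.base}
    (h : V ≤ U) (k : V' ≤ V) (u : C.Line e V) (v : C.Line e' V') :
    hev (hev (splitSec he f) h u) k v = hev f (k.trans h) (mulLine he (resLine k u) v) := rfl

variable (M) in
def split : homMod e'' M ⟶ homMod e (homMod e' M) :=
  RSpace.Mod.mkHom (X := C.space) (homMod e'' M) (homMod e (homMod e' M))
    (fun U => AddMonoidHom.mk' (fun f => splitSec he f)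
      (fun f f' => hom_sec_ext fun V k u => hom_sec_ext fun V' k' v => rfl))
    (fun U r f => hom_sec_ext fun V k u => hom_sec_ext fun V' k' v => rfl)
    (fun h f => rfl)

theorem hev_hev_split {U : Opens C.base} (f : MSec (homMod e'' M) U) {V V' : Opens C.base}
    (h : V ≤ U) (k : V' ≤ V) (u : C.Line e V) (v : C.Line e' V') :
    hev (hev (mapp (split he M) U f) h u) k v =
      hev f (k.trans h) (mulLine he (resLine k u) v) := rfl

theorem inv_mul_of_mul (he : e * e' = e'') (hu : e⁻¹ * e = 1) : e⁻¹ * e'' = e' := by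
  rw [← he, ← mul_assoc, hu, one_mul]

theorem split_surj (hC : C.Exact) (hu : e⁻¹ * e = 1) (ht : C.LocTriv e) (U : Opens C.base) :
    Function.Surjective (mapp (split he M) U) := by
  intro H
  have he' := inv_mul_of_mul he hu
  have hu' : e * e⁻¹ = 1 := by rw [mul_comm, hu]
  -- the value at `w`, computed with a frame
  let loc : ∀ {V : Opens C.base} (h : V ≤ U) (F : C.Frame e V) (w : C.Line e'' V), MSec M V :=
    fun {V} h F w => hev (hev H h F.u) le_rfl (mulLine he' F.v w)
  have loc_res : ∀ {V V' : Opens C.base} (h : V ≤ U) (k : V' ≤ V) (F : C.Frame e V)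
      (w : C.Line e'' V), mres M k (loc h F w) = loc (k.trans h) (F.res k) (resLine k w) := by
    intro V V' h k F w
    change _ = hev (hev H (k.trans h) (resLine k F.u)) le_rfl _
    rw [hev_nat, hev_res]
    exact (hev_nat _ _ _ _).symm
  have loc_eq : ∀ {V : Opens C.base} (h : V ≤ U) (F F' : C.Frame e V) (w : C.Line e'' V),
      loc h F w = loc h F' w := by
    intro V h F F' w
    obtain ⟨a, ha⟩ := hC.descend (mulLine hu' F.u F'.v)
    have h1 : F.u = a • F'.u := Subtype.ext (Subtype.ext (funext fun z => by
      have h2 := ha z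
      change F.u.1.1 z * F'.v.1.1 z = _ at h2
      change F.u.1.1 z = a.1 ⟨C.π z, z.2⟩ * F'.u.1.1 z
      rw [← h2, mul_assoc, mul_comm (F'.v.1.1 z), F'.inv, mul_one]))
    have h3 : mulLine he' F'.v w = a • mulLine he' F.v w :=
      Subtype.ext (Subtype.ext (funext fun z => by
        have h2 := ha z
        change F.u.1.1 z * F'.v.1.1 z = _ at h2
        change F'.v.1.1 z * w.1.1 z = a.1 ⟨C.π z, z.2⟩ * (F.v.1.1 z * w.1.1 z)
        have := F.inv z
        rw [← h2]
        linear_combination (-(F'.v.1.1 z * w.1.1 z)) * this))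
    change hev (hev H h F.u) le_rfl (mulLine he' F.v w) =
      hev (hev H h F'.u) le_rfl (mulLine he' F'.v w)
    rw [h1, h3, hev_map_smul, hev_smul, hev_map_smul]
    rfl
  choose N hN F using ht
  have F : ∀ y, C.Frame e (N y) := fun y => (F y).some
  have cov : ∀ V : Opens C.base, V ≤ ⨆ y, V ⊓ N y := fun V y hy =>
    Opens.mem_iSup.2 ⟨y, hy, hN y⟩
  have ex : ∀ (V : Opens C.base) (h : V ≤ U) (w : C.Line e'' V), ∃! t : MSec M V, ∀ y,
      mres M (inf_le_left : V ⊓ N y ≤ V) t =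
        loc (inf_le_left.trans h) ((F y).res inf_le_right) (resLine inf_le_left w) := fun V h w =>
    RSpace.Mod.glue (X := C.space) M (fun y => V ⊓ N y) (fun i => inf_le_left) (cov V) _
      fun i j => by
        refine (loc_res _ _ _ _).trans (Eq.trans ?_ (loc_res _ _ _ _).symm)
        exact loc_eq _ _ _ _
  choose t ht' huniq using ex
  have t_frame : ∀ {V : Opens C.base} (h : V ≤ U) (F : C.Frame e V) (w : C.Line e'' V),
      t V h w = loc h F w := fun {V} h F w => (huniq V h w _ fun y => by
    refine (loc_res _ _ _ _).trans ?_
    exact loc_eq _ _ _ _).symm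
  have t_res : ∀ {V V' : Opens C.base} (h : V ≤ U) (k : V' ≤ V) (w : C.Line e'' V),
      mres M k (t V h w) = t V' (k.trans h) (resLine k w) := fun {V V'} h k w => by
    refine huniq V' (k.trans h) _ _ fun y => ?_
    refine (RSpace.Mod.res_res (X := C.space) _ _ _).trans ?_
    have h1 := congrArg (mres M (inf_le_inf_right _ k : V' ⊓ N y ≤ V ⊓ N y)) (ht' V h w y)
    refine Eq.trans ?_ (h1.trans (loc_res _ _ _ _))
    exact (RSpace.Mod.res_res (X := C.space) _ _ _).symm
  refine ⟨mkSec ⟨t, fun V h u v => ?_, fun V h r u => ?_, fun h k u => (t_res h k u).symm⟩, ?_⟩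
  · refine (huniq V h _ _ fun y => ?_).symm
    refine (RSpace.Mod.res_add (X := C.space) _ _ _).trans ?_
    refine (congrArg₂ _ (ht' V h u y) (ht' V h v y)).trans ?_
    refine (hev_map_add _ _ _ _).symm.trans ?_
    exact congrArg _ (mulLine_add _ _ _ _).symm
  · refine (huniq V h _ _ fun y => ?_).symm
    refine (Cover.res_smul _ _ _).trans ?_
    refine (congrArg _ (ht' V h u y)).trans ?_
    refine (hev_map_smul _ _ _ _).symm.trans ?_
    exact congrArg _ (mulLine_smul _ _ _ _).symm
  · refine hom_sec_ext fun V k u => hom_sec_ext fun V' k' v => ?_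
    rw [hev_hev_split]
    refine RSpace.Mod.eq_of_res (X := C.space) M (fun y => V' ⊓ N y) (fun y => inf_le_left) (cov V')
      _ _ fun y => ?_
    refine (t_res (k'.trans k) _ _).trans ?_
    rw [t_frame _ ((F y).res inf_le_right)]
    set G : C.Frame e (V' ⊓ N y) := (F y).res inf_le_right with hG
    set u' : C.Line e (V' ⊓ N y) := resLine (inf_le_left.trans k') u with hu''
    obtain ⟨a, ha⟩ := hC.descend (mulLine hu' u' G.v)
    have h1 : u' = a • G.u := Subtype.ext (Subtype.ext (funext fun z => by
      have h2 := ha z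
      change u'.1.1 z * G.v.1.1 z = _ at h2
      change u'.1.1 z = a.1 ⟨C.π z, z.2⟩ * G.u.1.1 z
      rw [← h2, mul_assoc, mul_comm (G.v.1.1 z), G.inv, mul_one]))
    have h3 : mulLine he' G.v (mulLine he u' (resLine inf_le_left v)) =
        a • resLine inf_le_left v := Subtype.ext (Subtype.ext (funext fun z => by
      have h2 := ha z
      change u'.1.1 z * G.v.1.1 z = _ at h2
      change G.v.1.1 z * (u'.1.1 z * (resLine inf_le_left v).1.1 z) =
        a.1 ⟨C.π z, z.2⟩ * (resLine inf_le_left v).1.1 z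
      rw [← h2]
      ring))
    have h4 : mres M inf_le_left (hev (hev H k u) k' v) =
        hev (hev H (inf_le_left.trans (k'.trans k)) u') le_rfl
          (resLine (inf_le_left : V' ⊓ N y ≤ V') v) := by
      rw [hu'', hev_nat H k (inf_le_left.trans k') u, hev_res]
      exact (hev_nat (hev H k u) k' inf_le_left v).symm
    refine Eq.trans ?_ h4.symm
    change hev (hev H _ G.u) le_rfl (mulLine he' G.v (mulLine he u' (resLine inf_le_left v))) = _
    rw [h3, h1, hev_map_smul, hev_map_smul, hev_smul]
    rfl

theorem split_inj (hu : e⁻¹ * e = 1) (ht : C.LocTriv e) (U : Opens C.base) :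
    Function.Injective (mapp (split he M) U) := by
  intro f f' hf
  have he' := inv_mul_of_mul he hu
  choose N hN F using ht
  have F : ∀ y, C.Frame e (N y) := fun y => (F y).some
  refine hom_sec_ext fun V k w => ?_
  refine RSpace.Mod.eq_of_res (X := C.space) M (fun y => V ⊓ N y) (fun y => inf_le_left)
    (fun y hy => Opens.mem_iSup.2 ⟨y, hy, hN y⟩) _ _ fun y => ?_
  refine (hev_nat _ _ _ _).symm.trans (Eq.trans ?_ (hev_nat _ _ _ _))
  have h1 : resLine inf_le_left w = mulLine he ((F y).res (inf_le_right : V ⊓ N y ≤ _)).u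
      (mulLine he' ((F y).res inf_le_right).v (resLine inf_le_left w)) :=
    Subtype.ext (Subtype.ext (funext fun z => by
      have h2 := ((F y).res (inf_le_right : V ⊓ N y ≤ _)).inv z
      change (resLine inf_le_left w).1.1 z = _ * (_ * (resLine inf_le_left w).1.1 z)
      rw [← mul_assoc, h2, one_mul]))
  rw [h1]
  have h2 := congrArg (fun G => hev (hev G (inf_le_left.trans k)
    ((F y).res (inf_le_right : V ⊓ N y ≤ _)).u) le_rfl
      (mulLine he' ((F y).res inf_le_right).v (resLine inf_le_left w))) hf
  exact h2

/-- The isomorphism `Hom(L, Hom(L', -)) ≅ Hom(L'', -)` given by multiplication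
`L ⊗ L' → L''`. -/
def homComp (hC : C.Exact) (hu : e⁻¹ * e = 1) (ht : C.LocTriv e) :
    homFunctor e' ⋙ homFunctor e ≅ homFunctor e'' :=
  (NatIso.ofComponents (fun M => RSpace.Mod.isoOfBij (X := C.space) (split he M)
      fun U => ⟨split_inj he hu ht U, split_surj he hC hu ht U⟩)
    (fun f => RSpace.Mod.hom_ext (X := C.space) fun U m => rfl)).symm

theorem homComp_inv_app (hC : C.Exact) (hu : e⁻¹ * e = 1) (ht : C.LocTriv e) (M : C.space.Mod) :
    (homComp he hC hu ht).inv.app M = split he M := rfl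

/-- The isomorphism `Hom(O, -) ≅ -`. -/
def homOne {e : C.I → C.P → ℂ} (hC : C.Exact) (h1 : e = 1) :
    homFunctor e ≅ 𝟭 C.space.Mod := by
  subst h1
  have ev1 : ∀ U : Opens C.base, ((1 : C.Up U) : C.Up U) ∈ C.line 1 U := fun U i z z' _ => by simp
  let one : ∀ U : Opens C.base, C.Line 1 U := fun U => ⟨1, ev1 U⟩
  have smul_one : ∀ {U : Opens C.base} (u : C.Line 1 U), ∃ a : C.O U, u = a • one U :=
    fun {U} u => by
      obtain ⟨a, ha⟩ := hC.descend u
      refine ⟨a, Subtype.ext (Subtype.ext (funext fun z => (ha z).trans ?_))⟩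
      change _ = a.1 _ * 1
      rw [mul_one]
  have cancel : ∀ {U : Opens C.base} (a b : C.O U), a • one U = b • one U → a = b :=
    fun {U} a b hab => Subtype.ext (funext fun y => by
      obtain ⟨z, hz⟩ := hC.surj y.1
      have h1 := congrArg (fun u : C.Line 1 U => u.1.1 ⟨z, by rw [hz]; exact y.2⟩) hab
      change a.1 ⟨C.π z, _⟩ * 1 = b.1 ⟨C.π z, _⟩ * 1 at h1
      rw [mul_one, mul_one] at h1
      have hy : (⟨C.π z, by rw [hz]; exact y.2⟩ : U) = y := Subtype.ext hz
      rwa [hy] at h1)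
  choose co hco using @smul_one
  refine NatIso.ofComponents (fun M => RSpace.Mod.isoOfBij (X := C.space)
    (RSpace.Mod.mkHom (X := C.space) (homMod 1 M) M
      (fun U => AddMonoidHom.mk' (fun f => hev f le_rfl (one U)) fun f f' => rfl)
      (fun U r f => rfl) (fun {U V} h f => ?_)) fun U =>
        ⟨fun (f f' : MSec (homMod 1 M) U) hf => ?_, fun m => ?_⟩) ?_
  · exact hev_nat f le_rfl h (one V)
  · refine hom_sec_ext fun V k u => ?_
    change hev f le_rfl (one U) = hev f' le_rfl (one U) at hf
    rw [hco u, hev_map_smul, hev_map_smul]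
    refine congrArg _ ?_
    exact (hev_nat f le_rfl k (one U)).trans
      ((congrArg (mres M k) hf).trans (hev_nat f' le_rfl k (one U)).symm)
  · refine ⟨mkSec ⟨fun V h u => co u • mres M h m, fun V h u v => ?_, fun V h r u => ?_,
      fun {V V'} h k u => ?_⟩, ?_⟩
    · rw [← add_smul]
      congr 1
      apply cancel
      rw [add_smul, ← hco, ← hco, ← hco]
    · rw [← mul_smul]
      congr 1
      apply cancel
      rw [mul_smul, ← hco, ← hco]
    · refine Eq.trans ?_ (Cover.res_smul k (co u) _).symm
      congr 1
      · apply cancel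
        rw [← hco]
        exact congrArg (resLine k) (hco u)
      · exact (RSpace.Mod.res_res (X := C.space) _ _ _).symm
    · change co (one U) • mres M le_rfl m = m
      have h1 : co (one U) = 1 := by
        apply cancel
        rw [← hco, one_smul]
      rw [h1, one_smul]
      exact RSpace.Mod.res_self m
  · intro M N f
    exact RSpace.Mod.hom_ext (X := C.space) fun U m => rfl

/-- The action of a group `G` by the functors `- ⊗ L(k)⁻¹`, where `L(k)` is the line bundle with
multipliers `e k`. -/
def homAction {G : Type} [Group G] (e : G →* (C.I → C.P → ℂ)) (hC : C.Exact)
    (ht : ∀ k, C.LocTriv (e k)) : CatAction G C.space.Mod :=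
  have hu : ∀ k, (e k)⁻¹ * e k = 1 := fun k => by
    funext i z
    have h1 : e k⁻¹ * e k = 1 := by rw [← map_mul, inv_mul_cancel, map_one]
    have h2 : e k⁻¹ i z * e k i z = 1 := congrFun (congrFun h1 i) z
    exact inv_mul_cancel₀ (right_ne_zero_of_mul_eq_one h2)
  { act := fun k => homFunctor (e k)
    isEquivalence := isEquivalence_of_unit _
      (fun {g h k} hk => homComp (by rw [← map_mul, hk]) hC (hu g) (ht g)) (homOne hC (map_one e))
    additive := fun g => ⟨rfl⟩
    linear := fun g A B z f => rfl
    c := fun {g h k} hk => homComp (by rw [← map_mul, hk]) hC (hu g) (ht g)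
    assoc := fun {g h k gh hk ghk} e₁ e₂ e₃ e₄ A => by
      let c := fun {g h k : G} (hk : g * h = k) => homComp (C := C) (e := e g) (e' := e h)
        (e'' := e k) (by rw [← map_mul, hk]) hC (hu g) (ht g)
      have key : (c e₁).app ((homFunctor (e k)).obj A) ≪≫ (c e₃).app A =
          (homFunctor (e g)).mapIso ((c e₂).app A) ≪≫ (c e₄).app A := Iso.ext_inv
        (RSpace.Mod.hom_ext (X := C.space) fun U m => hom_sec_ext fun V k u =>
          hom_sec_ext fun V' k' v => hom_sec_ext fun V'' k'' w => congrArg (hev m _)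
            (Subtype.ext (mul_assoc (resLine (k''.trans k') u).1 (resLine k'' v).1 w.1)))
      exact congrArg Iso.hom key }

end Cover

/-! ### From twisted equivariant objects to modules over the twisted algebra -/

namespace Cover

variable {C : Cover} {G : Type} [CommGroup G] [Fintype G] {l : Bilin G}
  {e : G →* (C.I → C.P → ℂ)} {hC : C.Exact} {ht : ∀ k, C.LocTriv (e k)}

def StarOp.comp {W : Opens C.base} (a : C.StarOp l e W) (k : G) : C.Line (e k) W :=
  ⟨a.val k, a.val_mem k⟩

/-- The right multiplication `m * a = ∑ k, ρ_k(m)(a k)` of the twisted algebra on an object with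
a `λ`-twisted linearization `ρ_k : M → Hom(L k, M) = M ⊗ (L k)⁻¹`. -/
def starAct (A : TwistedEquivariant (homAction e hC ht) l.toFun) {U : Opens C.base}
    (a : C.StarOp l e U) (m : MSec A.obj U) : MSec A.obj U :=
  ∑ k : G, hev (e := e k) (M := A.obj) (mapp (A.rho k).hom U m) le_rfl (a.comp k)

variable (A : TwistedEquivariant (homAction e hC ht) l.toFun)

abbrev rhoEv {U : Opens C.base} (k : G) (m : MSec A.obj U) (u : C.Line (e k) U) : MSec A.obj U :=
  hev (e := e k) (M := A.obj) (mapp (A.rho k).hom U m) le_rfl u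

theorem rho_split {g h k : G} (hk : g * h = k) : (A.rho g).hom ≫ homMap (A.rho h).hom =
    (l.toFun g h : ℂ) • ((A.rho k).hom ≫ split (C := C) (e := e g) (e' := e h) (e'' := e k)
      (by rw [← map_mul, hk]) A.obj) := by
  have h1 := A.rho_rho hk
  have h2 := congrArg (fun f => f ≫ (((homAction e hC ht).c hk).inv.app A.obj)) h1
  simp only [Category.assoc, Iso.hom_inv_id_app, Linear.smul_comp] at h2
  exact (congrArg (fun f => (A.rho g).hom ≫ f) (Category.comp_id _)).symm.trans h2

theorem rhoEv_rhoEv {U : Opens C.base} {g h k : G} (hk : g * h = k) (m : MSec A.obj U)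
    (u : C.Line (e g) U) (v : C.Line (e h) U) :
    rhoEv A h (rhoEv A g m u) v = (algebraMap ℂ (C.O U) (l.toFun g h)) •
      rhoEv A k m (mulLine (by rw [← map_mul, hk]) u v) := by
  have h1 := congrArg (fun f => mapp f U m) (rho_split A hk)
  have h2 := congrArg (fun F : MSec (homMod (e g) (homMod (e h) A.obj)) U =>
    hev (hev F le_rfl u) le_rfl v) h1
  refine h2.trans ?_
  exact congrArg (fun r : C.O U => r • rhoEv A k m (mulLine (by rw [← map_mul, hk]) u v))
    (rfl : resO le_rfl (resO le_rfl (algebraMap ℂ (C.O U) (l.toFun g h))) = _)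

theorem rhoEv_one {U : Opens C.base} (m : MSec A.obj U) (u : C.Line (e 1) U)
    (hu : ∀ z, u.1.1 z = 1) : rhoEv A 1 m u = m := by
  have h1 : ∀ m, rhoEv A 1 (rhoEv A 1 m u) u = rhoEv A 1 m u := fun m => by
    rw [rhoEv_rhoEv A (mul_one 1), l.one_left]
    have h2 : mulLine (by rw [← map_mul, mul_one]) u u = u :=
      Subtype.ext (Subtype.ext (funext fun z => by
        change u.1.1 z * u.1.1 z = u.1.1 z
        rw [hu, mul_one]))
    rw [h2, Units.val_one, _root_.map_one, one_smul]
  have inj : Function.Injective fun m => rhoEv A 1 m u := by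
    intro m m' hm
    have gen : ∀ F F' : MSec (homMod (e 1) A.obj) U, hev F le_rfl u = hev F' le_rfl u → F = F' := by
      intro F F' hF
      refine hom_sec_ext fun V k v => ?_
      obtain ⟨a, ha⟩ := hC.descend (W := V) ⟨v.1, by rw [← map_one e]; exact v.2⟩
      have hv : v = a • resLine k u := Subtype.ext (Subtype.ext (funext fun z => by
        refine (ha z).trans ?_
        change _ = a.1 _ * u.1.1 _
        rw [hu, mul_one]))
      rw [hv, hev_map_smul, hev_map_smul]
      refine congrArg _ ?_
      refine (hev_nat F le_rfl k u).trans (Eq.trans ?_ (hev_nat F' le_rfl k u).symm)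
      exact congrArg (mres A.obj k) hF
    have h3 : mapp (A.rho 1).hom U m = mapp (A.rho 1).hom U m' := gen _ _ hm
    have h4 := congrArg (mapp (A.rho 1).inv U) h3
    have h5 : ∀ m, mapp (A.rho 1).inv U (mapp (A.rho 1).hom U m) = m := fun m =>
      congrArg (fun f => mapp f U m) (A.rho 1).hom_inv_id
    rwa [h5, h5] at h4
  exact inj (h1 m)

theorem rhoEv_add {U : Opens C.base} (k : G) (m m' : MSec A.obj U) (u : C.Line (e k) U) :
    rhoEv A k (m + m') u = rhoEv A k m u + rhoEv A k m' u := by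
  rw [rhoEv, _root_.map_add]
  rfl

theorem rhoEv_zero {U : Opens C.base} (k : G) (u : C.Line (e k) U) :
    rhoEv A k (0 : MSec A.obj U) u = 0 := by
  have := rhoEv_add A k 0 0 u
  rw [add_zero] at this
  exact left_eq_add.1 this

theorem rhoEv_sum {U : Opens C.base} {ι : Type} (s : Finset ι) (k : G) (m : ι → MSec A.obj U)
    (u : C.Line (e k) U) : rhoEv A k (∑ i ∈ s, m i) u = ∑ i ∈ s, rhoEv A k (m i) u :=
  map_sum (AddMonoidHom.mk' (fun m => rhoEv A k m u) fun m m' => rhoEv_add A k m m' u) m s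

theorem rhoEv_add' {U : Opens C.base} (k : G) (m : MSec A.obj U) (u v : C.Line (e k) U) :
    rhoEv A k m (u + v) = rhoEv A k m u + rhoEv A k m v :=
  hev_map_add _ _ _ _

theorem rhoEv_smul {U : Opens C.base} (k : G) (r : C.O U) (m : MSec A.obj U) (u : C.Line (e k) U) :
    rhoEv A k m (r • u) = r • rhoEv A k m u :=
  hev_map_smul _ _ _ _

theorem rhoEv_sum' {U : Opens C.base} {ι : Type} (s : Finset ι) (k : G) (m : MSec A.obj U)
    (u : ι → C.Line (e k) U) : rhoEv A k m (∑ i ∈ s, u i) = ∑ i ∈ s, rhoEv A k m (u i) :=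
  map_sum (AddMonoidHom.mk' (fun u => rhoEv A k m u) fun u u' => rhoEv_add' A k m u u') u s

theorem starAct_eq {U : Opens C.base} (a : C.StarOp l e U) (m : MSec A.obj U) :
    starAct A a m = ∑ k : G, rhoEv A k m (a.comp k) := rfl

theorem comp_mul {U : Opens C.base} (a b : C.StarOp l e U) (k : G) :
    (a * b).comp k = ∑ j : G, (algebraMap ℂ (C.O U) (l.toFun j (j⁻¹ * k))) •
      mulLine (by rw [← map_mul, mul_inv_cancel_left]) (b.comp j) (a.comp (j⁻¹ * k)) := by
  have h : ∀ (s : Finset G) (f : G → C.Line (e k) U),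
      (∑ j ∈ s, f j).1 = ∑ j ∈ s, (f j).1 := fun s f =>
    map_sum (AddMonoidHom.mk' (fun x : C.Line (e k) U => x.1) fun _ _ => rfl) f s
  refine Subtype.ext ((h _ _).trans ?_).symm
  refine Finset.sum_congr rfl fun j _ => ?_
  rfl

instance starModule (U : Opens C.base) : Module (C.StarOp l e U) (MSec A.obj U) where
  smul a m := starAct A a m
  one_smul m := by
    classical
    refine (Finset.sum_eq_single (M := MSec A.obj U) (1 : G) (fun k _ hk => ?_)
      fun h => (h (Finset.mem_univ _)).elim).trans ?_
    · have h0 : (1 : C.StarOp l e U).comp k = 0 := Subtype.ext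
        ((Bilin.one_apply l k).trans (if_neg hk))
      rw [h0]
      have := rhoEv_add' A k m 0 0
      rw [add_zero] at this
      exact left_eq_add.1 this
    · refine rhoEv_one A m _ fun z => ?_
      have h1 : (1 : C.StarOp l e U).val 1 = 1 := (Bilin.one_apply l 1).trans (if_pos rfl)
      exact congrArg (fun f : C.Up U => f.1 z) h1
  mul_smul a b m := by
    change starAct A (a * b) m = starAct A a (starAct A b m)
    simp only [starAct_eq, comp_mul, rhoEv_sum, rhoEv_sum', rhoEv_smul]
    rw [Finset.sum_comm (s := Finset.univ) (t := Finset.univ)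
      (f := fun k j => rhoEv A k (rhoEv A j m (b.comp j)) (a.comp k)), Finset.sum_comm]
    refine Finset.sum_congr rfl fun j _ => ?_
    rw [← Equiv.sum_comp (Equiv.mulLeft j)]
    refine Finset.sum_congr rfl fun k _ => ?_
    rw [rhoEv_rhoEv A (rfl : j * k = j * k)]
    have hk : j⁻¹ * (j * k) = k := inv_mul_cancel_left j k
    have key : ∀ (k' : G) (hk' : k' = k) (h : e j * e k' = e (j * k)),
        (algebraMap ℂ (C.O U) (l.toFun j k')) • rhoEv A (j * k) m
          (mulLine h (b.comp j) (a.comp k')) =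
        (algebraMap ℂ (C.O U) (l.toFun j k)) • rhoEv A (j * k) m
          (mulLine (by rw [← map_mul]) (b.comp j) (a.comp k)) := by
      rintro k' rfl h
      rfl
    exact key _ hk _
  smul_zero a := by
    change starAct A a 0 = 0
    rw [starAct_eq]
    exact Finset.sum_eq_zero fun k _ => rhoEv_zero A k _
  smul_add a m m' := by
    change starAct A a (m + m') = starAct A a m + starAct A a m'
    simp only [starAct_eq, rhoEv_add, Finset.sum_add_distrib]
  add_smul a b m := by
    change starAct A (a + b) m = starAct A a m + starAct A b m
    simp only [starAct_eq]
    rw [← Finset.sum_add_distrib]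
    exact Finset.sum_congr rfl fun k _ => rhoEv_add' A k m (a.comp k) (b.comp k)
  zero_smul m := by
    change starAct A 0 m = 0
    refine Finset.sum_eq_zero fun k _ => ?_
    have := rhoEv_add' A k m 0 0
    rw [add_zero] at this
    exact left_eq_add.1 this

theorem star_smul_def {U : Opens C.base} (a : C.StarOp l e U) (m : MSec A.obj U) :
    a • m = ∑ k : G, rhoEv A k m (a.comp k) := rfl

def toStarData : ModPresheafData (C.starSpace l e) where
  sec U := MSec A.obj U
  grp U := inferInstanceAs (AddCommGroup (MSec A.obj U))
  mod U := inferInstanceAs (Module (C.StarOp l e U) (MSec A.obj U))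
  res {U V} h := AddMonoidHom.mk' (fun m => mres A.obj h m)
    fun m n => RSpace.Mod.res_add (X := C.space) h m n
  res_self U a := RSpace.Mod.res_self (X := C.space) a
  res_res h h' a := RSpace.Mod.res_res (X := C.space) h h' a
  res_smul {U V} h r m := by
    change mres A.obj h (∑ k : G, rhoEv A k m (StarOp.comp r k)) = ∑ k : G, _
    refine (map_sum (AddMonoidHom.mk' (fun m => mres A.obj h m)
      fun m n => RSpace.Mod.res_add (X := C.space) h m n) _ _).trans ?_
    refine Finset.sum_congr rfl fun k _ => ?_
    refine (hev_nat (e := e k) (M := A.obj) (mapp (A.rho k).hom V m) le_rfl h _).symm.trans ?_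
    refine Eq.trans ?_ (congrArg (fun f => hev (e := e k) (M := A.obj) f le_rfl
      (resLine h (StarOp.comp r k))) (RSpace.Mod.app_res (X := C.space) (A.rho k).hom h m).symm)
    rfl

variable (C l e hC ht) in
/-- A `λ`-twisted equivariant object for the action by the functors `- ⊗ (L k)⁻¹` is the same as a
right module over the twisted algebra `⨁ k, L k`. -/
def toStar : TwistedEquivariant (homAction e hC ht) l.toFun ⥤ (C.starSpace l e).Mod where
  obj A := (toStarData A).toMod fun U s hs =>
    RSpace.Mod.glue (X := C.space) A.obj U (le_iSup U) le_rfl s hs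
  map {A B} f := RSpace.Mod.mkHom (X := C.starSpace l e) _ _ (fun U => mapp f.hom U)
    (fun U r m => by
      change mapp f.hom U (∑ k : G, rhoEv A k m (StarOp.comp r k)) =
        ∑ k : G, rhoEv B k (mapp f.hom U m) (StarOp.comp r k)
      rw [map_sum]
      refine Finset.sum_congr rfl fun k _ => ?_
      have h1 := congrArg (fun F => mapp F U m) (f.comm k)
      exact congrArg (fun F => hev (e := e k) (M := B.obj) F le_rfl (StarOp.comp r k)) h1)
    (fun h m => RSpace.Mod.app_res (X := C.space) f.hom h m)
  map_id A := RSpace.Mod.hom_ext (X := C.starSpace l e) fun U m => rfl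
  map_comp f f' := RSpace.Mod.hom_ext (X := C.starSpace l e) fun U m => rfl

end Cover

/-! ### Holomorphic maps and translations -/

/-- A morphism between spaces with sheaves of rings given by their sections. -/
def RingSheafData.mkRHom {X Y : TopCat.{0}} (D : RingSheafData X) (D' : RingSheafData Y) (b : X ⟶ Y)
    (φ : ∀ U : Opens Y, D'.sec U →+* D.sec ((Opens.map b).obj U))
    (hn : ∀ {U V : Opens Y} (h : U ≤ V) (a : D'.sec V),
      φ U (D'.res h a) = D.res ((Opens.map b).map (homOfLE h)).le (φ V a)) :
    RHom D.toRSpace D'.toRSpace where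
  base := b
  sh := ⟨{ app := fun U => RingCat.ofHom (φ U.unop)
           naturality := fun U V f => by
             ext a
             exact hn f.unop.le a }⟩

/-- A map between two covered spaces, lifted to a holomorphic map of their covers. -/
structure CoverHom (C D : Cover) where
  up : C.P → D.P
  base : C.base ⟶ D.base
  comm : ∀ z, D.π (up z) = base (C.π z)
  cont : Continuous up
  holo : ∀ z, ∃ L : (C.ι → ℂ) → (D.ι → ℂ), AnalyticAt ℂ L (C.co z) ∧
    ∀ᶠ z' in 𝓝 z, D.co (up z') = L (C.co z')

namespace CoverHom

variable {C D : Cover} (f : CoverHom C D)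

abbrev pre (W : Opens D.base) : Opens C.base := (Opens.map f.base).obj W

theorem mem_pre {W : Opens D.base} {z : C.P} (h : C.π z ∈ f.pre W) : D.π (f.up z) ∈ W := by
  rw [f.comm]; exact h

/-- Pull-back of holomorphic functions on the covers. -/
def onUp (W : Opens D.base) : D.Up W →ₐ[ℂ] C.Up (f.pre W) where
  toFun a := ⟨fun z => a.1 ⟨f.up z, f.mem_pre z.2⟩, fun z => by
    obtain ⟨F, hF, h1⟩ := a.2 ⟨f.up z, f.mem_pre z.2⟩
    obtain ⟨L, hL, h2⟩ := f.holo z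
    have h3 : D.co (f.up z) = L (C.co z) := h2.self_of_nhds
    refine ⟨F ∘ L, AnalyticAt.comp (by rw [← h3]; exact hF) hL, ?_⟩
    filter_upwards [f.cont.continuousAt.eventually h1, h2] with z' h4 h5 h6
    rw [h4 (f.mem_pre h6), h5]
    rfl⟩
  map_one' := rfl
  map_mul' _ _ := rfl
  map_zero' := rfl
  map_add' _ _ := rfl
  commutes' _ := rfl

/-- Pull-back of holomorphic functions. -/
def onO (W : Opens D.base) : D.O W →+* C.O (f.pre W) where
  toFun a := ⟨fun y => a.1 ⟨f.base y, y.2⟩, by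
    have h := (f.onUp W (algebraMap _ _ a)).2
    change Cover.lift (f.pre W) (fun y => a.1 ⟨f.base y, y.2⟩) ∈ C.Up (f.pre W)
    convert h using 1
    funext z
    exact congrArg a.1 (Subtype.ext (f.comm z).symm)⟩
  map_one' := rfl
  map_mul' _ _ := rfl
  map_zero' := rfl
  map_add' _ _ := rfl

def toRHom : RHom C.space D.space :=
  C.ringData.mkRHom D.ringData f.base (fun W => f.onO W) (fun _ _ => rfl)

/-- Pull-back maps sections of the line bundle with multipliers `e'` to sections of the line bundle
with multipliers `e`. -/
def Compat (e' : D.I → D.P → ℂ) (e : C.I → C.P → ℂ) : Prop :=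
  ∀ (W : Opens D.base) (a : D.Up W), a ∈ D.line e' W → f.onUp W a ∈ C.line e (f.pre W)

variable {G : Type} [CommGroup G] [Fintype G] (l : Bilin G)
  {e : G →* (C.I → C.P → ℂ)} {e' : G →* (D.I → D.P → ℂ)}

def onStar (h : ∀ k, f.Compat (e' k) (e k)) (W : Opens D.base) :
    D.StarOp l e' W →+* C.StarOp l e (f.pre W) :=
  RingHom.op ((Bilin.Twisted.map l (f.onUp W)).restrict (D.Star l e' W) (C.Star l e (f.pre W))
    fun a ha k => h k W (a k) (ha k))

/-- The morphism of noncommutative ringed spaces given by pull-back of functions. -/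
def toStarRHom (h : ∀ k, f.Compat (e' k) (e k)) : RHom (C.starSpace l e) (D.starSpace l e') :=
  (C.starData l e).mkRHom (D.starData l e') f.base (fun W => f.onStar l h W) (fun _ _ => rfl)

/-- `g_* f_* = h_*` if `g ∘ f = h`. -/
def pushIso {E : Cover} (f : CoverHom C D) (g : CoverHom D E) (h : CoverHom C E)
    (hb : f.base ≫ g.base = h.base) :
    f.toRHom.push ⋙ g.toRHom.push ≅ h.toRHom.push :=
  RHom.pushIso _ _ _ hb fun U a => by
    refine Subtype.ext (funext fun y => ?_)
    refine congrArg a.1 (Subtype.ext ?_)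
    exact ConcreteCategory.congr_hom hb y.1

/-- `g_* f_* = h_*` if `g ∘ f = h`, for the noncommutative spaces. -/
def starPushIso {E : Cover} {e'' : G →* (E.I → E.P → ℂ)} (f : CoverHom C D) (g : CoverHom D E)
    (h : CoverHom C E) (hf : ∀ k, f.Compat (e' k) (e k)) (hg : ∀ k, g.Compat (e'' k) (e' k))
    (hh : ∀ k, h.Compat (e'' k) (e k))
    (hb : f.base ≫ g.base = h.base) (hu : ∀ z, g.up (f.up z) = h.up z) :
    (f.toStarRHom l hf).push ⋙ (g.toStarRHom l hg).push ≅ (h.toStarRHom l hh).push :=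
  RHom.pushIso _ _ _ hb fun U a => by
    refine MulOpposite.unop_injective (Subtype.ext (funext fun k =>
      Subtype.ext (funext fun z => ?_)))
    refine congrArg (Subtype.val (Cover.StarOp.val a k)) (Subtype.ext ?_)
    exact hu z.1

/-- `f_* = id` if `f` is the identity of the base. -/
def pushOne (f : CoverHom C C) (hb : ∀ y, f.base y = y) : f.toRHom.push ≅ 𝟭 C.space.Mod :=
  have le1 : ∀ U : Opens C.base, U ≤ f.pre U := fun U y hy => by
    change f.base y ∈ U
    rw [hb]; exact hy
  have le2 : ∀ U : Opens C.base, f.pre U ≤ U := fun U y hy => by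
    change f.base y ∈ U at hy
    rw [hb] at hy; exact hy
  NatIso.ofComponents (fun M => RSpace.Mod.isoOfBij (X := C.space)
    (RSpace.Mod.mkHom (X := C.space) (f.toRHom.push.obj M) M
      (fun U => AddMonoidHom.mk' (fun m => M.res (le1 U) (show M.Sec (f.pre U) from m))
        fun m n => RSpace.Mod.res_add (X := C.space) (le1 U) m n)
      (fun U r m => by
        refine (Cover.res_smul (le1 U) (f.onO U r) (show M.Sec (f.pre U) from m)).trans ?_
        refine congrArg (fun s : C.O U => s • _) (Subtype.ext (funext fun y => ?_))
        exact congrArg (Subtype.val (show C.O U from r)) (Subtype.ext (hb y.1)))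
      (fun {U V} h m => (RSpace.Mod.res_res (X := C.space) (M := M) _ _ _).trans
        (RSpace.Mod.res_res (X := C.space) (M := M) _ _ _).symm))
    fun U => Function.bijective_iff_has_inverse.2 ⟨fun m => M.res (le2 U) m,
      fun m => (RSpace.Mod.res_res (X := C.space) (M := M) _ _ _).trans
        (RSpace.Mod.res_self (X := C.space) _),
      fun m => (RSpace.Mod.res_res (X := C.space) (M := M) _ _ _).trans
        (RSpace.Mod.res_self (X := C.space) _)⟩)
    fun {M N} φ => RSpace.Mod.hom_ext (X := C.space) fun U m =>
      (RSpace.Mod.app_res (X := C.space) φ (le1 U) m).symm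

end CoverHom

/-- The action of a group `G` by the functors `(τ g)_*`, for a (left) action `τ` of `G` on a space by
holomorphic maps. -/
def pushAction {C : Cover} {G : Type} [Group G] (τ : G → CoverHom C C)
    (one : ∀ y, (τ 1).base y = y)
    (mul : ∀ {g h k : G}, g * h = k → (τ h).base ≫ (τ g).base = (τ k).base) :
    CatAction G C.space.Mod where
  act g := (τ g).toRHom.push
  isEquivalence := isEquivalence_of_unit _
    (fun {g h k} hk => (τ h).pushIso (τ g) (τ k) (mul hk)) ((τ 1).pushOne one)
  additive g := ⟨rfl⟩
  linear g A B z f := rfl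
  c {g h k} hk := (τ h).pushIso (τ g) (τ k) (mul hk)
  assoc {g h k gh hk ghk} e₁ e₂ e₃ e₄ A := RSpace.Mod.hom_ext (X := C.space) fun U m =>
    (RSpace.Mod.res_res (X := C.space) (M := A) _ _ _).trans
      (RSpace.Mod.res_res (X := C.space) (M := A) _ _ _).symm

/-! ### Complex tori and deformation parameters at roots of unity -/

/-- The algebraic torus `T = (ℂˣ)^g`. -/
abbrev Tor (g : ℕ) : Type := Fin g → ℂˣ

/-- The character group `ℤ^g` of `T`, written multiplicatively. -/
abbrev That (g : ℕ) : Type := Multiplicative (Fin g → ℤ)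

/-- The value `t(x) = ∏ x_i ^ t_i` of a character. -/
def mono {g : ℕ} : That g →* Tor g →* ℂˣ where
  toFun t :=
    { toFun := fun x => ∏ i, x i ^ t.toAdd i
      map_one' := by simp
      map_mul' := fun x y => by simp [mul_zpow, Finset.prod_mul_distrib] }
  map_one' := by ext; simp
  map_mul' s t := by ext x; simp [zpow_add, Finset.prod_mul_distrib]

/-- A complex torus `X = T / Γ`, where `Γ` is a discrete subgroup of `T = (ℂˣ)^g` which is free with
basis `period 0, …, period (g - 1)`. -/
structure Torus (g : ℕ) where
  period : Fin g → Tor g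
  indep : ∀ n : Fin g → ℤ, ∏ j, period j ^ n j = 1 → n = 0
  disc : DiscreteTopology (Subgroup.closure (Set.range period))

/-- A deformation parameter at roots of unity: a 2-cocycle of the character group of `T` with values
in the `N`-th roots of unity. -/
structure DefParam (g : ℕ) where
  coc : That g → That g → ℂˣ
  cocycle : ∀ a b c, coc b c * coc a (b * c) = coc (a * b) c * coc a b
  N : ℕ
  pos : 0 < N
  pow : ∀ a b, coc a b ^ N = 1

namespace DefParam

variable {g : ℕ} (d : DefParam g)

/-- The alternating bicharacter corresponding to the class of the cocycle. -/
def alt (s t : That g) : ℂˣ := d.coc s t / d.coc t s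

theorem alt_mul (a b c : That g) : d.alt (a * b) c = d.alt a c * d.alt b c := by
  have h1 := congrArg Units.val (d.cocycle a b c)
  have h2 := congrArg Units.val (d.cocycle c a b)
  have h3 := congrArg Units.val (d.cocycle a c b)
  rw [mul_comm c a] at h2
  rw [mul_comm c b] at h3
  rw [alt, alt, alt, div_mul_div_comm, div_eq_div_iff_mul_eq_mul]
  ext
  simp only [Units.val_mul] at h1 h2 h3 ⊢
  have hA : (d.coc a b : ℂ) * (d.coc (a * c) b : ℂ) ≠ 0 :=
    mul_ne_zero (Units.ne_zero _) (Units.ne_zero _)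
  apply mul_right_cancel₀ hA
  linear_combination (-(d.coc c a : ℂ) * d.coc c b * d.coc (a * c) b) * h1
    - ((d.coc a c : ℂ) * d.coc b c * d.coc (a * c) b) * h2
    + ((d.coc b c : ℂ) * d.coc c a * d.coc (a * c) b) * h3

/-- The subgroup `Ĥ` of characters on which the alternating bicharacter vanishes. -/
def Hh : Subgroup (That g) where
  carrier := {t | ∀ t', d.alt t t' = 1}
  mul_mem' ha hb t := by rw [alt_mul, ha, hb, mul_one]
  one_mem' t := by
    have := d.alt_mul 1 1 t
    rwa [mul_one, left_eq_mul] at this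
  inv_mem' {a} ha t := by
    have h1 : d.alt 1 t = 1 := by
      have := d.alt_mul 1 1 t
      rwa [mul_one, left_eq_mul] at this
    have := d.alt_mul a a⁻¹ t
    rw [mul_inv_cancel, ha, one_mul] at this
    rw [← this, h1]

/-- The finite group `K̂`. -/
abbrev Kh : Type := That g ⧸ d.Hh

theorem pow_mem (t : That g) : t ^ d.N ∈ d.Hh := by
  intro t'
  have h : ∀ n : ℕ, d.alt (t ^ n) t' = d.alt t t' ^ n := by
    intro n
    induction n with
    | zero => rw [pow_zero, pow_zero]; exact d.Hh.one_mem t'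
    | succ n ih => rw [pow_succ, alt_mul, ih, pow_succ]
  rw [h, alt, div_pow, d.pow, d.pow, div_one]

instance : Finite d.Kh := by
  haveI : Group.FG (That g) := inferInstance
  haveI : Group.FG d.Kh := QuotientGroup.fg d.Hh
  refine CommGroup.finite_of_fg_torsion _ fun k => ?_
  induction k using QuotientGroup.induction_on with
  | H t =>
    refine isOfFinOrder_iff_pow_eq_one.2 ⟨d.N, d.pos, ?_⟩
    exact (QuotientGroup.eq_one_iff _).2 (d.pow_mem t)

instance : Fintype d.Kh := Fintype.ofFinite _

/-- The subgroup `K` of `T`, dual to `K̂`. -/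
def K : Subgroup (Tor g) where
  carrier := {x | ∀ h ∈ d.Hh, mono h x = 1}
  mul_mem' ha hb h hh := by rw [map_mul, ha h hh, hb h hh, mul_one]
  one_mem' h _ := map_one _
  inv_mem' ha h hh := by rw [map_inv, ha h hh, inv_one]

/-- The pairing of `K̂` and `K`. -/
def pair : d.Kh →* d.K →* ℂˣ :=
  QuotientGroup.lift d.Hh
    { toFun := fun t => (mono t).comp d.K.subtype
      map_one' := by rw [map_one]; rfl
      map_mul' := fun s t => by rw [map_mul]; rfl }
    fun h hh => MonoidHom.ext fun x => x.2 h hh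

end DefParam

namespace Torus

variable {g : ℕ} (X : Torus g) (d : DefParam g)

/-- The restriction of characters of `T` to `Γ`; a character of `Γ` is given by its values on the
basis. -/
def res : That g →* Tor g where
  toFun t := fun j => mono t (X.period j)
  map_one' := by ext; simp
  map_mul' s t := by ext; simp

/-- The subgroup `ΓK` of `T`. -/
def GK : Subgroup (Tor g) := Subgroup.closure (Set.range X.period) ⊔ d.K

/-- The complex torus `Y = T / ΓK = X / K`. -/
abbrev Y : Type := Tor g ⧸ X.GK d

/-- The dual torus `Ŷ`, the quotient of the group of characters of `Γ` by those which come from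
`Ĥ`. -/
abbrev Yh : Type := Tor g ⧸ d.Hh.map X.res

theorem period_mem (j : Fin g) : X.period j ∈ X.GK d :=
  Subgroup.mem_sup_left (Subgroup.subset_closure ⟨j, rfl⟩)

theorem K_mem (κ : d.K) : (κ : Tor g) ∈ X.GK d := Subgroup.mem_sup_right κ.2

/-- The homomorphism from `K̂` to `Ŷ`. -/
def kap : d.Kh →* X.Yh d :=
  QuotientGroup.map d.Hh (d.Hh.map X.res) X.res (Subgroup.le_comap_map _ _)

def coverY : Cover where
  ι := Fin g
  P := Tor g
  base := TopCat.of (X.Y d)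
  π := QuotientGroup.mk
  cont := QuotientGroup.continuous_mk
  co x i := (x i : ℂ)
  I := Fin g ⊕ d.K
  move := Sum.elim (fun j x => x * X.period j) (fun κ x => x * κ)
  π_move := by
    rintro (j | κ) x
    · exact (QuotientGroup.mk_mul_of_mem _ (X.period_mem d j))
    · exact (QuotientGroup.mk_mul_of_mem _ (X.K_mem d κ))

def coverYh : Cover where
  ι := Fin g
  P := Tor g
  base := TopCat.of (X.Yh d)
  π := QuotientGroup.mk
  cont := QuotientGroup.continuous_mk
  co x i := (x i : ℂ)
  I := d.Hh
  move h x := x * X.res h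
  π_move h x := QuotientGroup.mk_mul_of_mem _ (Subgroup.mem_map_of_mem _ h.2)

def coverYY : Cover where
  ι := Fin g ⊕ Fin g
  P := Tor g × Tor g
  base := TopCat.of (X.Y d × X.Yh d)
  π z := (QuotientGroup.mk z.1, QuotientGroup.mk z.2)
  cont := (QuotientGroup.continuous_mk.comp continuous_fst).prodMk
    (QuotientGroup.continuous_mk.comp continuous_snd)
  co z := Sum.elim (fun i => (z.1 i : ℂ)) (fun i => (z.2 i : ℂ))
  I := Fin g ⊕ d.K ⊕ d.Hh
  move := Sum.elim (fun j z => (z.1 * X.period j, z.2))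
    (Sum.elim (fun κ z => (z.1 * κ, z.2)) (fun h z => (z.1, z.2 * X.res h)))
  π_move := by
    rintro (j | κ | h) z
    · exact Prod.ext (QuotientGroup.mk_mul_of_mem _ (X.period_mem d j)) rfl
    · exact Prod.ext (QuotientGroup.mk_mul_of_mem _ (X.K_mem d κ)) rfl
    · exact Prod.ext rfl (QuotientGroup.mk_mul_of_mem _ (Subgroup.mem_map_of_mem _ h.2))

/-- The multipliers of the line bundles `L k` on `Y`: sections of `L k` are `Γ`-invariant functions
`f` on `T` with `f (x κ) = k(κ) f x` for `κ ∈ K`. -/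
def eY : d.Kh →* ((X.coverY d).I → (X.coverY d).P → ℂ) where
  toFun k := Sum.elim (fun _ _ => 1) (fun κ _ => (d.pair k κ : ℂ))
  map_one' := by
    funext i z
    rcases i with j | κ <;> simp <;> rfl
  map_mul' k k' := by
    funext i z
    rcases i with j | κ
    · exact (mul_one (1 : ℂ)).symm
    · change ((d.pair (k * k') κ : ℂˣ) : ℂ) = d.pair k κ * d.pair k' κ
      simp

/-- The multipliers of the pull-backs of the line bundles `L k` to `Y × Ŷ`. -/
def eYY : d.Kh →* ((X.coverYY d).I → (X.coverYY d).P → ℂ) where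
  toFun k := Sum.elim (fun _ _ => 1) (Sum.elim (fun κ _ => (d.pair k κ : ℂ)) (fun _ _ => 1))
  map_one' := by
    funext i z
    rcases i with j | κ | h <;> simp <;> rfl
  map_mul' k k' := by
    funext i z
    rcases i with j | κ | h
    · exact (mul_one (1 : ℂ)).symm
    · change ((d.pair (k * k') κ : ℂˣ) : ℂ) = d.pair k κ * d.pair k' κ
      simp
    · exact (mul_one (1 : ℂ)).symm

/-- The multipliers of the Poincaré bundle on `Y × Ŷ`: its sections are the functions `φ` with
`φ (x γ, χ) = χ(γ)⁻¹ φ (x, χ)`, `φ (x κ, χ) = φ (x, χ)` and `φ (x, χ h) = h(x)⁻¹ φ (x, χ)` for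
`γ ∈ Γ`, `κ ∈ K` and `h ∈ Ĥ`. -/
def eQ : (X.coverYY d).I → (X.coverYY d).P → ℂ :=
  Sum.elim (fun j z => ((z.2 j)⁻¹ : ℂˣ))
    (Sum.elim (fun _ _ => 1) (fun h z => ((mono (h : That g) z.1)⁻¹ : ℂˣ)))

end Torus

namespace Torus

variable {g : ℕ} (X : Torus g) (d : DefParam g)

/-- Points of `T` which are in the same orbit of `ΓK`. -/
def Rel (a b : Tor g) : Prop :=
  Relation.EqvGen (fun a b => ∃ i, b = (X.coverY d).move i a) a b

theorem rel_mul {a : Tor g} (ha : a ∈ Subgroup.closure (Set.range X.period)) :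
    ∀ w : Tor g, X.Rel d w (w * a) := by
  induction ha using Subgroup.closure_induction with
  | mem x hx =>
    obtain ⟨j, rfl⟩ := hx
    intro w
    exact Relation.EqvGen.rel _ _ ⟨Sum.inl j, rfl⟩
  | one =>
    intro w
    rw [mul_one]
    exact Relation.EqvGen.refl _
  | mul x y _ _ hx hy =>
    intro w
    rw [← mul_assoc]
    exact Relation.EqvGen.trans _ _ _ (hx w) (hy _)
  | inv x _ hx =>
    intro w
    have := hx (w * x⁻¹)
    rw [inv_mul_cancel_right] at this
    exact Relation.EqvGen.symm _ _ this

theorem rel_of_eq {z z' : Tor g} (h : (z : X.Y d) = z') : X.Rel d z z' := by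
  have hm : z⁻¹ * z' ∈ X.GK d := QuotientGroup.eq.1 h
  obtain ⟨a, ha, b, hb, hab⟩ := Subgroup.mem_sup.1 hm
  have h2 : X.Rel d (z * a) (z * a * b) := Relation.EqvGen.rel _ _ ⟨Sum.inr ⟨b, hb⟩, rfl⟩
  have h3 : z * a * b = z' := by rw [mul_assoc, hab, mul_inv_cancel_left]
  rw [h3] at h2
  exact Relation.EqvGen.trans _ _ _ (X.rel_mul d ha z) h2

theorem exact_coverY : (X.coverY d).Exact where
  surj := (QuotientGroup.mk_surjective : Function.Surjective (QuotientGroup.mk : Tor g → X.Y d))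
  orbit := fun (z z' : Tor g) h => X.rel_of_eq d (z := z) (z' := z') h

/-- A point of the cover of `Y`, as an element of `T`. -/
def pt {V : Opens (X.coverY d).base} (z : (X.coverY d).Pre V) : Tor g := z.1

theorem K_pow {x : Tor g} (hx : x ∈ d.K) : x ^ d.N = 1 := by
  funext i
  have h := hx _ (d.pow_mem (Multiplicative.ofAdd (Pi.single i 1)))
  rw [map_pow] at h
  have h1 : mono (Multiplicative.ofAdd (Pi.single i (1 : ℤ))) x = x i := by
    change ∏ j, x j ^ (Pi.single i (1 : ℤ) : Fin g → ℤ) j = x i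
    rw [Finset.prod_eq_single i]
    · simp
    · intro j _ hj
      simp [hj]
    · simp
  rw [MonoidHom.pow_apply, h1] at h
  exact h

theorem eq_one_of_pow {x : Tor g} (hx : x ∈ Subgroup.closure (Set.range X.period))
    (h : x ^ d.N = 1) : x = 1 := by
  obtain ⟨n, rfl⟩ := Subgroup.exists_of_mem_closure_range _ _ hx
  have h1 := X.indep (fun j => n j * d.N) (by
    rw [← h, ← Finset.prod_pow]
    exact Finset.prod_congr rfl fun j _ => by rw [zpow_mul, zpow_natCast])
  refine Finset.prod_eq_one fun j _ => ?_
  have h2 : n j * d.N = 0 := congrFun h1 j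
  have h3 : n j = 0 := by
    rcases mul_eq_zero.1 h2 with h | h
    · exact h
    · exact absurd h (by exact_mod_cast d.pos.ne')
  rw [h3, zpow_zero]

theorem finite_torsion : {x : Tor g | x ^ d.N = 1}.Finite := by
  haveI : NeZero d.N := ⟨d.pos.ne'⟩
  have h : (Set.univ.pi fun _ : Fin g => {u : ℂˣ | u ^ d.N = 1}).Finite :=
    Set.Finite.pi fun _ => (Set.finite_coe_iff.1 (inferInstanceAs (Finite (rootsOfUnity d.N ℂ)))).subset
      fun u hu => (mem_rootsOfUnity _ _).2 hu
  exact h.subset fun x hx i _ => congrFun (show x ^ d.N = 1 from hx) i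

theorem exists_nhds : ∃ N ∈ 𝓝 (1 : Tor g), ∀ x ∈ N, x ∈ X.GK d → x = 1 := by
  haveI := X.disc
  obtain ⟨t, ht, ht'⟩ := isOpen_induced_iff.1
    (isOpen_discrete ({1} : Set (Subgroup.closure (Set.range X.period))))
  have h1 : (1 : Tor g) ∈ t := by
    have : (1 : Subgroup.closure (Set.range X.period)) ∈ Subtype.val ⁻¹' t := by rw [ht']; rfl
    exact this
  have h2 : (fun x : Tor g => x ^ d.N) ⁻¹' t ∈ 𝓝 (1 : Tor g) :=
    (continuous_pow d.N).continuousAt.preimage_mem_nhds (by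
      rw [one_pow]; exact ht.mem_nhds h1)
  have h3 : ({x : Tor g | x ^ d.N = 1} \ {1})ᶜ ∈ 𝓝 (1 : Tor g) :=
    ((finite_torsion d).subset Set.diff_subset).isClosed.isOpen_compl.mem_nhds (by simp)
  refine ⟨_, Filter.inter_mem h2 h3, ?_⟩
  rintro x ⟨hx1, hx2⟩ hx
  obtain ⟨a, ha, b, hb, rfl⟩ := Subgroup.mem_sup.1 hx
  have h4 : (a * b) ^ d.N = a ^ d.N := by rw [mul_pow, K_pow d hb, mul_one]
  have h5 : a ^ d.N = 1 := by
    have h6 : (⟨a ^ d.N, Subgroup.pow_mem _ ha _⟩ : Subgroup.closure (Set.range X.period)) ∈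
        Subtype.val ⁻¹' t := by
      change a ^ d.N ∈ t
      rw [← h4]
      exact hx1
    rw [ht'] at h6
    exact congrArg Subtype.val h6
  by_contra hne
  exact hx2 ⟨by rw [Set.mem_setOf_eq, h4, h5], hne⟩

theorem locTriv (k : d.Kh) : (X.coverY d).LocTriv (X.eY d k) := by
  intro y
  obtain ⟨z₀, rfl⟩ := QuotientGroup.mk_surjective y
  obtain ⟨N, hN, hN'⟩ := X.exists_nhds d
  have hdiv : (fun p : Tor g × Tor g => p.1⁻¹ * p.2) ⁻¹' N ∈ 𝓝 ((1 : Tor g), (1 : Tor g)) :=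
    ((continuous_fst.inv.mul continuous_snd).continuousAt).preimage_mem_nhds (by simpa using hN)
  rw [nhds_prod_eq, Filter.mem_prod_same_iff] at hdiv
  obtain ⟨O', hO', hO''⟩ := hdiv
  obtain ⟨O, hOO', hO, h1O⟩ := mem_nhds_iff.1 hO'
  have sep : ∀ a ∈ O, ∀ b ∈ O, a⁻¹ * b ∈ X.GK d → a = b := fun a ha b hb hab =>
    inv_mul_eq_one.1 (hN' _ (hO'' (Set.mk_mem_prod (hOO' ha) (hOO' hb))) hab)
  let S : Set (Tor g) := (fun x => z₀⁻¹ * x) ⁻¹' O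
  have hS : IsOpen S := hO.preimage (continuous_const.mul continuous_id)
  let V : Opens (X.coverY d).base :=
    ⟨(QuotientGroup.mk : Tor g → X.Y d) '' S, QuotientGroup.isOpenMap_coe _ hS⟩
  have dec : ∀ z : (X.coverY d).Pre V, ∃ n ∈ S, ∃ a ∈ Subgroup.closure (Set.range X.period),
      ∃ κ : d.K, X.pt d z = n * (a * (κ : Tor g)) := by
    rintro ⟨z, n, hn, hz⟩
    have hm := QuotientGroup.eq.1 hz
    obtain ⟨a, ha, b, hb, hab⟩ := Subgroup.mem_sup.1 hm
    exact ⟨n, hn, a, ha, ⟨b, hb⟩, by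
      rw [hab]
      exact (mul_inv_cancel_left n (show Tor g from z)).symm⟩
  choose n hn a ha κ hz using dec
  have uniq : ∀ (z : (X.coverY d).Pre V) (n' a' : Tor g) (κ' : d.K), n' ∈ S →
      a' ∈ Subgroup.closure (Set.range X.period) → X.pt d z = n' * (a' * (κ' : Tor g)) → κ' = κ z := by
    intro z n' a' κ' hn' ha' hz'
    have e1 : n z * (a z * (κ z : Tor g)) = n' * (a' * (κ' : Tor g)) := (hz z).symm.trans hz'
    have hmem : a z * (κ z : Tor g) ∈ X.GK d :=
      Subgroup.mem_sup.2 ⟨_, ha z, _, (κ z).2, rfl⟩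
    have hmem' : a' * (κ' : Tor g) ∈ X.GK d := Subgroup.mem_sup.2 ⟨_, ha', _, κ'.2, rfl⟩
    have e2 : n' = n z := by
      have h1 : (z₀⁻¹ * n')⁻¹ * (z₀⁻¹ * n z) = (a' * (κ' : Tor g)) * (a z * (κ z : Tor g))⁻¹ := by
        have : n z = n' * (a' * (κ' : Tor g)) * (a z * (κ z : Tor g))⁻¹ := by rw [← e1, mul_inv_cancel_right]
        rw [this]
        group
      have h2 := sep _ hn' _ (hn z) (by
        rw [h1]; exact Subgroup.mul_mem _ hmem' (Subgroup.inv_mem _ hmem))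
      exact mul_left_cancel h2
    rw [e2] at e1
    have e3 : a z * (κ z : Tor g) = a' * (κ' : Tor g) := mul_left_cancel e1
    have e4 : a'⁻¹ * a z = κ' * (κ z : Tor g)⁻¹ := by
      rw [eq_mul_inv_iff_mul_eq, mul_assoc, e3, inv_mul_cancel_left]
    have e5 : a'⁻¹ * a z = 1 := X.eq_one_of_pow d
      (Subgroup.mul_mem _ (Subgroup.inv_mem _ ha') (ha z)) (by
        rw [e4]
        exact K_pow d (Subgroup.mul_mem _ κ'.2 (Subgroup.inv_mem _ (κ z).2)))
    rw [e5] at e4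
    exact Subtype.ext (mul_inv_eq_one.1 e4.symm)
  have frame : ∀ k : d.Kh, ∃ u : (X.coverY d).Line (X.eY d k) V, ∀ z, u.1.1 z = d.pair k (κ z) := by
    intro k
    refine ⟨⟨⟨fun z => d.pair k (κ z), fun z => ⟨fun _ => d.pair k (κ z), analyticAt_const, ?_⟩⟩,
      ?_⟩, fun z => rfl⟩
    · have hopen : {z' : Tor g | z' * (a z * (κ z : Tor g))⁻¹ ∈ S} ∈ 𝓝 (X.pt d z) :=
        (hS.preimage (continuous_id.mul continuous_const)).mem_nhds (by
          change X.pt d z * (a z * (κ z : Tor g))⁻¹ ∈ S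
          rw [hz z, mul_inv_cancel_right]
          exact hn z)
      refine Filter.mem_of_superset hopen fun (z' : Tor g) h1 h2 => ?_
      have := uniq ⟨z', h2⟩ (z' * (a z * (κ z : Tor g))⁻¹) (a z) (κ z) h1 (ha z)
        (by rw [inv_mul_cancel_right]; rfl)
      change ((d.pair k (κ ⟨z', h2⟩) : ℂˣ) : ℂ) = _
      rw [← this]
    · rintro (j | κ') z z' h
      · have := uniq z' (n z) (a z * X.period j) (κ z) (hn z)
          (Subgroup.mul_mem _ (ha z) (Subgroup.subset_closure ⟨j, rfl⟩))
          ((show X.pt d z' = _ from h).trans (by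
            change X.pt d z * X.period j = _
            rw [hz z]
            rw [mul_assoc, mul_right_comm]))
        change ((d.pair k (κ z') : ℂˣ) : ℂ) = 1 * d.pair k (κ z)
        rw [one_mul, ← this]
      · have := uniq z' (n z) (a z) (κ z * κ') (hn z) (ha z)
          ((show X.pt d z' = _ from h).trans (by
            change X.pt d z * κ' = _
            rw [hz z]
            rw [mul_assoc, mul_assoc]; rfl))
        change ((d.pair k (κ z') : ℂˣ) : ℂ) = d.pair k κ' * d.pair k (κ z)
        rw [← this, map_mul, mul_comm, Units.val_mul]
  obtain ⟨u, hu⟩ := frame k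
  obtain ⟨v, hv⟩ := frame k⁻¹
  have hinv : X.eY d k⁻¹ = (X.eY d k)⁻¹ := by
    funext i z
    have h1 : X.eY d k * X.eY d k⁻¹ = 1 := by rw [← map_mul, mul_inv_cancel, map_one]
    exact eq_inv_of_mul_eq_one_right (congrFun (congrFun h1 i) z)
  refine ⟨V, ⟨z₀, ?_, rfl⟩, ⟨u, ⟨v.1, hinv ▸ v.2⟩, fun z => ?_⟩⟩
  · change z₀⁻¹ * z₀ ∈ O
    rw [inv_mul_cancel]
    exact h1O
  · change u.1.1 z * v.1.1 z = 1
    rw [hu, hv, map_inv, MonoidHom.inv_apply, ← Units.val_mul, mul_inv_cancel, Units.val_one]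

end Torus

/-! ### Kernels -/

namespace Cover

variable (C : Cover)

/-- A line bundle, as a presheaf of bimodules over the holomorphic functions. -/
def lineBi (q : C.I → C.P → ℂ) : BiPresheaf C C.ringData where
  sec W := C.Line q W
  grp W := inferInstance
  modO W := inferInstance
  modS W := inferInstanceAs (Module (C.O W) (C.Line q W))
  comm W := @SMulCommClass.mk (C.O W) (C.O W) (C.Line q W) _ _ fun (a b : C.O W) (m : C.Line q W) =>
    smul_comm a b m
  res h := resLine h
  res_self _ _ := rfl
  res_res _ _ _ := rfl
  res_smulO _ _ _ := rfl
  res_smulS _ _ _ := rfl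

variable {G : Type} [CommGroup G] [Fintype G] (l : Bilin G) (e : G →* (C.I → C.P → ℂ))

/-- The presheaf of (right) modules `⨁ k, Q ⊗ L k` over the twisted algebra `⨁ k, L k`, where `Q` is
the line bundle with multipliers `q`. -/
def starBi (q : C.I → C.P → ℂ) : BiPresheaf C (C.starData l e) where
  sec W := C.StarModSec l e q W
  grp W := inferInstance
  modO W := inferInstance
  modS W := inferInstanceAs (Module (C.StarOp l e W) (C.StarModSec l e q W))
  comm W := inferInstanceAs (SMulCommClass (C.O W) (C.StarOp l e W) (C.StarModSec l e q W))
  res {U V} h := AddMonoidHom.mk' (fun x => (⟨resTw h x.1, fun k => resUp_mem h (x.2 k)⟩ :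
      C.StarMod l e q U)) fun _ _ => rfl
  res_self _ _ := rfl
  res_res _ _ _ := rfl
  res_smulO _ _ _ := rfl
  res_smulS {U V} h r a := Subtype.ext (map_mul (resTw h) a.1 (StarOp.val r))

end Cover

/-! ### Projections and translations -/

namespace Torus

variable {g : ℕ} (X : Torus g) (d : DefParam g)

/-- A character of `T` representing an element of `K̂`. -/
def rep (k : d.Kh) : That g := Quotient.out k

theorem mk_rep (k : d.Kh) : (rep d k : d.Kh) = k := QuotientGroup.out_eq' k

theorem kap_eq (k : d.Kh) : X.kap d k = QuotientGroup.mk (X.res (rep d k)) := by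
  conv_lhs => rw [← mk_rep d k]
  rfl

theorem analytic_proj {ι : Type} [Fintype ι] (i : ι) (v : ι → ℂ) :
    AnalyticAt ℂ (fun w : ι → ℂ => w i) v :=
  (ContinuousLinearMap.proj (R := ℂ) (φ := fun _ : ι => ℂ) i).analyticAt v

/-- The projection `Y × Ŷ → Y`. -/
def p : CoverHom (X.coverYY d) (X.coverY d) where
  up z := z.1
  base := TopCat.ofHom ⟨Prod.fst, continuous_fst⟩
  comm _ := rfl
  cont := continuous_fst
  holo z := ⟨fun v i => v (Sum.inl i), AnalyticAt.pi fun i => analytic_proj _ _,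
    Filter.Eventually.of_forall fun _ => rfl⟩

/-- The projection `Y × Ŷ → Ŷ`. -/
def q : CoverHom (X.coverYY d) (X.coverYh d) where
  up z := z.2
  base := TopCat.ofHom ⟨Prod.snd, continuous_snd⟩
  comm _ := rfl
  cont := continuous_snd
  holo z := ⟨fun v i => v (Sum.inr i), AnalyticAt.pi fun i => analytic_proj _ _,
    Filter.Eventually.of_forall fun _ => rfl⟩

/-- The translation by `k⁻¹` on `Ŷ`; the direct image functor `M ↦ (U ↦ M (U k))` is the pull-back
along the translation by `k`. -/
def tau (k : d.Kh) : CoverHom (X.coverYh d) (X.coverYh d) where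
  up := fun x : Tor g => x * (X.res (rep d k))⁻¹
  base := TopCat.ofHom ⟨fun y : X.Yh d => y * (X.kap d k)⁻¹, continuous_mul_const _⟩
  comm := fun (x : Tor g) => by
    change (QuotientGroup.mk (x * (X.res (rep d k))⁻¹) : X.Yh d) =
      (QuotientGroup.mk x : X.Yh d) * (X.kap d k)⁻¹
    rw [kap_eq]
    rfl
  cont := (continuous_mul_const _ : Continuous fun x : Tor g => x * (X.res (rep d k))⁻¹)
  holo z := ⟨fun v i => v i * (((X.res (rep d k))⁻¹ : Tor g) i : ℂ),
    AnalyticAt.pi fun i => (analytic_proj _ _).mul analyticAt_const,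
    Filter.Eventually.of_forall fun _ => funext fun _ => Units.val_mul _ _⟩

/-- The translation by `(1, k⁻¹)` on `Y × Ŷ`. -/
def tr (k : d.Kh) : CoverHom (X.coverYY d) (X.coverYY d) where
  up z := (z.1, z.2 * (X.res (rep d k))⁻¹)
  base := TopCat.ofHom ⟨fun y : X.Y d × X.Yh d => (y.1, y.2 * (X.kap d k)⁻¹),
    continuous_fst.prodMk ((continuous_mul_const _).comp continuous_snd)⟩
  comm z := by
    refine Prod.ext rfl ?_
    change (QuotientGroup.mk (z.2 * (X.res (rep d k))⁻¹) : X.Yh d) =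
      (QuotientGroup.mk z.2 : X.Yh d) * (X.kap d k)⁻¹
    rw [kap_eq]
    rfl
  cont := continuous_fst.prodMk
    ((continuous_mul_const (X.res (rep d k))⁻¹).comp continuous_snd)
  holo z := ⟨fun v => Sum.elim (fun i => v (Sum.inl i))
      (fun i => v (Sum.inr i) * (((X.res (rep d k))⁻¹ : Tor g) i : ℂ)),
    AnalyticAt.pi fun i => by
      rcases i with i | i
      · exact analytic_proj _ _
      · exact (analytic_proj _ _).mul analyticAt_const,
    Filter.Eventually.of_forall fun _ => funext fun i => by
      rcases i with i | i
      · rfl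
      · exact Units.val_mul _ _⟩

/-- The composition of `tr k` and `q`. -/
def trq (k : d.Kh) : CoverHom (X.coverYY d) (X.coverYh d) where
  up := fun z : Tor g × Tor g => z.2 * (X.res (rep d k))⁻¹
  base := (X.tr d k).base ≫ (X.q d).base
  comm z := ((X.q d).comm ((X.tr d k).up z)).trans
    (congrArg (X.q d).base ((X.tr d k).comm z))
  cont := ((continuous_mul_const (X.res (rep d k))⁻¹).comp continuous_snd : Continuous fun
    z : Tor g × Tor g => z.2 * (X.res (rep d k))⁻¹)
  holo z := ⟨fun v i => v (Sum.inr i) * (((X.res (rep d k))⁻¹ : Tor g) i : ℂ),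
    AnalyticAt.pi fun i => (analytic_proj _ _).mul analyticAt_const,
    Filter.Eventually.of_forall fun _ => funext fun _ => Units.val_mul _ _⟩

theorem p_compat (k : d.Kh) : (X.p d).Compat (X.eY d k) (X.eYY d k) := by
  rintro W a ha (j | κ | h) z z' hz
  · exact ha (Sum.inl j) ⟨(X.p d).up z.1, (X.p d).mem_pre z.2⟩
      ⟨(X.p d).up z'.1, (X.p d).mem_pre z'.2⟩ (congrArg Prod.fst hz)
  · exact ha (Sum.inr κ) ⟨(X.p d).up z.1, (X.p d).mem_pre z.2⟩
      ⟨(X.p d).up z'.1, (X.p d).mem_pre z'.2⟩ (congrArg Prod.fst hz)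
  · have h1 : (⟨(X.p d).up z'.1, (X.p d).mem_pre z'.2⟩ : (X.coverY d).Pre W) =
        ⟨(X.p d).up z.1, (X.p d).mem_pre z.2⟩ := Subtype.ext
      (congrArg Prod.fst hz : _)
    exact (congrArg a.1 h1).trans (one_mul _).symm

theorem tr_move (k : d.Kh) (i : (X.coverYY d).I) (z : (X.coverYY d).P) :
    (X.tr d k).up ((X.coverYY d).move i z) = (X.coverYY d).move i ((X.tr d k).up z) := by
  rcases i with j | κ | h
  · rfl
  · rfl
  · exact Prod.ext rfl (mul_right_comm (G := Tor g) _ _ _)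

theorem tr_compat (k k' : d.Kh) : (X.tr d k).Compat (X.eYY d k') (X.eYY d k') := by
  intro W a ha i z z' hz
  refine (ha i ⟨(X.tr d k).up z.1, (X.tr d k).mem_pre z.2⟩
      ⟨(X.tr d k).up z'.1, (X.tr d k).mem_pre z'.2⟩
      ((congrArg (X.tr d k).up hz).trans (X.tr_move d k i z.1))).trans ?_
  rcases i with j | κ | h <;> rfl

/-! ### Group actions on the categories of sheaves on `Y` and `Ŷ` -/

/-- The action of `K̂` on sheaves of modules on `Ŷ` by pull-backs along translations. -/
def actYh : CatAction d.Kh (X.coverYh d).space.Mod :=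
  pushAction (X.tau d)
    (show ∀ y : X.Yh d, y * (X.kap d 1)⁻¹ = y from fun y => by
      rw [map_one, inv_one]
      exact mul_one y)
    (fun {g h k} hk => by
      ext y
      have key : ∀ y : X.Yh d, y * (X.kap d h)⁻¹ * (X.kap d g)⁻¹ = y * (X.kap d k)⁻¹ :=
        fun y => by
          rw [← hk, map_mul]
          refine (mul_assoc y _ _).trans (congrArg (fun t => y * t) ?_)
          exact (mul_inv_rev (X.kap d g) (X.kap d h)).symm
      exact key y)

/-- The action of `K̂` on sheaves of modules on `Y` by the functors `- ⊗ (L k)⁻¹`. -/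
def actY : CatAction d.Kh (X.coverY d).space.Mod :=
  Cover.homAction (X.eY d) (X.exact_coverY d) (X.locTriv d)

/-! ### The Fourier–Mukai functor of the Poincaré bundle -/

/-- The functor `M ↦ p_* (q^* M ⊗ Q)`. -/
def FMQ : (X.coverYh d).space.Mod ⥤ (X.coverY d).space.Mod :=
  (X.q d).toRHom.pull ⋙ ((X.coverYY d).lineBi (X.eQ d)).tensor ⋙ (X.p d).toRHom.push

/-- The canonical morphism `q^* R_k^* M → R_{(1, k)}^* q^* M`. -/
def baseChange (k : d.Kh) : (X.tau d k).toRHom.push ⋙ (X.q d).toRHom.pull ⟶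
    (X.q d).toRHom.pull ⋙ (X.tr d k).toRHom.push where
  app M := ((X.q d).toRHom.adj.homEquiv _ _).symm
    ((X.tau d k).toRHom.push.map ((X.q d).toRHom.adj.unit.app M) ≫
      ((X.q d).pushIso (X.tau d k) (X.trq d k) rfl).hom.app ((X.q d).toRHom.pull.obj M) ≫
      ((X.tr d k).pushIso (X.q d) (X.trq d k) rfl).inv.app ((X.q d).toRHom.pull.obj M))
  naturality M N f := by
    apply ((X.q d).toRHom.adj.homEquiv _ _).injective
    rw [Functor.comp_map, Functor.comp_map, Adjunction.homEquiv_naturality_left,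
      Adjunction.homEquiv_naturality_right, Equiv.apply_symm_apply, Equiv.apply_symm_apply]
    have h1 := ((X.q d).pushIso (X.tau d k) (X.trq d k) rfl).hom.naturality
      ((X.q d).toRHom.pull.map f)
    have h2 := ((X.tr d k).pushIso (X.q d) (X.trq d k) rfl).inv.naturality
      ((X.q d).toRHom.pull.map f)
    have h3 := (X.q d).toRHom.adj.unit.naturality f
    simp only [Functor.comp_map, Functor.id_map] at h1 h2 h3
    rw [Category.assoc, Category.assoc, ← h2, ← (reassoc_of% h1), ← Functor.map_comp_assoc, h3,
      ← Functor.map_comp_assoc]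

end Torus

/-! ### Invariants -/

namespace RSpace.Mod

variable {X : RSpace} (M : X.Mod) {κ : Type} (θ : κ → (M ⟶ M))

/-- The sections which are fixed by all `θ k`. -/
def invSub (U : Opens X.top) : Submodule (X.sh.obj.obj (op U)) (M.Sec U) where
  carrier := {m | ∀ k, app (θ k) U m = m}
  add_mem' ha hb k := by rw [map_add, ha, hb]
  zero_mem' k := map_zero _
  smul_mem' r m hm k := by rw [app_smul, hm]

def invData : ModPresheafData X where
  sec U := M.invSub θ U
  res {U V} h := AddMonoidHom.mk' (fun m => ⟨M.res h m.1, fun k => by rw [app_res, m.2]⟩)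
    fun m n => Subtype.ext (res_add h m.1 n.1)
  res_self U m := Subtype.ext (res_self m.1)
  res_res h h' m := Subtype.ext (res_res h h' m.1)
  res_smul h r m := Subtype.ext (res_smul h r m.1)

/-- The subsheaf of sections which are fixed by all `θ k`. -/
def invariants : X.Mod := (M.invData θ).toMod fun {ι} U s hs => by
  obtain ⟨t, ht, hu⟩ := M.glue U (le_iSup U) le_rfl (fun i => (s i).1)
    (fun i j => congrArg Subtype.val (hs i j))
  refine ⟨⟨t, fun k => ?_⟩, fun i => Subtype.ext (ht i), fun t' ht' =>
    Subtype.ext (hu t'.1 fun i => congrArg Subtype.val (ht' i))⟩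
  refine hu _ fun i => ?_
  rw [← app_res, ht]
  exact (s i).2 k

variable {M θ}

def invariantsMap {N : X.Mod} {θ' : κ → (N ⟶ N)} (f : M ⟶ N) (hf : ∀ k, θ k ≫ f = f ≫ θ' k) :
    M.invariants θ ⟶ N.invariants θ' :=
  mkHom (M.invariants θ) (N.invariants θ')
    (fun U => AddMonoidHom.mk' (fun m : M.invSub θ U => (⟨app f U m.1, fun k => by
        have h1 := congrArg (fun F => app F U m.1) (hf k)
        refine h1.symm.trans ?_
        rw [app_comp, m.2]⟩ : N.invSub θ' U))
      fun m n => Subtype.ext (map_add (app f U) m.1 n.1))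
    (fun U r m => Subtype.ext (app_smul f U r (show M.invSub θ U from m).1))
    (fun h m => Subtype.ext (app_res f h (show M.invSub θ _ from m).1))

end RSpace.Mod

/-! ### The deformed Fourier–Mukai functor -/

namespace Torus

variable {g : ℕ} (X : Torus g) (d : DefParam g)

/-- The function `(x, χ) ↦ t(x)⁻¹` for a character `t` representing `k`. -/
def monoInv (k : d.Kh) (W : Opens (X.coverYY d).base) : (X.coverYY d).Up W :=
  ⟨fun z => ((mono (rep d k) (show Tor g × Tor g from z.1).1)⁻¹ : ℂˣ), fun z => by
    refine ⟨fun v => (∏ i : Fin g, v (Sum.inl i) ^ (rep d k).toAdd i)⁻¹, ?_, ?_⟩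
    · refine AnalyticAt.inv (Finset.analyticAt_fun_prod _ fun i _ =>
        AnalyticAt.zpow (analytic_proj _ _) ?_) ?_
      · exact Units.ne_zero _
      · exact Finset.prod_ne_zero_iff.2 fun i _ => zpow_ne_zero _ (Units.ne_zero _)
    · refine Filter.Eventually.of_forall fun (z' : Tor g × Tor g) _ => ?_
      change (((∏ i, z'.1 i ^ (rep d k).toAdd i)⁻¹ : ℂˣ) : ℂ) = _
      simp [Torus.coverYY]⟩

theorem pair_rep (k : d.Kh) (κ : d.K) : d.pair k κ = mono (rep d k) (κ : Tor g) := by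
  conv_lhs => rw [← mk_rep d k]
  rfl

/-- The function `(x, χ) ↦ t(x)⁻¹ f(x, χ t⁻¹)` for a character `t` representing `k`. -/
def shift (k : d.Kh) {W : Opens (X.coverYY d).base} (f : (X.coverYY d).Up W) :
    (X.coverYY d).Up ((X.tr d k).pre W) :=
  X.monoInv d k _ * (X.tr d k).onUp W f

theorem shift_mem (k s : d.Kh) {W : Opens (X.coverYY d).base} {f : (X.coverYY d).Up W}
    (hf : f ∈ (X.coverYY d).line (X.eQ d * X.eYY d (s * k)) W) :
    X.shift d k f ∈ (X.coverYY d).line (X.eQ d * X.eYY d s) ((X.tr d k).pre W) := by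
  intro i z z' hz
  have h1 := hf i ⟨(X.tr d k).up z.1, (X.tr d k).mem_pre z.2⟩
    ⟨(X.tr d k).up z'.1, (X.tr d k).mem_pre z'.2⟩
    ((congrArg (X.tr d k).up hz).trans (X.tr_move d k i z.1))
  change (X.monoInv d k _).1 z' * f.1 ⟨(X.tr d k).up z'.1, _⟩ = _ *
    ((X.monoInv d k _).1 z * f.1 ⟨(X.tr d k).up z.1, _⟩)
  rw [h1, ← mul_assoc, ← mul_assoc]
  congr 1
  obtain ⟨⟨x, c⟩, hw⟩ := z
  obtain ⟨⟨x', c'⟩, hw'⟩ := z'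
  rcases i with j | κ | h
  · obtain ⟨rfl, rfl⟩ := Prod.mk.inj hz
    change (((mono (rep d k) (x * X.period j))⁻¹ : ℂˣ) : ℂ) *
      ((((c' * (X.res (rep d k))⁻¹ : Tor g) j)⁻¹ : ℂˣ) * 1) =
      (((c' j)⁻¹ : ℂˣ) * 1) * ((mono (rep d k) x)⁻¹ : ℂˣ)
    rw [mul_one, mul_one, ← Units.val_mul, ← Units.val_mul]
    refine congrArg Units.val ?_
    change _ * (c' j * (mono (rep d k) (X.period j))⁻¹)⁻¹ = _
    rw [map_mul, mul_inv, mul_inv, inv_inv]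
    rw [mul_mul_mul_comm, mul_comm (mono (rep d k) x)⁻¹, inv_mul_cancel, mul_one]
  · obtain ⟨rfl, rfl⟩ := Prod.mk.inj hz
    change (((mono (rep d k) (x * κ))⁻¹ : ℂˣ) : ℂ) * (1 * (d.pair (s * k) κ : ℂˣ)) =
      (1 * (d.pair s κ : ℂˣ)) * ((mono (rep d k) x)⁻¹ : ℂˣ)
    rw [one_mul, one_mul, ← Units.val_mul, ← Units.val_mul]
    refine congrArg Units.val ?_
    rw [map_mul (mono (rep d k)), map_mul, MonoidHom.mul_apply, pair_rep d k, mul_inv,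
      mul_mul_mul_comm, mul_comm, inv_mul_cancel, one_mul, mul_comm]
  · obtain ⟨rfl, rfl⟩ := Prod.mk.inj hz
    exact mul_comm _ _

variable (lam : Bilin d.Kh)

/-- The linearization of the deformed Poincaré bundle: the component at `s` of the image of `ψ` is
`λ(k, s)⁻¹ t(x)⁻¹ ψ_{s k}(x, χ t⁻¹)`, where `t` is a character representing `k`. -/
def sigma (k : d.Kh) {W : Opens (X.coverYY d).base}
    (ψ : (X.coverYY d).StarModSec lam (X.eYY d) (X.eQ d) W) :
    (X.coverYY d).StarModSec lam (X.eYY d) (X.eQ d) ((X.tr d k).pre W) :=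
  ⟨fun s => ((lam.toFun k s)⁻¹ : ℂˣ).val • X.shift d k (ψ.1 (s * k)),
    fun s => Cover.smul_mem_line _ (X.shift_mem d k s (ψ.2 (s * k)))⟩

theorem sigma_add (k : d.Kh) {W : Opens (X.coverYY d).base}
    (ψ ψ' : (X.coverYY d).StarModSec lam (X.eYY d) (X.eQ d) W) :
    X.sigma d lam k (ψ + ψ') = X.sigma d lam k ψ + X.sigma d lam k ψ' := by
  refine Subtype.ext (funext fun s => ?_)
  change (((lam.toFun k s)⁻¹ : ℂˣ) : ℂ) •
      (X.monoInv d k _ * (X.tr d k).onUp W (ψ.1 (s * k) + ψ'.1 (s * k))) =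
    (((lam.toFun k s)⁻¹ : ℂˣ) : ℂ) • (X.monoInv d k _ * (X.tr d k).onUp W (ψ.1 (s * k))) +
      (((lam.toFun k s)⁻¹ : ℂˣ) : ℂ) • (X.monoInv d k _ * (X.tr d k).onUp W (ψ'.1 (s * k)))
  rw [map_add, mul_add, smul_add]

theorem sigma_smul (k : d.Kh) {W : Opens (X.coverYY d).base} (r : (X.coverYY d).O W)
    (ψ : (X.coverYY d).StarModSec lam (X.eYY d) (X.eQ d) W) :
    X.sigma d lam k (r • ψ) = (X.tr d k).onO W r • X.sigma d lam k ψ := by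
  refine Subtype.ext (funext fun s => Subtype.ext (funext fun z => ?_))
  have h : (⟨(X.coverYY d).π ((X.tr d k).up z.1), (X.tr d k).mem_pre z.2⟩ : W) =
      ⟨(X.tr d k).base ((X.coverYY d).π z.1), z.2⟩ := Subtype.ext ((X.tr d k).comm z.1)
  change (((lam.toFun k s)⁻¹ : ℂˣ) : ℂ) * ((X.monoInv d k _).1 z *
      (r.1 ⟨(X.coverYY d).π ((X.tr d k).up z.1), _⟩ *
        (ψ.1 (s * k)).1 ⟨(X.tr d k).up z.1, (X.tr d k).mem_pre z.2⟩)) =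
    r.1 ⟨(X.tr d k).base ((X.coverYY d).π z.1), _⟩ * ((((lam.toFun k s)⁻¹ : ℂˣ) : ℂ) *
      ((X.monoInv d k _).1 z * (ψ.1 (s * k)).1 ⟨(X.tr d k).up z.1, (X.tr d k).mem_pre z.2⟩))
  rw [h]
  ring

theorem sigma_op_smul (k : d.Kh) {W : Opens (X.coverYY d).base}
    (a : (X.coverYY d).StarOp lam (X.eYY d) W)
    (ψ : (X.coverYY d).StarModSec lam (X.eYY d) (X.eQ d) W) :
    X.sigma d lam k (a • ψ) =
      (X.tr d k).onStar lam (X.tr_compat d k) W a • X.sigma d lam k ψ := by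
  refine Subtype.ext (funext fun s => ?_)
  change (((lam.toFun k s)⁻¹ : ℂˣ) : ℂ) • (X.monoInv d k _ * (X.tr d k).onUp W
      (∑ j : d.Kh, (lam.toFun j (j⁻¹ * (s * k)) : ℂ) • (ψ.1 j * a.val (j⁻¹ * (s * k))))) =
    ∑ j : d.Kh, (lam.toFun j (j⁻¹ * s) : ℂ) • (((((lam.toFun k j)⁻¹ : ℂˣ) : ℂ) •
      (X.monoInv d k _ * (X.tr d k).onUp W (ψ.1 (j * k)))) * (X.tr d k).onUp W (a.val (j⁻¹ * s)))
  rw [map_sum, Finset.mul_sum, Finset.smul_sum, ← Equiv.sum_comp (Equiv.mulRight k)]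
  refine Finset.sum_congr rfl fun j _ => ?_
  have e1 : (j * k)⁻¹ * (s * k) = j⁻¹ * s := by
    rw [mul_inv, mul_mul_mul_comm, inv_mul_cancel, mul_one]
  simp only [Equiv.coe_mulRight, e1, map_smul, map_mul]
  have e2 : (lam.toFun k s)⁻¹ * lam.toFun (j * k) (j⁻¹ * s) =
      lam.toFun j (j⁻¹ * s) * (lam.toFun k j)⁻¹ := by
    have h1 : lam.toFun k s = lam.toFun k j * lam.toFun k (j⁻¹ * s) := by
      rw [← lam.mul_right, mul_inv_cancel_left]
    rw [lam.mul_left, h1, mul_inv, mul_assoc, mul_comm (lam.toFun j (j⁻¹ * s)),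
      inv_mul_cancel_left, mul_comm]
  have e3 := congrArg Units.val e2
  rw [Units.val_mul, Units.val_mul] at e3
  rw [mul_smul_comm, smul_smul, e3, smul_mul_assoc, smul_smul, mul_assoc]

end Torus

theorem BiPresheaf.smul_tmul' {C : Cover} {D : RingSheafData C.base} (B : BiPresheaf C D)
    {F : C.space.Mod} {W : Opens C.base} (r : C.O W) (b : B.sec W)
    (n : RSpace.Mod.Sec (X := C.space) F W) :
    ((r • b) ⊗ₜ n : B.TSec F W) = b ⊗ₜ (r • n) := TensorProduct.smul_tmul r b n

namespace Torus

variable {g : ℕ} (X : Torus g) (d : DefParam g) (lam : Bilin d.Kh)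

/-- The category of sheaves of modules on `X̂^λ`, i.e. `λ`-twisted equivariant sheaves on `Ŷ`. -/
abbrev ModXhLam := TwistedEquivariant (X.actYh d) lam.toFun

/-- The category of sheaves of right modules on the noncommutative torus `X_λ`. -/
abbrev ModXLam := ((X.coverY d).starSpace lam (X.eY d)).Mod

variable {lam}

/-- The pull-back to `Y × Ŷ` of a twisted equivariant sheaf. -/
abbrev pullObj (E : X.ModXhLam d lam) : (X.coverYY d).space.Mod := (X.q d).toRHom.pull.obj E.obj

/-- The linearization of the pull-back to `Y × Ŷ` of a twisted equivariant sheaf. -/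
def rhoPull (E : X.ModXhLam d lam) (k : d.Kh) :
    X.pullObj d E ⟶ (X.tr d k).toRHom.push.obj (X.pullObj d E) :=
  (X.q d).toRHom.pull.map (E.rho k).hom ≫ (X.baseChange d k).app E.obj

/-- The value of `rhoPull` on sections. -/
def rhoSec (E : X.ModXhLam d lam) (k : d.Kh) (W : Opens (X.coverYY d).base) :
    Cover.MSec (X.pullObj d E) W →+ Cover.MSec (X.pullObj d E) ((X.tr d k).pre W) :=
  RSpace.Mod.app (X := (X.coverYY d).space) (X.rhoPull d E k) W

theorem rhoSec_smul (E : X.ModXhLam d lam) (k : d.Kh) {W : Opens (X.coverYY d).base}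
    (r : (X.coverYY d).O W) (n : Cover.MSec (X.pullObj d E) W) :
    X.rhoSec d E k W (r • n) = (X.tr d k).onO W r • X.rhoSec d E k W n :=
  RSpace.Mod.app_smul (X := (X.coverYY d).space) (X.rhoPull d E k) W r n

theorem rhoSec_res (E : X.ModXhLam d lam) (k : d.Kh) {V W : Opens (X.coverYY d).base} (h : V ≤ W)
    (n : Cover.MSec (X.pullObj d E) W) :
    X.rhoSec d E k V (Cover.mres (X.pullObj d E) h n) =
      Cover.mres (X.pullObj d E) ((Opens.map (X.tr d k).base).map (homOfLE h)).le
        (X.rhoSec d E k W n) :=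
  RSpace.Mod.app_res (X := (X.coverYY d).space) (X.rhoPull d E k) h n

/-- The deformed Poincaré bundle, as a presheaf of right modules over the twisted algebra. -/
abbrev PLam (lam : Bilin d.Kh) : BiPresheaf (X.coverYY d) ((X.coverYY d).starData lam (X.eYY d)) :=
  (X.coverYY d).starBi lam (X.eYY d) (X.eQ d)

/-- The functor which sends `E` to the sheaf `q^* E ⊗ P_λ` on `Y × Ŷ`. -/
def kernelFunctor (lam : Bilin d.Kh) : X.ModXhLam d lam ⥤
    ((X.coverYY d).starSpace lam (X.eYY d)).Mod where
  obj E := (X.PLam d lam).tensor.obj (X.pullObj d E)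
  map f := (X.PLam d lam).tensor.map ((X.q d).toRHom.pull.map f.hom)
  map_id E := by
    rw [TwistedEquivariant.id_hom, CategoryTheory.Functor.map_id, CategoryTheory.Functor.map_id]
  map_comp f f' := by
    rw [TwistedEquivariant.comp_hom, Functor.map_comp, Functor.map_comp]

def linBalanced (E : X.ModXhLam d lam) (k : d.Kh) : (X.PLam d lam).Balanced (X.pullObj d E)
    (((X.tr d k).toStarRHom lam (X.tr_compat d k)).push.obj ((X.kernelFunctor d lam).obj E)) where
  φ W := AddMonoidHom.mk' (fun b => AddMonoidHom.mk'
      (fun n => (X.PLam d lam).toTensor (X.pullObj d E) ((X.tr d k).pre W)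
        (X.sigma d lam k b ⊗ₜ X.rhoSec d E k W n))
      (fun n n' => by
        refine (congrArg (fun y => (X.PLam d lam).toTensor (X.pullObj d E) ((X.tr d k).pre W)
          (X.sigma d lam k b ⊗ₜ y)) (map_add (X.rhoSec d E k W) n n')).trans ?_
        refine (congrArg ((X.PLam d lam).toTensor (X.pullObj d E) ((X.tr d k).pre W))
          (TensorProduct.tmul_add _ _ _)).trans ?_
        exact map_add ((X.PLam d lam).toTensor (X.pullObj d E) ((X.tr d k).pre W)) _ _))
    (fun b b' => by
      ext n
      refine (congrArg (fun x => (X.PLam d lam).toTensor (X.pullObj d E) ((X.tr d k).pre W)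
        (x ⊗ₜ X.rhoSec d E k W n)) (X.sigma_add d lam k b b')).trans ?_
      refine (congrArg ((X.PLam d lam).toTensor (X.pullObj d E) ((X.tr d k).pre W))
        (TensorProduct.add_tmul _ _ _)).trans ?_
      exact map_add ((X.PLam d lam).toTensor (X.pullObj d E) ((X.tr d k).pre W)) _ _)
  hO W r b n := by
    change (X.PLam d lam).toTensor (X.pullObj d E) ((X.tr d k).pre W)
        (X.sigma d lam k (r • b) ⊗ₜ X.rhoSec d E k W n) =
      (X.PLam d lam).toTensor (X.pullObj d E) ((X.tr d k).pre W)
        (X.sigma d lam k b ⊗ₜ X.rhoSec d E k W (r • n))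
    refine (congrArg (fun x => (X.PLam d lam).toTensor (X.pullObj d E) ((X.tr d k).pre W)
      (x ⊗ₜ X.rhoSec d E k W n)) (X.sigma_smul d lam k r b)).trans ?_
    refine Eq.trans ?_ (congrArg (fun y => (X.PLam d lam).toTensor (X.pullObj d E)
      ((X.tr d k).pre W) (X.sigma d lam k b ⊗ₜ y)) (X.rhoSec_smul d E k r n)).symm
    exact congrArg ((X.PLam d lam).toTensor (X.pullObj d E) ((X.tr d k).pre W))
      (BiPresheaf.smul_tmul' (X.PLam d lam) (F := X.pullObj d E) _ _ _)
  hS W r b n := by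
    refine Eq.trans ?_ ((X.PLam d lam).toTensor_smul (X.pullObj d E)
      ((X.tr d k).onStar lam (X.tr_compat d k) W r)
      (X.sigma d lam k b ⊗ₜ X.rhoSec d E k W n))
    exact congrArg (fun x => (X.PLam d lam).toTensor (X.pullObj d E) ((X.tr d k).pre W)
      (x ⊗ₜ X.rhoSec d E k W n)) (X.sigma_op_smul d lam k r b)
  hn {U V} h b n := by
    refine Eq.trans ?_ ((X.PLam d lam).toTensor_res (X.pullObj d E)
      ((Opens.map (X.tr d k).base).map (homOfLE h)).le
      (X.sigma d lam k b ⊗ₜ X.rhoSec d E k V n))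
    refine congrArg ((X.PLam d lam).toTensor (X.pullObj d E) ((X.tr d k).pre U)) ?_
    refine Eq.trans ?_ (BiPresheaf.tres_tmul _ _ _ _ _).symm
    exact congrArg (fun y => _ ⊗ₜ y) (X.rhoSec_res d E k h n)

/-- The linearization `σ_k ⊗ ρ_k` of `q^* E ⊗ P_λ`. -/
def linKernel (E : X.ModXhLam d lam) (k : d.Kh) : (X.kernelFunctor d lam).obj E ⟶
    ((X.tr d k).toStarRHom lam (X.tr_compat d k)).push.obj ((X.kernelFunctor d lam).obj E) :=
  (X.linBalanced d E k).desc _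

theorem linKernel_app (E : X.ModXhLam d lam) (k : d.Kh) (W : Opens (X.coverYY d).base)
    (b : (X.coverYY d).StarModSec lam (X.eYY d) (X.eQ d) W) (n : Cover.MSec (X.pullObj d E) W) :
    RSpace.Mod.app (X := (X.coverYY d).starSpace lam (X.eYY d)) (X.linKernel d E k) W
      ((X.PLam d lam).toTensor (X.pullObj d E) W (b ⊗ₜ n)) =
      (X.PLam d lam).toTensor (X.pullObj d E) ((X.tr d k).pre W)
        (X.sigma d lam k b ⊗ₜ X.rhoSec d E k W n) :=
  BiPresheaf.Balanced.desc_toTensor _ (X.linBalanced d E k) W (b ⊗ₜ n)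

/-- The direct image along the projection `Y × Ŷ → Y`, for modules over the twisted algebras. -/
def pushLam (lam : Bilin d.Kh) :
    ((X.coverYY d).starSpace lam (X.eYY d)).Mod ⥤ X.ModXLam d lam :=
  ((X.p d).toStarRHom lam (X.p_compat d)).push

theorem tr_p (k : d.Kh) : (X.tr d k).base ≫ (X.p d).base = (X.p d).base := rfl

/-- The action of `k` on the direct image of `q^* E ⊗ P_λ` to `Y`. -/
def actPush (E : X.ModXhLam d lam) (k : d.Kh) :
    (X.pushLam d lam).obj ((X.kernelFunctor d lam).obj E) ⟶
      (X.pushLam d lam).obj ((X.kernelFunctor d lam).obj E) :=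
  (X.pushLam d lam).map (X.linKernel d E k) ≫
    ((X.tr d k).starPushIso lam (X.p d) (X.p d) (X.tr_compat d k) (X.p_compat d) (X.p_compat d)
      (X.tr_p d k) fun _ => rfl).hom.app ((X.kernelFunctor d lam).obj E)

theorem linKernel_comm {E E' : X.ModXhLam d lam} (f : E ⟶ E') (k : d.Kh) :
    X.linKernel d E k ≫ ((X.tr d k).toStarRHom lam (X.tr_compat d k)).push.map
      ((X.kernelFunctor d lam).map f) = (X.kernelFunctor d lam).map f ≫ X.linKernel d E' k := by
  have h1 : X.rhoPull d E k ≫ (X.tr d k).toRHom.push.map ((X.q d).toRHom.pull.map f.hom) =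
      (X.q d).toRHom.pull.map f.hom ≫ X.rhoPull d E' k := by
    have h2 := (X.baseChange d k).naturality f.hom
    have h3 := congrArg (X.q d).toRHom.pull.map (f.comm k)
    simp only [Functor.comp_map, Functor.map_comp] at h2 h3
    refine (Category.assoc _ _ _).trans ?_
    refine (congrArg (fun F => (X.q d).toRHom.pull.map (E.rho k).hom ≫ F) h2.symm).trans ?_
    refine (Category.assoc _ _ _).symm.trans ?_
    refine (congrArg (fun F => F ≫ (X.baseChange d k).app E'.obj) h3).trans ?_
    exact Category.assoc _ _ _
  refine BiPresheaf.tensor_hom_ext _ fun W b n => ?_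
  have h4 := congrArg (fun F => RSpace.Mod.app (X := (X.coverYY d).space) F W n) h1
  have h5 := X.linKernel_app d E k W b n
  have h6 := BiPresheaf.Balanced.desc_toTensor (X.PLam d lam)
    ((X.PLam d lam).mapBalanced ((X.q d).toRHom.pull.map f.hom)) W (b ⊗ₜ n)
  have h7 := BiPresheaf.Balanced.desc_toTensor (X.PLam d lam)
    ((X.PLam d lam).mapBalanced ((X.q d).toRHom.pull.map f.hom)) ((X.tr d k).pre W)
    (X.sigma d lam k b ⊗ₜ X.rhoSec d E k W n)
  have h8 := X.linKernel_app d E' k W b (Cover.mapp ((X.q d).toRHom.pull.map f.hom) W n)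
  refine (congrArg (RSpace.Mod.app (X := (X.coverYY d).starSpace lam (X.eYY d))
    ((X.kernelFunctor d lam).map f) ((X.tr d k).pre W)) h5).trans ?_
  refine h7.trans (Eq.trans ?_ ((congrArg
    (RSpace.Mod.app (X := (X.coverYY d).starSpace lam (X.eYY d)) (X.linKernel d E' k) W)
      h6).trans h8).symm)
  exact congrArg (fun y => (X.PLam d lam).toTensor (X.pullObj d E') ((X.tr d k).pre W)
    (X.sigma d lam k b ⊗ₜ y)) h4

theorem actPush_comm {E E' : X.ModXhLam d lam} (f : E ⟶ E') (k : d.Kh) :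
    X.actPush d E k ≫ (X.pushLam d lam).map ((X.kernelFunctor d lam).map f) =
      (X.pushLam d lam).map ((X.kernelFunctor d lam).map f) ≫ X.actPush d E' k := by
  have h1 := ((X.tr d k).starPushIso lam (X.p d) (X.p d) (X.tr_compat d k) (X.p_compat d)
    (X.p_compat d) (X.tr_p d k) fun _ => rfl).hom.naturality ((X.kernelFunctor d lam).map f)
  have h2 := congrArg (X.pushLam d lam).map (X.linKernel_comm d f k)
  simp only [Functor.comp_map, Functor.map_comp] at h1 h2
  refine (Category.assoc _ _ _).trans ?_
  refine (congrArg (fun F => (X.pushLam d lam).map (X.linKernel d E k) ≫ F) h1.symm).trans ?_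
  refine (Category.assoc _ _ _).symm.trans ?_
  refine (congrArg (fun F => F ≫ ((X.tr d k).starPushIso lam (X.p d) (X.p d) (X.tr_compat d k)
    (X.p_compat d) (X.p_compat d) (X.tr_p d k) fun _ => rfl).hom.app
      ((X.kernelFunctor d lam).obj E')) h2).trans ?_
  exact Category.assoc _ _ _

/-- The deformed Fourier–Mukai functor from `X̂^λ` to `X_λ`: it sends a twisted equivariant sheaf `E`
to the `K̂`-invariant part of the direct image of `q^* E ⊗ P_λ` on `Y × Ŷ`, which is the direct image
to `Y` of the sheaf on `Y × X̂` corresponding to the `K̂`-equivariant sheaf `q^* E ⊗ P_λ`. -/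
def FMLam (lam : Bilin d.Kh) : X.ModXhLam d lam ⥤ X.ModXLam d lam where
  obj E := RSpace.Mod.invariants _ (X.actPush d E)
  map f := RSpace.Mod.invariantsMap ((X.pushLam d lam).map ((X.kernelFunctor d lam).map f))
    fun k => X.actPush_comm d f k
  map_id E := RSpace.Mod.hom_ext fun U m => by
    refine Subtype.ext ?_
    have h1 : (X.pushLam d lam).map ((X.kernelFunctor d lam).map (𝟙 E)) = 𝟙 _ := by
      rw [CategoryTheory.Functor.map_id, CategoryTheory.Functor.map_id]
    exact congrArg (fun F => RSpace.Mod.app F U (Subtype.val m)) h1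
  map_comp f f' := RSpace.Mod.hom_ext fun U m => by
    refine Subtype.ext ?_
    have h1 : (X.pushLam d lam).map ((X.kernelFunctor d lam).map (f ≫ f')) =
      (X.pushLam d lam).map ((X.kernelFunctor d lam).map f) ≫
        (X.pushLam d lam).map ((X.kernelFunctor d lam).map f') := by
      rw [Functor.map_comp, Functor.map_comp]
    exact congrArg (fun F => RSpace.Mod.app F U (Subtype.val m)) h1

end Torus

namespace Torus

variable {g : ℕ} (X : Torus g) (d : DefParam g)

/-- The isomorphism `(R_(1,k)^{-1})^* Q ⊗ p^* L_k → Q`: the section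
`u(x) t(x)⁻¹ ψ(x, χ t⁻¹)` of `Q`, where `t` is a character representing `k`, for a section `ψ` of `Q`
over `W` and a section `u` of `L k` over a neighbourhood of the projection of `W`. -/
def shiftLine (k : d.Kh) {U : Opens (X.coverY d).base} {W : Opens (X.coverYY d).base}
    (hW : (X.tr d k).pre W ≤ (X.p d).pre U) (u : (X.coverY d).Line (X.eY d k) U)
    (ψ : (X.coverYY d).Line (X.eQ d) W) : (X.coverYY d).Line (X.eQ d) ((X.tr d k).pre W) :=
  ⟨Cover.resUp hW ((X.p d).onUp U u.1) * X.shift d k ψ.1,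
    Cover.mul_mem_line
      (e := X.eYY d k) (e' := X.eQ d * X.eYY d k⁻¹)
      (by rw [mul_left_comm, ← map_mul, mul_inv_cancel, map_one, mul_one])
      (Cover.resUp_mem hW (X.p_compat d k U u.1 u.2))
      (X.shift_mem d k k⁻¹ (by rw [inv_mul_cancel, map_one, mul_one]; exact ψ.2))⟩

variable {d}

/-- The isomorphisms `FM(R_k^* M) ≅ FM(M) ⊗ (L k)⁻¹ = Hom(L k, FM(M))` of the equivariant structure
are induced by the base change `q^* R_k^* M ≅ R_(1,k)^* q^* M` and by `shiftLine`. -/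
def IsCanonical (a : EquivariantStructure (X.actYh d) (X.actY d) (X.FMQ d)) : Prop :=
  ∀ (k : d.Kh) (M : (X.coverYh d).space.Mod) (U : Opens (X.coverY d).base)
    (s : Cover.MSec ((X.FMQ d).obj (((X.actYh d).act k).obj M)) U)
    (u : (X.coverY d).Line (X.eY d k) U)
    (W : Opens (X.coverYY d).base) (hW : W ≤ (X.p d).pre U)
    (hW' : (X.tr d k).pre W ≤ (X.p d).pre U) (m : ℕ)
    (ψ : Fin m → (X.coverYY d).Line (X.eQ d) W)
    (n : Fin m → Cover.MSec ((X.q d).toRHom.pull.obj ((X.tau d k).toRHom.push.obj M)) W),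
    Cover.mres (((X.coverYY d).lineBi (X.eQ d)).tensorObj
        ((X.q d).toRHom.pull.obj ((X.tau d k).toRHom.push.obj M))) hW s =
      ∑ i, ((X.coverYY d).lineBi (X.eQ d)).toTensor
        ((X.q d).toRHom.pull.obj ((X.tau d k).toRHom.push.obj M)) W (ψ i ⊗ₜ n i) →
    Cover.mres (((X.coverYY d).lineBi (X.eQ d)).tensorObj ((X.q d).toRHom.pull.obj M)) hW'
        (Cover.hev (e := X.eY d k) (M := (X.FMQ d).obj M)
          (Cover.mapp ((a.a k).hom.app M) U s) le_rfl u) =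
      ∑ i, ((X.coverYY d).lineBi (X.eQ d)).toTensor ((X.q d).toRHom.pull.obj M)
        ((X.tr d k).pre W)
        (X.shiftLine d k hW' u (ψ i) ⊗ₜ Cover.mapp ((X.baseChange d k).app M) W (n i))

variable (d)

/-- The equivalence from `λ`-twisted equivariant sheaves on `Y` to right modules on `X_λ`. -/
def toXLam (lam : Bilin d.Kh) :
    TwistedEquivariant (X.actY d) lam.toFun ⥤ X.ModXLam d lam :=
  (X.coverY d).toStar lam (X.eY d) (X.exact_coverY d) (X.locTriv d)

end Torus

/-! ### Coherence -/

namespace RSpace.Mod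

variable {X : RSpace}

/-- The section `∑ a i • m i` of `M` over `V`. -/
def comb {M : X.Mod} {U V : Opens X.top} (h : V ≤ U) {m : ℕ} (s : Fin m → M.Sec U)
    (a : Fin m → X.sh.obj.obj (op V)) : M.Sec V := ∑ i, a i • M.res h (s i)

/-- A sheaf of modules is coherent if it is locally finitely generated and, for all finite families of
sections over an open set, the sheaf of relations is locally finitely generated. -/
def IsCoherent (M : X.Mod) : Prop :=
  (∀ x : X.top, ∃ (V : Opens X.top) (m : ℕ) (s : Fin m → M.Sec V), x ∈ V ∧
    ∀ (W : Opens X.top) (_ : W ≤ V) (t : M.Sec W), ∀ y ∈ W,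
      ∃ (W' : Opens X.top) (hW' : W' ≤ W) (hV : W' ≤ V) (a : Fin m → X.sh.obj.obj (op W')),
        y ∈ W' ∧ M.res hW' t = comb hV s a) ∧
  ∀ (U : Opens X.top) (m : ℕ) (s : Fin m → M.Sec U), ∀ x ∈ U,
    ∃ (V : Opens X.top) (hV : V ≤ U) (n : ℕ) (r : Fin n → Fin m → X.sh.obj.obj (op V)), x ∈ V ∧
      (∀ j, comb hV s (r j) = 0) ∧
      ∀ (W : Opens X.top) (hW : W ≤ V) (b : Fin m → X.sh.obj.obj (op W)),
        comb (hW.trans hV) s b = 0 → ∀ y ∈ W,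
          ∃ (W' : Opens X.top) (hW' : W' ≤ W) (c : Fin n → X.sh.obj.obj (op W')), y ∈ W' ∧
            ∀ i, (X.sh.obj.map (homOfLE hW').op (b i) : X.sh.obj.obj (op W')) =
              ∑ j, c j * (X.sh.obj.map (homOfLE (hW'.trans hW)).op (r j i) :
                X.sh.obj.obj (op W'))

end RSpace.Mod

end NCTorus

end

/-!
Let `t` be a character representing `k ∈ K̂`. The map `ψ(x, χ) ↦ t(x)⁻¹ ψ(x, χ t⁻¹)` identifies
the pull-back of `Q ⊗ p^* L k` under the translation by `(1, k⁻¹)` with `Q`. Together with the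
base change `q^* R_k^* M ≅ R_(1,k)^* q^* M` it gives morphisms of sheaves (`Torus.theta`), and
hence the canonical morphisms `FM(R_k^* M) → Hom(L k, FM(M))` (`Torus.aNat`). Two translations
compose because changing the representative `t` by an element of `Ĥ` is compensated by the
multipliers of `Q` (`shift_shift`), and because base change is compatible with composition
(`bc_bc`); this is the coherence of the equivariant structure (`pentagon`). For `k = 1` the
canonical morphism is an isomorphism by inspection, and coherence for `k k⁻¹ = 1` then makes all
of them isomorphisms (`isIso_aNat`). Sections of a tensor product are handled by
`BiPresheaf.tensor_induction`: they are local sums of pure tensors.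

A section of `q^* E ⊗ P_λ` is a family of sections of the summands `q^* E ⊗ Q ⊗ L k`
(`starPr_ext`, `exists_starPr_eq`). In terms of these components the linearization sends the
component at `s k` to the component at `s`, through `theta` and the scalar `λ(k, s)⁻¹`
(`starPr_linSec`). An invariant section is therefore determined by its component at `1`, which can
be prescribed arbitrarily (`prOne_bijective`), and which is a section of the image of `E` under
the functor of `Q`. Under this bijection the right multiplication with a section of `L k` picks up
the component at `k⁻¹`, i.e. `ρ_k` of the component at `1` (`prOne_smul`). This is the isomorphism
of functors `inducedIso`.

For coherence, let `A` be any twisted equivariant sheaf for the functors `Hom(L k, -)`. Locally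
the `L k` have nowhere vanishing sections `u k`, and a section `a = ∑ α k u k` of the twisted
algebra acts by `∑ α k ρ_k(m)(u k)`. Hence generators `s i` over the twisted algebra give the
generators `ρ_k(s i)(u k)` over the functions, and the relations between the `s i` over the
twisted algebra are those between the `ρ_k(s i)(u k)` over the functions
(`finTypeO_of_finTypeStar`, `finRelStar_of_finRelO`). For the remaining implication, that
coherence over the twisted algebra yields finitely generated relations over the functions,
consider the automorphisms of the twisted algebra which multiply `L k` by `χ k`, for the
characters `χ` of `K̂`. The families all of whose twists are relations form a locally finitely
generated sheaf (`FinRel.finGen_twist`), and by orthogonality of characters they are the families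
whose homogeneous components are relations (`sum_rhoEv_eq_zero`); these are spanned by relations
over the functions (`finRelO_of_finRelStar`).
-/

noncomputable section

namespace NCTorus

/-! ### Sections of the tensor product sheaf -/

namespace BiPresheaf

variable {C : Cover} {D D' : RingSheafData C.base} (B : BiPresheaf C D)

theorem exists_toTensor_res (F : C.space.Mod) {W : Opens C.base}
    (s : RSpace.Mod.Sec (X := D.toRSpace) (B.tensorObj F) W) {y : C.base} (hy : y ∈ W) :
    ∃ (V : Opens C.base) (h : V ≤ W) (x : B.TSec F V), y ∈ V ∧
      (B.tensorObj F).res h s = B.toTensor F V x := by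
  have h1 := Presheaf.imageSieve_mem (Opens.grothendieckTopology C.base)
    (CategoryTheory.toSheafify (Opens.grothendieckTopology C.base)
      (B.preTensor F).toPresheaf.presheaf) (U := op W) s
  obtain ⟨V, f, ⟨x, hx⟩, hV⟩ := h1 y hy
  exact ⟨V, f.le, x, hV, hx.symm⟩

/-- Sections of `B ⊗ F` are local sums of pure tensors; a local additive property of sections
follows from its validity for pure tensors. -/
theorem tensor_induction {F : C.space.Mod}
    {P : ∀ W : Opens C.base, RSpace.Mod.Sec (X := D.toRSpace) (B.tensorObj F) W → Prop}
    (loc : ∀ W s, (∀ y ∈ W, ∃ (V : Opens C.base) (h : V ≤ W), y ∈ V ∧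
      P V ((B.tensorObj F).res h s)) → P W s)
    (zero : ∀ W, P W 0) (add : ∀ W s t, P W s → P W t → P W (s + t))
    (tmul : ∀ W b n, P W (B.toTensor F W (b ⊗ₜ n))) (W : Opens C.base) (s) : P W s := by
  refine loc W s fun y hy => ?_
  obtain ⟨V, h, x, hV, hx⟩ := B.exists_toTensor_res F s hy
  refine ⟨V, h, hV, ?_⟩
  rw [hx]
  clear hx
  induction x using TensorProduct.induction_on with
  | zero => rw [map_zero]; exact zero V
  | tmul b n => exact tmul V b n
  | add x y hx hy => rw [map_add]; exact add V _ _ hx hy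

/-- A family of additive maps from `B(W) × F(W)` to the sections of a sheaf which is balanced over
the functions on `W`, and compatible with restrictions. -/
structure AddBalanced (F : C.space.Mod) (N : D'.toRSpace.Mod) where
  φ : ∀ W : Opens C.base,
    B.sec W →+ RSpace.Mod.Sec (X := C.space) F W →+ RSpace.Mod.Sec (X := D'.toRSpace) N W
  hO : ∀ (W : Opens C.base) (r : C.O W) (b) (n), φ W (r • b) n = φ W b (r • n)
  hn : ∀ {U V : Opens C.base} (h : U ≤ V) (b) (n),
    φ U (B.res h b) (RSpace.Mod.res (X := C.space) F h n) = N.res h (φ V b n)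

namespace AddBalanced

variable {B} {F : C.space.Mod} {N : D'.toRSpace.Mod} (β : AddBalanced (D' := D') B F N)

/-- The maps on the algebraic tensor products over the functions. -/
def lift (W : Opens C.base) : B.TSec F W →+ RSpace.Mod.Sec (X := D'.toRSpace) N W :=
  TensorProduct.liftAddHom (β.φ W) (β.hO W)

/-- The maps `lift`, as a morphism of presheaves of abelian groups. -/
def preDesc : (B.preTensor F).toPresheaf.presheaf ⟶ N.val.presheaf where
  app U := AddCommGrpCat.ofHom (β.lift U.unop)
  naturality U V f := by
    ext a
    exact B.tsec_ext (A := RSpace.Mod.Sec (X := D'.toRSpace) N V.unop)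
      (fun a => β.lift V.unop (B.tres F f.unop.le a)) (fun a => N.res f.unop.le (β.lift U.unop a))
      (fun x y => by rw [map_add, map_add]) (fun x y => by rw [map_add, RSpace.Mod.res_add])
      (fun b n => β.hn f.unop.le b n) a

/-- The family of additive maps on the sections of `B ⊗ F` which is given by a family of balanced
maps; no linearity over the sheaf of rings acting on `B` is required. -/
def desc (W : Opens C.base) : RSpace.Mod.Sec (X := D.toRSpace) (B.tensorObj F) W →+
    RSpace.Mod.Sec (X := D'.toRSpace) N W :=
  ((CategoryTheory.sheafifyLift (Opens.grothendieckTopology C.base) β.preDesc N.isSheaf).app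
    (op W)).hom

theorem desc_res {U V : Opens C.base} (h : U ≤ V)
    (s : RSpace.Mod.Sec (X := D.toRSpace) (B.tensorObj F) V) :
    β.desc U ((B.tensorObj F).res h s) = N.res h (β.desc V s) :=
  ConcreteCategory.congr_hom ((CategoryTheory.sheafifyLift
    (Opens.grothendieckTopology C.base) β.preDesc N.isSheaf).naturality (homOfLE h).op) s

theorem desc_toTensor (W : Opens C.base) (b : B.sec W) (n) :
    β.desc W (B.toTensor F W (b ⊗ₜ n)) = β.φ W b n := by
  have h1 := CategoryTheory.toSheafify_sheafifyLift (Opens.grothendieckTopology C.base)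
    β.preDesc N.isSheaf
  have h2 := congrArg (fun f => f.app (op W)) h1
  exact congrArg (fun f => AddCommGrpCat.Hom.hom f (show B.TSec F W from b ⊗ₜ n)) h2

end AddBalanced

end BiPresheaf

/-! ### Tensor products with line bundles -/

namespace Cover

variable {C : Cover}

/-- The sheaf `L ⊗ F`, where `L` is the line bundle with multipliers `e`. -/
abbrev lineTensor (e : C.I → C.P → ℂ) (F : C.space.Mod) : C.space.Mod := (C.lineBi e).tensorObj F

/-- The section `b ⊗ n` of `L ⊗ F`. -/
def ltmul {e : C.I → C.P → ℂ} {F : C.space.Mod} {W : Opens C.base} (b : C.Line e W)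
    (n : MSec F W) : MSec (lineTensor e F) W :=
  (C.lineBi e).toTensor F W ((show (C.lineBi e).sec W from b) ⊗ₜ n)

variable {e e' e'' : C.I → C.P → ℂ} {F F' : C.space.Mod} {W : Opens C.base}

theorem add_ltmul (b b' : C.Line e W) (n : MSec F W) :
    ltmul (b + b') n = ltmul b n + ltmul b' n :=
  (congrArg ((C.lineBi e).toTensor F W) (TensorProduct.add_tmul _ _ _)).trans
    (map_add ((C.lineBi e).toTensor F W) _ _)

theorem ltmul_add (b : C.Line e W) (n n' : MSec F W) :
    ltmul b (n + n') = ltmul b n + ltmul b n' :=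
  (congrArg ((C.lineBi e).toTensor F W) (TensorProduct.tmul_add _ _ _)).trans
    (map_add ((C.lineBi e).toTensor F W) _ _)

theorem smul_ltmul (r : C.O W) (b : C.Line e W) (n : MSec F W) :
    ltmul (r • b) n = r • ltmul b n :=
  (C.lineBi e).toTensor_smul F r (b ⊗ₜ n)

theorem ltmul_smul (r : C.O W) (b : C.Line e W) (n : MSec F W) :
    ltmul b (r • n) = r • ltmul b n := by
  rw [← smul_ltmul]
  exact congrArg ((C.lineBi e).toTensor F W) (BiPresheaf.smul_tmul' (C.lineBi e) r b n).symm

theorem res_ltmul {V : Opens C.base} (h : V ≤ W) (b : C.Line e W) (n : MSec F W) :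
    mres (lineTensor e F) h (ltmul b n) = ltmul (resLine h b) (mres F h n) :=
  ((C.lineBi e).toTensor_res F h (b ⊗ₜ n)).symm

/-- Functoriality of `L ⊗ F` in `F`. -/
def lineTensorMap (e : C.I → C.P → ℂ) (f : F ⟶ F') : lineTensor e F ⟶ lineTensor e F' :=
  (C.lineBi e).tensor.map f

theorem map_ltmul (f : F ⟶ F') (b : C.Line e W) (n : MSec F W) :
    mapp (lineTensorMap e f) W (ltmul b n) = ltmul b (mapp f W n) :=
  BiPresheaf.Balanced.desc_toTensor (C.lineBi e) ((C.lineBi e).mapBalanced f) W (b ⊗ₜ n)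

/-- The balanced maps `(b, n) ↦ (v ↦ b v ⊗ n)`. -/
def mulBalanced (he : e * e' = e'') (F : C.space.Mod) :
    (C.lineBi e).Balanced F (homMod e' (lineTensor e'' F)) where
  φ W := AddMonoidHom.mk' (fun b => AddMonoidHom.mk' (fun n => mkSec
      { ev := fun V h v => ltmul (mulLine he (resLine h b) v) (mres F h n)
        map_add := fun V h u v => by rw [mulLine_add, add_ltmul]
        map_smul := fun V h r u => by rw [mulLine_smul, smul_ltmul]
        nat := fun h k u => by
          rw [res_ltmul, resLine_mulLine]
          exact congrArg (ltmul (mulLine he (resLine (k.trans h) b) (resLine k u)))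
            (RSpace.Mod.res_res (X := C.space) k h n).symm })
      (fun n n' => hom_sec_ext fun V h v =>
        (congrArg (ltmul _) (RSpace.Mod.res_add (X := C.space) h n n')).trans (ltmul_add _ _ _)))
    (fun b b' => by
      ext n
      exact hom_sec_ext fun V h v => (congrArg (fun x => ltmul x (mres F h n))
        (add_mulLine he (resLine h b) (resLine h b') v)).trans (add_ltmul _ _ _))
  hO W r b n := hom_sec_ext fun V h v => by
    change ltmul (mulLine he (resO h r • resLine h b) v) (mres F h n) =
      ltmul (mulLine he (resLine h b) v) (mres F h (r • n))
    rw [smul_mulLine, smul_ltmul]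
    exact (ltmul_smul _ _ _).symm.trans (congrArg _ (Cover.res_smul h r n).symm)
  hS W r b n := hom_sec_ext fun V h v => by
    change ltmul (mulLine he (resO h r • resLine h b) v) (mres F h n) =
      resO h r • ltmul (mulLine he (resLine h b) v) (mres F h n)
    rw [smul_mulLine, smul_ltmul]
  hn {U V} h b n := hom_sec_ext fun W k v =>
    congrArg (ltmul (mulLine he (resLine (k.trans h) b) v))
      (RSpace.Mod.res_res (X := C.space) k h n)

/-- Multiplication of sections of `L ⊗ F` with sections of `L'`, as a morphism
`L ⊗ F → Hom(L', L'' ⊗ F)` for `L ⊗ L' = L''`. -/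
def mulHom (he : e * e' = e'') (F : C.space.Mod) :
    lineTensor e F ⟶ homMod e' (lineTensor e'' F) := (mulBalanced he F).desc _

/-- The product of a section of `L ⊗ F` with a section of `L'`. -/
def tmulLine (he : e * e' = e'') (s : MSec (lineTensor e F) W) (u : C.Line e' W) :
    MSec (lineTensor e'' F) W := hev (mapp (mulHom he F) W s) le_rfl u

variable (he : e * e' = e'')

theorem ltmul_tmulLine (b : C.Line e W) (n : MSec F W) (u : C.Line e' W) :
    tmulLine he (ltmul b n) u = ltmul (mulLine he b u) n := by
  have h1 := BiPresheaf.Balanced.desc_toTensor (C.lineBi e) (mulBalanced he F) W (b ⊗ₜ n)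
  refine (congrArg (fun G => hev (e := e') (M := lineTensor e'' F) G le_rfl u) h1).trans ?_
  exact congrArg (ltmul (mulLine he b u)) (RSpace.Mod.res_self (X := C.space) n)

theorem add_tmulLine (s s' : MSec (lineTensor e F) W) (u : C.Line e' W) :
    tmulLine he (s + s') u = tmulLine he s u + tmulLine he s' u :=
  (congrArg (fun G => hev (e := e') (M := lineTensor e'' F) G le_rfl u)
    (map_add (mapp (mulHom he F) W) s s')).trans (hev_add _ _ _ _)

theorem smul_tmulLine (r : C.O W) (s : MSec (lineTensor e F) W) (u : C.Line e' W) :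
    tmulLine he (r • s) u = r • tmulLine he s u :=
  (congrArg (fun G => hev (e := e') (M := lineTensor e'' F) G le_rfl u)
    (app_smul (mulHom he F) r s)).trans (hev_smul _ _ _ _)

theorem tmulLine_add (s : MSec (lineTensor e F) W) (u u' : C.Line e' W) :
    tmulLine he s (u + u') = tmulLine he s u + tmulLine he s u' := hev_map_add _ _ _ _

theorem tmulLine_smul (r : C.O W) (s : MSec (lineTensor e F) W) (u : C.Line e' W) :
    tmulLine he s (r • u) = r • tmulLine he s u := hev_map_smul _ _ _ _

theorem res_tmulLine {V : Opens C.base} (h : V ≤ W) (s : MSec (lineTensor e F) W)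
    (u : C.Line e' W) : mres (lineTensor e'' F) h (tmulLine he s u) =
      tmulLine he (mres (lineTensor e F) h s) (resLine h u) := by
  refine (hev_nat (mapp (mulHom he F) W s) le_rfl h u).symm.trans ?_
  exact congrArg (fun G => hev (e := e') (M := lineTensor e'' F) G le_rfl (resLine h u))
    (RSpace.Mod.app_res (X := C.space) (mulHom he F) h s).symm

/-- Multiplication with a section of `L'`, as an additive map. -/
def tmulLineHom (u : C.Line e' W) : MSec (lineTensor e F) W →+ MSec (lineTensor e'' F) W :=
  AddMonoidHom.mk' (fun s => tmulLine he s u) fun s s' => add_tmulLine he s s' u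

end Cover

namespace Cover

variable {C : Cover} {e : C.I → C.P → ℂ} {F : C.space.Mod}

/-- A property of sections of `L ⊗ F` over the open subsets of `W₀` which is local and additive
holds if it holds for the sections `b ⊗ n`. -/
theorem line_induction {W₀ : Opens C.base}
    {P : ∀ W : Opens C.base, W ≤ W₀ → MSec (lineTensor e F) W → Prop}
    (loc : ∀ W hW s, (∀ y ∈ W, ∃ (V : Opens C.base) (h : V ≤ W), y ∈ V ∧
      P V (h.trans hW) (mres (lineTensor e F) h s)) → P W hW s)
    (zero : ∀ W hW, P W hW 0)
    (add : ∀ W hW s t, P W hW s → P W hW t → P W hW (s + t))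
    (tmul : ∀ W hW b n, P W hW (ltmul b n)) (s : MSec (lineTensor e F) W₀) : P W₀ le_rfl s := by
  refine (C.lineBi e).tensor_induction (P := fun W s => ∀ hW : W ≤ W₀, P W hW s) ?_ ?_ ?_ ?_ W₀ s
    le_rfl
  · intro W s hs hW
    refine loc W hW s fun y hy => ?_
    obtain ⟨V, h, hV, hP⟩ := hs y hy
    exact ⟨V, h, hV, hP (h.trans hW)⟩
  · exact fun W hW => zero W hW
  · exact fun W s t h1 h2 hW => add W hW s t (h1 hW) (h2 hW)
  · exact fun W b n hW => tmul W hW b n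

theorem eq_of_local (M : C.space.Mod) {W : Opens C.base} {s t : MSec M W}
    (h : ∀ y ∈ W, ∃ (V : Opens C.base) (k : V ≤ W), y ∈ V ∧ mres M k s = mres M k t) : s = t := by
  choose V hV hy hP using h
  exact RSpace.Mod.eq_of_res (X := C.space) M (fun y : W => V y.1 y.2)
    (fun y => hV y.1 y.2) (fun y hy' => Opens.mem_iSup.2 ⟨⟨y, hy'⟩, hy y hy'⟩) _ _
    fun y => hP y.1 y.2

theorem mres_mres (M : C.space.Mod) {U V W : Opens C.base} (h : U ≤ V) (h' : V ≤ W)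
    (m : MSec M W) : mres M h (mres M h' m) = mres M (h.trans h') m :=
  RSpace.Mod.res_res (X := C.space) h h' m

theorem mres_self (M : C.space.Mod) {W : Opens C.base} (m : MSec M W) : mres M le_rfl m = m :=
  RSpace.Mod.res_self (X := C.space) m

theorem mres_add (M : C.space.Mod) {V W : Opens C.base} (h : V ≤ W) (m n : MSec M W) :
    mres M h (m + n) = mres M h m + mres M h n := RSpace.Mod.res_add (X := C.space) h m n

theorem mres_zero (M : C.space.Mod) {V W : Opens C.base} (h : V ≤ W) :
    mres M h (0 : MSec M W) = 0 := RSpace.Mod.res_zero (X := C.space) h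

theorem mapp_mres {M N : C.space.Mod} (f : M ⟶ N) {V W : Opens C.base} (h : V ≤ W)
    (m : MSec M W) : mapp f V (mres M h m) = mres N h (mapp f W m) :=
  RSpace.Mod.app_res (X := C.space) f h m

variable {e' e'' : C.I → C.P → ℂ}

theorem tmulLine_tmulLine {c d' : C.I → C.P → ℂ} (h₁ : e * e' = c) (h₂ : c * e'' = d')
    {f : C.I → C.P → ℂ} (h₃ : e' * e'' = f) (h₄ : e * f = d') {W : Opens C.base}
    (s : MSec (lineTensor e F) W) (u : C.Line e' W) (v : C.Line e'' W) :
    tmulLine h₂ (tmulLine h₁ s u) v = tmulLine h₄ s (mulLine h₃ u v) := by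
  refine line_induction (P := fun V hV s => tmulLine h₂ (tmulLine h₁ s (resLine hV u))
    (resLine hV v) = tmulLine h₄ s (resLine hV (mulLine h₃ u v))) ?_ ?_ ?_ ?_ s
  · intro W hW s hs
    refine eq_of_local _ fun y hy => ?_
    obtain ⟨V, h, hV, hP⟩ := hs y hy
    refine ⟨V, h, hV, ?_⟩
    rw [res_tmulLine, res_tmulLine, res_tmulLine]
    exact hP
  · intro W hW
    have h0 : ∀ {e e' e''} (he : e * e' = e'') (u : C.Line e' W),
      tmulLine he (0 : MSec (lineTensor e F) W) u = 0 := fun he u => map_zero (tmulLineHom he u)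
    rw [h0, h0, h0]
  · intro W hW s t h h'
    rw [add_tmulLine, add_tmulLine, add_tmulLine, h, h']
  · intro W hW b n
    rw [ltmul_tmulLine, ltmul_tmulLine, ltmul_tmulLine]
    refine congrArg (fun x => ltmul x n) (Subtype.ext ?_)
    exact mul_assoc _ _ _

theorem map_tmulLine {F' : C.space.Mod} (f : F ⟶ F') (he : e * e' = e'') {W : Opens C.base}
    (s : MSec (lineTensor e F) W) (u : C.Line e' W) :
    mapp (lineTensorMap e'' f) W (tmulLine he s u) =
      tmulLine he (mapp (lineTensorMap e f) W s) u := by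
  refine line_induction (P := fun V hV s => mapp (lineTensorMap e'' f) V
    (tmulLine he s (resLine hV u)) = tmulLine he (mapp (lineTensorMap e f) V s)
      (resLine hV u)) ?_ ?_ ?_ ?_ s
  · intro W hW s hs
    refine eq_of_local _ fun y hy => ?_
    obtain ⟨V, h, hV, hP⟩ := hs y hy
    refine ⟨V, h, hV, ?_⟩
    rw [res_tmulLine, ← mapp_mres, ← mapp_mres, res_tmulLine]
    exact hP
  · intro W hW
    have h0 : ∀ {F} (u : C.Line e' W),
      tmulLine he (0 : MSec (lineTensor e F) W) u = 0 := fun u => map_zero (tmulLineHom he u)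
    rw [h0, map_zero, map_zero, h0]
  · intro W hW s t h h'
    rw [add_tmulLine, map_add, map_add, add_tmulLine, h, h']
  · intro W hW b n
    rw [ltmul_tmulLine, map_ltmul, map_ltmul, ltmul_tmulLine]

end Cover

/-! ### Semilinear maps of line bundles along a map of covered spaces -/

namespace CoverHom

variable {C D : Cover}

/-- A map of line bundles over a map `f` of covered spaces: an additive map from the sections over
`W` to the sections over `f⁻¹ W`, linear along the pull-back of functions. -/
structure LineMap (f : CoverHom C D) (e : D.I → D.P → ℂ) (e' : C.I → C.P → ℂ) where
  app : ∀ W : Opens D.base, D.Line e W →+ C.Line e' (f.pre W)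
  smul : ∀ (W) (r : D.O W) (b), app W (r • b) = f.onO W r • app W b
  nat : ∀ {V W : Opens D.base} (h : V ≤ W) (b), app V (Cover.resLine h b) =
    Cover.resLine ((Opens.map f.base).map (homOfLE h)).le (app W b)

theorem pre_mono (f : CoverHom C D) {V W : Opens D.base} (h : V ≤ W) : f.pre V ≤ f.pre W :=
  ((Opens.map f.base).map (homOfLE h)).le

variable {f : CoverHom C D} {e : D.I → D.P → ℂ} {e' : C.I → C.P → ℂ} (m : f.LineMap e e')
  {F : D.space.Mod} {F' : C.space.Mod} (β : F ⟶ f.toRHom.push.obj F')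

/-- A morphism into a direct image, on sections. -/
def papp (W : Opens D.base) : Cover.MSec F W →+ Cover.MSec F' (f.pre W) :=
  RSpace.Mod.app (X := D.space) β W

theorem papp_smul {W : Opens D.base} (r : D.O W) (n : Cover.MSec F W) :
    papp β W (r • n) = f.onO W r • papp β W n :=
  RSpace.Mod.app_smul (X := D.space) β W r n

theorem papp_res {V W : Opens D.base} (h : V ≤ W) (n : Cover.MSec F W) :
    papp β V (Cover.mres F h n) = Cover.mres F' (f.pre_mono h) (papp β W n) :=
  RSpace.Mod.app_res (X := D.space) β h n

open Cover in
/-- The balanced maps `(b, n) ↦ m b ⊗ β n`. -/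
def tensorBalanced : (D.lineBi e).Balanced F (f.toRHom.push.obj (lineTensor e' F')) where
  φ W := AddMonoidHom.mk' (fun b => AddMonoidHom.mk'
      (fun n => ltmul (m.app W b) (papp β W n))
      (fun n n' => (congrArg (ltmul (m.app W b)) (map_add (papp β W) n n')).trans
        (ltmul_add _ _ _)))
    (fun b b' => by
      ext n
      exact (congrArg (fun x => ltmul x (papp β W n)) (map_add (m.app W) b b')).trans
        (add_ltmul _ _ _))
  hO W r b n := by
    change ltmul (m.app W (r • b)) (papp β W n) = ltmul (m.app W b) (papp β W (r • n))
    have h1 : m.app W (r • b) = _ := m.smul W r b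
    rw [papp_smul, h1, smul_ltmul]
    exact (ltmul_smul _ _ _).symm
  hS W r b n := (congrArg (fun x => ltmul x (papp β W n)) (m.smul W r b)).trans (smul_ltmul _ _ _)
  hn {U V} h b n := by
    have h1 : m.app U (resLine h b) = _ := m.nat h b
    change ltmul (m.app U (resLine h b)) (papp β U (mres F h n)) = _
    rw [h1, papp_res]
    exact (res_ltmul (f.pre_mono h) (m.app V b) (papp β V n)).symm

/-- The morphism `L ⊗ F → f_* (L' ⊗ F')` given by a map of line bundles over `f` and by a morphism
`F → f_* F'`. -/
def tensorMap : Cover.lineTensor e F ⟶ f.toRHom.push.obj (Cover.lineTensor e' F') :=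
  (tensorBalanced m β).desc _

open Cover in
theorem tensorMap_ltmul {W : Opens D.base} (b : D.Line e W) (n : MSec F W) :
    papp (tensorMap m β) W (ltmul b n) = ltmul (m.app W b) (papp β W n) :=
  BiPresheaf.Balanced.desc_toTensor (D.lineBi e) (tensorBalanced m β) W (b ⊗ₜ n)

end CoverHom

/-! ### Sections of inverse images -/

namespace CoverHom

variable {C D : Cover} (f : CoverHom C D)

/-- The inverse image of a section. -/
def punit (M : D.space.Mod) (U : Opens D.base) :
    Cover.MSec M U →+ Cover.MSec (f.toRHom.pull.obj M) (f.pre U) :=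
  papp (f := f) (f.toRHom.adj.unit.app M) U

theorem punit_res (M : D.space.Mod) {U V : Opens D.base} (h : U ≤ V) (m : Cover.MSec M V) :
    f.punit M U (Cover.mres M h m) =
      Cover.mres (f.toRHom.pull.obj M) (f.pre_mono h) (f.punit M V m) :=
  papp_res _ h m

theorem punit_smul (M : D.space.Mod) {U : Opens D.base} (r : D.O U) (m : Cover.MSec M U) :
    f.punit M U (r • m) = f.onO U r • f.punit M U m :=
  papp_smul _ r m

theorem mapp_pull_punit {M M' : D.space.Mod} (φ : M ⟶ M') (U : Opens D.base)
    (m : Cover.MSec M U) : Cover.mapp (f.toRHom.pull.map φ) (f.pre U) (f.punit M U m) =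
      f.punit M' U (Cover.mapp φ U m) := by
  have h1 := f.toRHom.adj.unit.naturality φ
  exact (congrArg (fun F => RSpace.Mod.app (X := D.space) F U m) h1).symm

/-- A morphism out of an inverse image is determined by its values on inverse images of
sections. -/
theorem pull_hom_ext {M : D.space.Mod} {N : C.space.Mod} {φ ψ : f.toRHom.pull.obj M ⟶ N}
    (h : ∀ U m, Cover.mapp φ (f.pre U) (f.punit M U m) = Cover.mapp ψ (f.pre U) (f.punit M U m)) :
    φ = ψ := by
  apply (f.toRHom.adj.homEquiv _ _).injective
  rw [Adjunction.homEquiv_unit, Adjunction.homEquiv_unit]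
  exact RSpace.Mod.hom_ext (X := D.space) fun U m => h U m

theorem homEquiv_symm_punit {M : D.space.Mod} {N : C.space.Mod} (φ : M ⟶ f.toRHom.push.obj N)
    (U : Opens D.base) (m : Cover.MSec M U) :
    Cover.mapp ((f.toRHom.adj.homEquiv M N).symm φ) (f.pre U) (f.punit M U m) = papp φ U m := by
  have h1 := Equiv.apply_symm_apply (f.toRHom.adj.homEquiv M N) φ
  rw [Adjunction.homEquiv_unit] at h1
  exact congrArg (fun F => RSpace.Mod.app (X := D.space) F U m) h1

theorem pull_map_smul {M M' : D.space.Mod} (z : ℂ) (φ : M ⟶ M') :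
    f.toRHom.pull.map (z • φ) = z • f.toRHom.pull.map φ := by
  refine f.pull_hom_ext fun U m => ?_
  rw [mapp_pull_punit, Cover.smul_hom_app, punit_smul, ← mapp_pull_punit]
  rfl

theorem pushIso_inv_app {E : Cover} (f : CoverHom C D) (g : CoverHom D E) (h : CoverHom C E)
    (hb : f.base ≫ g.base = h.base) (M : C.space.Mod) (U : Opens E.base)
    (x : Cover.MSec M (h.pre U)) (hU : f.pre (g.pre U) ≤ h.pre U) :
    RSpace.Mod.app (X := E.space) ((f.pushIso g h hb).inv.app M) U x = Cover.mres M hU x := by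
  have h1 : (f.pushIso g h hb).hom.app M ≫ (f.pushIso g h hb).inv.app M = 𝟙 _ := by simp
  have hU' : h.pre U ≤ f.pre (g.pre U) := fun y hy => by
    change g.base (f.base y) ∈ U
    have h2 : g.base (f.base y) = h.base y := ConcreteCategory.congr_hom hb y
    rw [h2]
    exact hy
  have h2 := congrArg (fun F => RSpace.Mod.app (X := E.space) F U (Cover.mres M hU x)) h1
  refine Eq.trans ?_ h2
  refine congrArg (RSpace.Mod.app (X := E.space) ((f.pushIso g h hb).inv.app M) U) ?_
  exact ((Cover.mres_mres M hU' hU x).trans (Cover.mres_self M x)).symm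

end CoverHom

namespace Torus

variable {g : ℕ} (X : Torus g) (d : DefParam g)

theorem tr_pre_q_pre (k : d.Kh) (U : Opens (X.coverYh d).base) :
    (X.tr d k).pre ((X.q d).pre U) ≤ (X.q d).pre ((X.tau d k).pre U) := fun _ h => h

/-- The base change morphism of a sheaf. -/
def bc (k : d.Kh) (M : (X.coverYh d).space.Mod) :
    (X.q d).toRHom.pull.obj ((X.tau d k).toRHom.push.obj M) ⟶
      (X.tr d k).toRHom.push.obj ((X.q d).toRHom.pull.obj M) := (X.baseChange d k).app M

theorem papp_bc_punit (k : d.Kh) (M : (X.coverYh d).space.Mod) (U : Opens (X.coverYh d).base)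
    (m : Cover.MSec M ((X.tau d k).pre U)) :
    CoverHom.papp (X.bc d k M) ((X.q d).pre U)
      ((X.q d).punit ((X.tau d k).toRHom.push.obj M) U m) =
    Cover.mres ((X.q d).toRHom.pull.obj M) (X.tr_pre_q_pre d k U)
      ((X.q d).punit M ((X.tau d k).pre U) m) := by
  refine ((X.q d).homEquiv_symm_punit (M := (X.tau d k).toRHom.push.obj M)
    (N := (X.tr d k).toRHom.push.obj ((X.q d).toRHom.pull.obj M)) _ U m).trans ?_
  have h1 := CoverHom.pushIso_inv_app (X.tr d k) (X.q d) (X.trq d k) rfl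
    ((X.q d).toRHom.pull.obj M) U (Cover.mres ((X.q d).toRHom.pull.obj M)
      (show (X.trq d k).pre U ≤ (X.q d).pre ((X.tau d k).pre U) from fun _ h => h)
      ((X.q d).punit M ((X.tau d k).pre U) m)) (fun _ h => h)
  refine Eq.trans ?_ (h1.trans (Cover.mres_mres _ _ _ _))
  rfl

end Torus

namespace Torus

variable {g : ℕ} (X : Torus g) (d : DefParam g)

theorem bc_naturality (k : d.Kh) {M M' : (X.coverYh d).space.Mod} (φ : M ⟶ M') :
    (X.q d).toRHom.pull.map ((X.tau d k).toRHom.push.map φ) ≫ X.bc d k M' =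
      X.bc d k M ≫ (X.tr d k).toRHom.push.map ((X.q d).toRHom.pull.map φ) :=
  (X.baseChange d k).naturality φ

theorem tr_comp {g' h k : d.Kh} (hk : g' * h = k) :
    (X.tr d h).base ≫ (X.tr d g').base = (X.tr d k).base := by
  ext y
  have key : ∀ y : X.Y d × X.Yh d,
      (y.1, y.2 * (X.kap d h)⁻¹ * (X.kap d g')⁻¹) = (y.1, y.2 * (X.kap d k)⁻¹) := fun y => by
    rw [← hk, map_mul]
    refine congrArg (Prod.mk y.1) ((mul_assoc y.2 _ _).trans (congrArg (fun t => y.2 * t) ?_))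
    exact (mul_inv_rev (X.kap d g') (X.kap d h)).symm
  exact key y

theorem tr_pre_tr_pre {g' h k : d.Kh} (hk : g' * h = k) (W : Opens (X.coverYY d).base) :
    (X.tr d h).pre ((X.tr d g').pre W) = (X.tr d k).pre W := by
  rw [CoverHom.pre, CoverHom.pre, CoverHom.pre, ← X.tr_comp d hk]
  rfl

/-- The coherence isomorphism of the action of `K̂` on sheaves on `Ŷ`. -/
def cYh {g' h k : d.Kh} (hk : g' * h = k) (M : (X.coverYh d).space.Mod) :
    (X.tau d g').toRHom.push.obj ((X.tau d h).toRHom.push.obj M) ⟶ (X.tau d k).toRHom.push.obj M :=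
  ((X.actYh d).c hk).hom.app M

theorem tau_pre_tau_pre {g' h k : d.Kh} (hk : g' * h = k) (U : Opens (X.coverYh d).base) :
    (X.tau d k).pre U = (X.tau d h).pre ((X.tau d g').pre U) := by
  refine Opens.ext (Set.ext fun (y : X.Yh d) => ?_)
  have h1 : y * (X.kap d k)⁻¹ = y * (X.kap d h)⁻¹ * (X.kap d g')⁻¹ := by
    rw [← hk, map_mul]
    refine Eq.trans (congrArg (fun t => y * t) ?_) (mul_assoc y _ _).symm
    exact mul_inv_rev (X.kap d g') (X.kap d h)
  exact iff_of_eq (congrArg (fun y : (X.coverYh d).base => y ∈ U) h1)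

open CoverHom in
/-- The base change morphisms are compatible with the composition of translations. -/
theorem bc_bc {g' h k : d.Kh} (hk : g' * h = k) (M : (X.coverYh d).space.Mod)
    {W : Opens (X.coverYY d).base}
    (n : Cover.MSec ((X.q d).toRHom.pull.obj
      ((X.tau d g').toRHom.push.obj ((X.tau d h).toRHom.push.obj M))) W) :
    papp (X.bc d h M) ((X.tr d g').pre W) (papp (X.bc d g' ((X.tau d h).toRHom.push.obj M)) W n) =
      Cover.mres ((X.q d).toRHom.pull.obj M) (X.tr_pre_tr_pre d hk W).le
        (papp (X.bc d k M) W (Cover.mapp ((X.q d).toRHom.pull.map (X.cYh d hk M)) W n)) := by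
  have key : X.bc d g' ((X.tau d h).toRHom.push.obj M) ≫
        (X.tr d g').toRHom.push.map (X.bc d h M) =
      ((X.q d).toRHom.pull.map (X.cYh d hk M) ≫ X.bc d k M) ≫
        ((X.tr d h).pushIso (X.tr d g') (X.tr d k) (X.tr_comp d hk)).inv.app _ := by
    refine (X.q d).pull_hom_ext fun U m => ?_
    have h1 : papp (X.bc d h M) ((X.tr d g').pre ((X.q d).pre U))
        (papp (X.bc d g' ((X.tau d h).toRHom.push.obj M)) ((X.q d).pre U)
          ((X.q d).punit _ U m)) = Cover.mres ((X.q d).toRHom.pull.obj M)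
            (((X.tr d h).pre_mono (X.tr_pre_q_pre d g' U)).trans
              (X.tr_pre_q_pre d h ((X.tau d g').pre U)))
            ((X.q d).punit M ((X.tau d h).pre ((X.tau d g').pre U)) m) := by
      refine (congrArg (papp (X.bc d h M) ((X.tr d g').pre ((X.q d).pre U)))
        (papp_bc_punit X d g' ((X.tau d h).toRHom.push.obj M) U m)).trans ?_
      refine (papp_res (X.bc d h M) (X.tr_pre_q_pre d g' U) _).trans ?_
      refine (congrArg (Cover.mres ((X.q d).toRHom.pull.obj M)
        ((X.tr d h).pre_mono (X.tr_pre_q_pre d g' U)))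
        (papp_bc_punit X d h M ((X.tau d g').pre U) m)).trans ?_
      exact Cover.mres_mres _ _ _ _
    have h2 : papp (X.bc d k M) ((X.q d).pre U)
        (Cover.mapp ((X.q d).toRHom.pull.map (X.cYh d hk M)) ((X.q d).pre U)
          ((X.q d).punit _ U m)) = Cover.mres ((X.q d).toRHom.pull.obj M)
            ((X.tr_pre_q_pre d k U).trans ((X.q d).pre_mono (X.tau_pre_tau_pre d hk U).le))
            ((X.q d).punit M ((X.tau d h).pre ((X.tau d g').pre U)) m) := by
      rw [mapp_pull_punit]
      refine (papp_bc_punit X d k M U _).trans ?_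
      refine (congrArg _ (punit_res (X.q d) M (X.tau_pre_tau_pre d hk U).le m)).trans ?_
      exact Cover.mres_mres _ _ _ _
    have h3 := pushIso_inv_app (X.tr d h) (X.tr d g') (X.tr d k) (X.tr_comp d hk)
      ((X.q d).toRHom.pull.obj M) ((X.q d).pre U) (papp (X.bc d k M) ((X.q d).pre U)
        (Cover.mapp ((X.q d).toRHom.pull.map (X.cYh d hk M)) ((X.q d).pre U)
          ((X.q d).punit _ U m))) (X.tr_pre_tr_pre d hk _).le
    have h4 := congrArg (Cover.mres ((X.q d).toRHom.pull.obj M)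
      (X.tr_pre_tr_pre d hk ((X.q d).pre U)).le) h2
    refine h1.trans (Eq.trans ?_ h3.symm)
    exact (h4.trans (Cover.mres_mres _ _ _ _)).symm
  have h3 := congrArg (fun F => RSpace.Mod.app (X := (X.coverYY d).space) F W n) key
  have h4 := pushIso_inv_app (X.tr d h) (X.tr d g') (X.tr d k) (X.tr_comp d hk)
    ((X.q d).toRHom.pull.obj M) W (papp (X.bc d k M) W
      (Cover.mapp ((X.q d).toRHom.pull.map (X.cYh d hk M)) W n)) (X.tr_pre_tr_pre d hk W).le
  exact h3.trans h4

/-- The isomorphism `R_1^* M ≅ M`. -/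
def tauOne (M : (X.coverYh d).space.Mod) : (X.tau d 1).toRHom.push.obj M ≅ M :=
  ((X.tau d 1).pushOne (show ∀ y : X.Yh d, y * (X.kap d 1)⁻¹ = y from fun y => by
    rw [map_one, inv_one]; exact mul_one y)).app M

theorem tau_one_pre (U : Opens (X.coverYh d).base) : (X.tau d 1).pre U = U := by
  refine Opens.ext (Set.ext fun (y : X.Yh d) => ?_)
  have h1 : y * (X.kap d 1)⁻¹ = y := by
    rw [map_one, inv_one]
    exact mul_one y
  exact iff_of_eq (congrArg (fun y : (X.coverYh d).base => y ∈ U) h1)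

theorem mul_kap_one (y : X.Y d × X.Yh d) : (y.1, y.2 * (X.kap d 1)⁻¹) = y := by
  refine Prod.ext rfl ?_
  rw [map_one, inv_one]
  exact mul_one y.2

theorem tr_one_pre (W : Opens (X.coverYY d).base) : (X.tr d 1).pre W = W := by
  refine Opens.ext (Set.ext fun (y : X.Y d × X.Yh d) => ?_)
  exact iff_of_eq (congrArg (fun y : (X.coverYY d).base => y ∈ W) (X.mul_kap_one d y))

open CoverHom in
theorem bc_one (M : (X.coverYh d).space.Mod) {W : Opens (X.coverYY d).base}
    (n : Cover.MSec ((X.q d).toRHom.pull.obj ((X.tau d 1).toRHom.push.obj M)) W) :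
    papp (X.bc d 1 M) W n = Cover.mres ((X.q d).toRHom.pull.obj M) (X.tr_one_pre d W).le
      (Cover.mapp ((X.q d).toRHom.pull.map (X.tauOne d M).hom) W n) := by
  let ι : (X.q d).toRHom.pull.obj M ⟶ (X.tr d 1).toRHom.push.obj ((X.q d).toRHom.pull.obj M) :=
    RSpace.Mod.mkHom (X := (X.coverYY d).space) _ _
      (fun W => AddMonoidHom.mk'
        (fun n => Cover.mres ((X.q d).toRHom.pull.obj M) (X.tr_one_pre d W).le n)
        (fun n n' => Cover.mres_add _ _ _ _))
      (fun W r n => by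
        refine (Cover.res_smul (X.tr_one_pre d W).le r n).trans ?_
        refine congrArg (fun s : (X.coverYY d).O ((X.tr d 1).pre W) => s • _)
          (Subtype.ext (funext fun y => ?_))
        refine congrArg (Subtype.val (show (X.coverYY d).O W from r)) (Subtype.ext ?_)
        exact (X.mul_kap_one d y.1).symm)
      (fun h n => (Cover.mres_mres _ _ _ _).trans (Cover.mres_mres _ _ _ _).symm)
  have key : X.bc d 1 M = (X.q d).toRHom.pull.map (X.tauOne d M).hom ≫ ι := by
    refine (X.q d).pull_hom_ext fun U m => ?_
    refine (papp_bc_punit X d 1 M U m).trans ?_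
    refine Eq.trans ?_ (congrArg (Cover.mres ((X.q d).toRHom.pull.obj M)
      (X.tr_one_pre d ((X.q d).pre U)).le) (mapp_pull_punit (X.q d) (X.tauOne d M).hom U m)).symm
    refine Eq.trans ?_ (congrArg (Cover.mres ((X.q d).toRHom.pull.obj M)
      (X.tr_one_pre d ((X.q d).pre U)).le) (punit_res (X.q d) M (X.tau_one_pre d U).ge m)).symm
    exact (Cover.mres_mres _ _ _ _).symm
  exact congrArg (fun F => RSpace.Mod.app (X := (X.coverYY d).space) F W n) key

end Torus

/-! ### Translations of sections of the Poincaré bundle -/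

namespace Torus

variable {g : ℕ} (X : Torus g) (d : DefParam g)

/-- The behaviour of the sections of `Q ⊗ L s` under translations of the second variable by
`η ∈ Ĥ`. -/
theorem line_move_res {s : d.Kh} {W : Opens (X.coverYY d).base} {f : (X.coverYY d).Up W}
    (hf : f ∈ (X.coverYY d).line (X.eQ d * X.eYY d s) W) {η : That g} (hη : η ∈ d.Hh)
    (x c : Tor g) (hz : (X.coverYY d).π (x, c) ∈ W) (hz' : (X.coverYY d).π (x, c * X.res η) ∈ W) :
    f.1 ⟨(x, c * X.res η), hz'⟩ = ((mono η x)⁻¹ : ℂˣ) * f.1 ⟨(x, c), hz⟩ := by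
  have h1 := hf (Sum.inr (Sum.inr ⟨η, hη⟩)) ⟨(x, c), hz⟩ ⟨(x, c * X.res η), hz'⟩ rfl
  refine h1.trans ?_
  change ((((mono η x)⁻¹ : ℂˣ) : ℂ) * 1) * _ = _
  rw [mul_one]

/-- The translations `ψ ↦ t(x)⁻¹ ψ(x, χ t⁻¹)` compose. The product of the chosen representatives of
two elements of `K̂` differs from the chosen representative of their product by an element of `Ĥ`,
under which the sections of `Q ⊗ L s` transform by the inverse of the same character. -/
theorem shift_shift {g' h k s : d.Kh} (hk : g' * h = k) {W : Opens (X.coverYY d).base}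
    {f : (X.coverYY d).Up W} (hf : f ∈ (X.coverYY d).line (X.eQ d * X.eYY d s) W) :
    X.shift d h (X.shift d g' f) = Cover.resUp (X.tr_pre_tr_pre d hk W).le (X.shift d k f) := by
  refine Subtype.ext (funext fun z => ?_)
  obtain ⟨⟨x, c⟩, hz⟩ := z
  have hη : (rep d k)⁻¹ * (rep d g' * rep d h) ∈ d.Hh := by
    rw [← QuotientGroup.eq, QuotientGroup.mk_mul, mk_rep, mk_rep, mk_rep, hk]
  obtain ⟨η, hη'⟩ : ∃ η, η = (rep d k)⁻¹ * (rep d g' * rep d h) := ⟨_, rfl⟩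
  rw [← hη'] at hη
  have e1 : rep d g' * rep d h = rep d k * η := by rw [hη', mul_inv_cancel_left]
  have hz1 := (X.tr d h).mem_pre hz
  have hz2 : (X.coverYY d).π (x, c * (X.res (rep d h))⁻¹ * (X.res (rep d g'))⁻¹) ∈ W :=
    (X.tr d g').mem_pre hz1
  have hz3 : (X.coverYY d).π (x, c * (X.res (rep d k))⁻¹) ∈ W :=
    (X.tr d k).mem_pre ((X.tr_pre_tr_pre d hk W).le hz)
  have e2 : c * (X.res (rep d k))⁻¹ =
      c * (X.res (rep d h))⁻¹ * (X.res (rep d g'))⁻¹ * X.res η := by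
    have h1 : X.res (rep d k) * X.res η = X.res (rep d g') * X.res (rep d h) := by
      rw [← map_mul, ← e1, map_mul]
    rw [eq_inv_mul_of_mul_eq h1, mul_comm (X.res (rep d k))⁻¹, ← mul_assoc, ← mul_assoc,
      inv_mul_cancel_right, inv_mul_cancel_right]
  have h4 := X.line_move_res d hf hη x (c * (X.res (rep d h))⁻¹ * (X.res (rep d g'))⁻¹) hz2
    (by rw [← e2]; exact hz3)
  change (((mono (rep d h) x)⁻¹ : ℂˣ) : ℂ) * ((((mono (rep d g') x)⁻¹ : ℂˣ) : ℂ) *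
    f.1 ⟨(x, c * (X.res (rep d h))⁻¹ * (X.res (rep d g'))⁻¹), hz2⟩) =
      (((mono (rep d k) x)⁻¹ : ℂˣ) : ℂ) * f.1 ⟨(x, c * (X.res (rep d k))⁻¹), hz3⟩
  have e3 : f.1 ⟨(x, c * (X.res (rep d k))⁻¹), hz3⟩ =
      f.1 ⟨(x, c * (X.res (rep d h))⁻¹ * (X.res (rep d g'))⁻¹ * X.res η),
        by rw [← e2]; exact hz3⟩ :=
    congrArg f.1 (Subtype.ext (congrArg (Prod.mk x) e2))
  rw [e3, h4, ← mul_assoc, ← mul_assoc, ← Units.val_mul, ← Units.val_mul]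
  congr 2
  rw [← mul_inv, ← mul_inv, ← MonoidHom.mul_apply, ← MonoidHom.mul_apply, ← map_mul, ← map_mul,
    mul_comm (rep d h), e1]

theorem shift_one {s : d.Kh} {W : Opens (X.coverYY d).base}
    {f : (X.coverYY d).Up W} (hf : f ∈ (X.coverYY d).line (X.eQ d * X.eYY d s) W) :
    X.shift d 1 f = Cover.resUp (X.tr_one_pre d W).le f := by
  refine Subtype.ext (funext fun z => ?_)
  obtain ⟨⟨x, c⟩, hz⟩ := z
  have hη : (rep d 1)⁻¹ ∈ d.Hh := by
    rw [inv_mem_iff, ← QuotientGroup.eq_one_iff, mk_rep]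
  have hz2 : (X.coverYY d).π (x, c) ∈ W := (X.tr_one_pre d W).le hz
  have hz3 : (X.coverYY d).π (x, c * (X.res (rep d 1))⁻¹) ∈ W := (X.tr d 1).mem_pre hz
  have h4 := X.line_move_res d hf hη x c hz2 (by rw [map_inv]; exact hz3)
  change (((mono (rep d 1) x)⁻¹ : ℂˣ) : ℂ) * f.1 ⟨(x, c * (X.res (rep d 1))⁻¹), hz3⟩ =
    f.1 ⟨(x, c), hz2⟩
  have e3 : f.1 ⟨(x, c * (X.res (rep d 1))⁻¹), hz3⟩ =
      f.1 ⟨(x, c * X.res (rep d 1)⁻¹), by rw [map_inv]; exact hz3⟩ :=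
    congrArg f.1 (Subtype.ext (congrArg (fun t => (x, c * t)) (map_inv X.res _).symm))
  rw [e3, h4, ← mul_assoc, ← Units.val_mul, map_inv, MonoidHom.inv_apply, inv_inv,
    inv_mul_cancel, Units.val_one, one_mul]

/-- The map `Q ⊗ L (s k) → Q ⊗ L s` over the translation by `(1, k⁻¹)` which is given by
`ψ ↦ t(x)⁻¹ ψ(x, χ t⁻¹)` for a character `t` representing `k`. -/
def shiftMap (k s : d.Kh) {e e' : (X.coverYY d).I → (X.coverYY d).P → ℂ}
    (he : e = X.eQ d * X.eYY d (s * k)) (he' : e' = X.eQ d * X.eYY d s) :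
    (X.tr d k).LineMap e e' where
  app W := AddMonoidHom.mk' (fun b => ⟨X.shift d k b.1, by
      rw [he']; exact X.shift_mem d k s (by rw [← he]; exact b.2)⟩)
    fun b b' => Subtype.ext (by
      change X.monoInv d k _ * (X.tr d k).onUp W (b.1 + b'.1) =
        X.monoInv d k _ * (X.tr d k).onUp W b.1 + X.monoInv d k _ * (X.tr d k).onUp W b'.1
      rw [map_add, mul_add])
  smul W r b := Subtype.ext (Subtype.ext (funext fun z => by
    have h : (⟨(X.coverYY d).π ((X.tr d k).up z.1), (X.tr d k).mem_pre z.2⟩ : W) =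
        ⟨(X.tr d k).base ((X.coverYY d).π z.1), z.2⟩ := Subtype.ext ((X.tr d k).comm z.1)
    change (X.monoInv d k _).1 z * (r.1 ⟨(X.coverYY d).π ((X.tr d k).up z.1), _⟩ *
        b.1.1 ⟨(X.tr d k).up z.1, (X.tr d k).mem_pre z.2⟩) =
      r.1 ⟨(X.tr d k).base ((X.coverYY d).π z.1), _⟩ *
        ((X.monoInv d k _).1 z * b.1.1 ⟨(X.tr d k).up z.1, (X.tr d k).mem_pre z.2⟩)
    rw [h]
    ring))
  nat h b := rfl

end Torus

namespace CoverHom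

theorem eq_of_local_pre {C D : Cover} (f : CoverHom C D) (M : C.space.Mod) {W : Opens D.base}
    {s t : Cover.MSec M (f.pre W)}
    (h : ∀ y ∈ W, ∃ (V : Opens D.base) (k : V ≤ W), y ∈ V ∧
      Cover.mres M (f.pre_mono k) s = Cover.mres M (f.pre_mono k) t) : s = t :=
  Cover.eq_of_local M fun y hy => by
    obtain ⟨V, k, hV, e⟩ := h (f.base y) hy
    exact ⟨f.pre V, f.pre_mono k, hV, e⟩

end CoverHom

namespace Torus

open Cover CoverHom

variable {g : ℕ} (X : Torus g) (d : DefParam g)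

section theta

variable {F F' : (X.coverYY d).space.Mod} {e e' : (X.coverYY d).I → (X.coverYY d).P → ℂ}

/-- The morphism `ψ ⊗ n ↦ t(x)⁻¹ ψ(x, χ t⁻¹) ⊗ β n` from `Q ⊗ L (s k) ⊗ F` to the direct image of
`Q ⊗ L s ⊗ F'`, for a character `t` representing `k` and a morphism `β` over the translation by
`(1, k⁻¹)`. -/
def theta (k s : d.Kh) (he : e = X.eQ d * X.eYY d (s * k)) (he' : e' = X.eQ d * X.eYY d s)
    (β : F ⟶ (X.tr d k).toRHom.push.obj F') :
    lineTensor e F ⟶ (X.tr d k).toRHom.push.obj (lineTensor e' F') :=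
  tensorMap (X.shiftMap d k s he he') β

variable {k s : d.Kh} (he : e = X.eQ d * X.eYY d (s * k)) (he' : e' = X.eQ d * X.eYY d s)
    (β : F ⟶ (X.tr d k).toRHom.push.obj F')

theorem theta_ltmul {W : Opens (X.coverYY d).base} (b : (X.coverYY d).Line e W) (n : MSec F W) :
    papp (X.theta d k s he he' β) W (ltmul b n) =
      ltmul ((X.shiftMap d k s he he').app W b) (papp β W n) :=
  tensorMap_ltmul (X.shiftMap d k s he he') β b n

theorem theta_res {V W : Opens (X.coverYY d).base} (h : V ≤ W) (t : MSec (lineTensor e F) W) :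
    papp (X.theta d k s he he' β) V (mres _ h t) =
      mres (lineTensor e' F') ((X.tr d k).pre_mono h) (papp (X.theta d k s he he' β) W t) :=
  papp_res _ h t

/-- The composition of two translations; the two linearizations of the second factor compose up to
a constant `c`. -/
theorem theta_theta {g' h k s s' : d.Kh} (hk : g' * h = k) {F F' F'' : (X.coverYY d).space.Mod}
    {e e' e'' : (X.coverYY d).I → (X.coverYY d).P → ℂ}
    (h₁ : e = X.eQ d * X.eYY d (s' * g')) (h₁' : e' = X.eQ d * X.eYY d s')
    (h₂ : e' = X.eQ d * X.eYY d (s * h)) (h₂' : e'' = X.eQ d * X.eYY d s)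
    (h₃ : e = X.eQ d * X.eYY d (s * k))
    {β₁ : F ⟶ (X.tr d g').toRHom.push.obj F'} {β₂ : F' ⟶ (X.tr d h).toRHom.push.obj F''}
    {β₃ : F ⟶ (X.tr d k).toRHom.push.obj F''} (c : ℂ)
    (hβ : ∀ (W : Opens (X.coverYY d).base) (n : MSec F W), papp β₂ _ (papp β₁ W n) =
      algebraMap ℂ ((X.coverYY d).O ((X.tr d h).pre ((X.tr d g').pre W))) c •
        mres F'' (X.tr_pre_tr_pre d hk W).le (papp β₃ W n))
    {W : Opens (X.coverYY d).base} (t : MSec (lineTensor e F) W) :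
    papp (X.theta d h s h₂ h₂' β₂) _ (papp (X.theta d g' s' h₁ h₁' β₁) W t) =
      algebraMap ℂ ((X.coverYY d).O ((X.tr d h).pre ((X.tr d g').pre W))) c •
        mres (lineTensor e'' F'') (X.tr_pre_tr_pre d hk W).le
          (papp (X.theta d k s h₃ h₂' β₃) W t) := by
  refine line_induction (P := fun W _ t =>
    papp (X.theta d h s h₂ h₂' β₂) _ (papp (X.theta d g' s' h₁ h₁' β₁) W t) =
      algebraMap ℂ ((X.coverYY d).O ((X.tr d h).pre ((X.tr d g').pre W))) c •
        mres (lineTensor e'' F'') (X.tr_pre_tr_pre d hk W).le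
          (papp (X.theta d k s h₃ h₂' β₃) W t)) ?_ ?_ ?_ ?_ t
  · intro W _ t ht
    refine eq_of_local _ fun y hy => ?_
    obtain ⟨V, k', hV, e⟩ := ht _ hy
    refine ⟨(X.tr d h).pre ((X.tr d g').pre V), (X.tr d h).pre_mono ((X.tr d g').pre_mono k'),
      hV, ?_⟩
    rw [theta_res, theta_res, theta_res] at e
    refine e.trans ?_
    refine Eq.trans ?_ (Cover.res_smul _ _ _).symm
    refine congrArg₂ (fun (r : (X.coverYY d).O ((X.tr d h).pre ((X.tr d g').pre V))) x => r • x)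
      rfl ?_
    exact (mres_mres _ _ _ _).trans (mres_mres _ _ _ _).symm
  · intro W _
    rw [map_zero, map_zero, map_zero, mres_zero, smul_zero]
  · intro W _ t t' ht ht'
    rw [map_add, map_add, map_add, mres_add, smul_add, ht, ht']
  · intro W _ b n
    rw [theta_ltmul, theta_ltmul, theta_ltmul, hβ, res_ltmul, ltmul_smul]
    refine congrArg _ (congrArg (fun x => ltmul x _) (Subtype.ext ?_))
    exact X.shift_shift d hk (s := s' * g') (by rw [← h₁]; exact b.2)

theorem theta_one {s : d.Kh} {F F' : (X.coverYY d).space.Mod}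
    {e : (X.coverYY d).I → (X.coverYY d).P → ℂ}
    (h₁ : e = X.eQ d * X.eYY d (s * 1)) (h₁' : e = X.eQ d * X.eYY d s)
    {β : F ⟶ (X.tr d 1).toRHom.push.obj F'} {φ : F ⟶ F'}
    (hβ : ∀ (W : Opens (X.coverYY d).base) (n : MSec F W), papp β W n =
      mres F' (X.tr_one_pre d W).le (mapp φ W n))
    {W : Opens (X.coverYY d).base} (t : MSec (lineTensor e F) W) :
    papp (X.theta d 1 s h₁ h₁' β) W t = mres (lineTensor e F') (X.tr_one_pre d W).le
      (mapp (lineTensorMap e φ) W t) := by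
  refine line_induction (P := fun W _ t =>
    papp (X.theta d 1 s h₁ h₁' β) W t = mres (lineTensor e F') (X.tr_one_pre d W).le
      (mapp (lineTensorMap e φ) W t)) ?_ ?_ ?_ ?_ t
  · intro W _ t ht
    refine eq_of_local_pre (X.tr d 1) _ fun y hy => ?_
    obtain ⟨V, k', hV, e⟩ := ht _ hy
    refine ⟨V, k', hV, ?_⟩
    rw [theta_res, mapp_mres] at e
    exact e.trans ((mres_mres _ _ _ _).trans (mres_mres _ _ _ _).symm)
  · intro W _
    rw [map_zero, map_zero, mres_zero]
  · intro W _ t t' ht ht'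
    rw [map_add, map_add, mres_add, ht, ht']
  · intro W _ b n
    rw [theta_ltmul, map_ltmul, hβ, res_ltmul]
    refine congrArg (fun x => ltmul x _) (Subtype.ext ?_)
    exact X.shift_one d (s := s) (by rw [← h₁']; exact b.2)

/-- The pull-back along the translation by `(1, k⁻¹)` of a section of the pull-back of `L l`. -/
def trLine (k : d.Kh) {l : d.Kh} {W : Opens (X.coverYY d).base}
    (u : (X.coverYY d).Line (X.eYY d l) W) : (X.coverYY d).Line (X.eYY d l) ((X.tr d k).pre W) :=
  ⟨(X.tr d k).onUp W u.1, X.tr_compat d k l W u.1 u.2⟩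

theorem theta_tmulLine {l s₁ : d.Kh} {e₁ e₁' : (X.coverYY d).I → (X.coverYY d).P → ℂ}
    (h₁ : e₁ = X.eQ d * X.eYY d (s₁ * k)) (h₁' : e₁' = X.eQ d * X.eYY d s₁)
    (hl : e * X.eYY d l = e₁) (hl' : e' * X.eYY d l = e₁')
    {W : Opens (X.coverYY d).base} (t : MSec (lineTensor e F) W)
    (u : (X.coverYY d).Line (X.eYY d l) W) :
    papp (X.theta d k s₁ h₁ h₁' β) W (tmulLine hl t u) =
      tmulLine hl' (papp (X.theta d k s he he' β) W t) (X.trLine d k u) := by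
  refine line_induction (P := fun W hW t =>
    papp (X.theta d k s₁ h₁ h₁' β) W (tmulLine hl t (resLine hW u)) =
      tmulLine hl' (papp (X.theta d k s he he' β) W t) (X.trLine d k (resLine hW u)))
    ?_ ?_ ?_ ?_ t
  · intro W hW t ht
    refine eq_of_local_pre (X.tr d k) _ fun y hy => ?_
    obtain ⟨V, k', hV, e⟩ := ht _ hy
    refine ⟨V, k', hV, ?_⟩
    rw [res_tmulLine, ← theta_res, ← theta_res, res_tmulLine]
    exact e
  · intro W hW
    have h0 : ∀ {e e' e''} (he : e * e' = e'') {F : (X.coverYY d).space.Mod} {W}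
        (u : (X.coverYY d).Line e' W), tmulLine he (0 : MSec (lineTensor e F) W) u = 0 :=
      fun he F W u => map_zero (tmulLineHom he u)
    rw [h0, map_zero, map_zero, h0]
  · intro W hW t t' ht ht'
    rw [add_tmulLine, map_add, map_add, add_tmulLine, ht, ht']
  · intro W hW b n
    rw [ltmul_tmulLine, theta_ltmul, theta_ltmul, ltmul_tmulLine]
    refine congrArg (fun x => ltmul x _) (Subtype.ext ?_)
    exact (congrArg (fun x => X.monoInv d k _ * x) (map_mul ((X.tr d k).onUp W) _ _)).trans
      (mul_assoc _ _ _).symm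

theorem theta_naturality {F₁ F₁' : (X.coverYY d).space.Mod}
    {β₁ : F₁ ⟶ (X.tr d k).toRHom.push.obj F₁'} {φ : F ⟶ F₁} {φ' : F' ⟶ F₁'}
    (hφ : φ ≫ β₁ = β ≫ (X.tr d k).toRHom.push.map φ')
    {W : Opens (X.coverYY d).base} (t : MSec (lineTensor e F) W) :
    papp (X.theta d k s he he' β₁) W (mapp (lineTensorMap e φ) W t) =
      mapp (lineTensorMap e' φ') _ (papp (X.theta d k s he he' β) W t) := by
  refine line_induction (P := fun W hW t =>
    papp (X.theta d k s he he' β₁) W (mapp (lineTensorMap e φ) W t) =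
      mapp (lineTensorMap e' φ') _ (papp (X.theta d k s he he' β) W t)) ?_ ?_ ?_ ?_ t
  · intro W hW t ht
    refine eq_of_local_pre (X.tr d k) _ fun y hy => ?_
    obtain ⟨V, k', hV, e⟩ := ht _ hy
    refine ⟨V, k', hV, ?_⟩
    rw [← mapp_mres, ← theta_res, ← theta_res, ← mapp_mres]
    exact e
  · intro W hW
    rw [map_zero, map_zero, map_zero, map_zero]
  · intro W hW t t' ht ht'
    rw [map_add, map_add, map_add, map_add, ht, ht']
  · intro W hW b n
    rw [map_ltmul, theta_ltmul, theta_ltmul, map_ltmul]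
    refine congrArg (ltmul _) ?_
    exact congrArg (fun f => RSpace.Mod.app (X := (X.coverYY d).space) f W n) hφ

end theta

end Torus

/-! ### The equivariant structure of the Fourier–Mukai functor -/

namespace Torus

open Cover CoverHom

variable {g : ℕ} (X : Torus g) (d : DefParam g)

/-- The pull-back to `Y × Ŷ` of a section of `L k`. -/
def pLine {k : d.Kh} {V : Opens (X.coverY d).base} (u : (X.coverY d).Line (X.eY d k) V) :
    (X.coverYY d).Line (X.eYY d k) ((X.p d).pre V) :=
  ⟨(X.p d).onUp V u.1, X.p_compat d k V u.1 u.2⟩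

theorem pLine_smul {k : d.Kh} {V : Opens (X.coverY d).base} (r : (X.coverY d).O V)
    (u : (X.coverY d).Line (X.eY d k) V) :
    X.pLine d (r • u) = (X.p d).onO V r • X.pLine d u := rfl

theorem eQ_mul_one : X.eQ d = X.eQ d * X.eYY d 1 := by rw [map_one, mul_one]

theorem eQ_one_mul (k : d.Kh) : X.eQ d * X.eYY d k = X.eQ d * X.eYY d (1 * k) := by rw [one_mul]

section aSec

variable {k : d.Kh} {F F' : (X.coverYY d).space.Mod} (β : F ⟶ (X.tr d k).toRHom.push.obj F')

/-- The section `u(x) t(x)⁻¹ ψ(x, χ t⁻¹) ⊗ β n` of the direct image of `Q ⊗ F'` to `Y`, for the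
section `ψ ⊗ n` of the direct image of `Q ⊗ F`. -/
def aSec {V : Opens (X.coverY d).base} (s : MSec (lineTensor (X.eQ d) F) ((X.p d).pre V))
    (u : (X.coverY d).Line (X.eY d k) V) : MSec (lineTensor (X.eQ d) F') ((X.p d).pre V) :=
  papp (X.theta d k 1 (X.eQ_one_mul d k) (X.eQ_mul_one d) β) ((X.p d).pre V)
    (tmulLine rfl s (X.pLine d u))

variable {V : Opens (X.coverY d).base}

theorem aSec_add (s s' : MSec (lineTensor (X.eQ d) F) ((X.p d).pre V))
    (u : (X.coverY d).Line (X.eY d k) V) :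
    X.aSec d β (s + s') u = X.aSec d β s u + X.aSec d β s' u := by
  rw [aSec, add_tmulLine]
  exact map_add _ _ _

theorem aSec_add' (s : MSec (lineTensor (X.eQ d) F) ((X.p d).pre V))
    (u u' : (X.coverY d).Line (X.eY d k) V) :
    X.aSec d β s (u + u') = X.aSec d β s u + X.aSec d β s u' := by
  rw [aSec, show X.pLine d (u + u') = X.pLine d u + X.pLine d u' from rfl, tmulLine_add]
  exact map_add _ _ _

theorem aSec_smul (r : (X.coverY d).O V) (s : MSec (lineTensor (X.eQ d) F) ((X.p d).pre V))
    (u : (X.coverY d).Line (X.eY d k) V) :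
    X.aSec d β ((X.p d).onO V r • s) u = (X.p d).onO V r • X.aSec d β s u := by
  rw [aSec, smul_tmulLine]
  exact papp_smul _ _ _

theorem aSec_smul' (r : (X.coverY d).O V) (s : MSec (lineTensor (X.eQ d) F) ((X.p d).pre V))
    (u : (X.coverY d).Line (X.eY d k) V) :
    X.aSec d β s (r • u) = (X.p d).onO V r • X.aSec d β s u := by
  rw [aSec, pLine_smul, tmulLine_smul]
  exact papp_smul _ _ _

theorem aSec_res {V' : Opens (X.coverY d).base} (h : V' ≤ V)
    (s : MSec (lineTensor (X.eQ d) F) ((X.p d).pre V)) (u : (X.coverY d).Line (X.eY d k) V) :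
    X.aSec d β (mres _ ((X.p d).pre_mono h) s) (resLine h u) =
      mres (lineTensor (X.eQ d) F') ((X.p d).pre_mono h) (X.aSec d β s u) := by
  refine (congrArg (papp (X.theta d k 1 (X.eQ_one_mul d k) (X.eQ_mul_one d) β) ((X.p d).pre V'))
    (res_tmulLine rfl ((X.p d).pre_mono h) s (X.pLine d u)).symm).trans ?_
  exact X.theta_res d _ _ β _ _

theorem aSec_naturality {F₁ F₁' : (X.coverYY d).space.Mod}
    {β₁ : F₁ ⟶ (X.tr d k).toRHom.push.obj F₁'} {φ : F ⟶ F₁} {φ' : F' ⟶ F₁'}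
    (hφ : φ ≫ β₁ = β ≫ (X.tr d k).toRHom.push.map φ')
    (s : MSec (lineTensor (X.eQ d) F) ((X.p d).pre V)) (u : (X.coverY d).Line (X.eY d k) V) :
    X.aSec d β₁ (mapp (lineTensorMap (X.eQ d) φ) _ s) u =
      mapp (lineTensorMap (X.eQ d) φ') _ (X.aSec d β s u) := by
  rw [aSec, ← map_tmulLine]
  exact X.theta_naturality d _ _ β hφ _

theorem aSec_aSec {g' h k : d.Kh} (hk : g' * h = k) {F F' F'' : (X.coverYY d).space.Mod}
    {β₁ : F ⟶ (X.tr d g').toRHom.push.obj F'} {β₂ : F' ⟶ (X.tr d h).toRHom.push.obj F''}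
    {β₃ : F ⟶ (X.tr d k).toRHom.push.obj F''} (c : ℂ)
    (hβ : ∀ (W : Opens (X.coverYY d).base) (n : MSec F W), papp β₂ _ (papp β₁ W n) =
      algebraMap ℂ ((X.coverYY d).O ((X.tr d h).pre ((X.tr d g').pre W))) c •
        mres F'' (X.tr_pre_tr_pre d hk W).le (papp β₃ W n))
    (s : MSec (lineTensor (X.eQ d) F) ((X.p d).pre V)) (u : (X.coverY d).Line (X.eY d g') V)
    (v : (X.coverY d).Line (X.eY d h) V) (he : X.eY d g' * X.eY d h = X.eY d k) :
    X.aSec d β₂ (X.aSec d β₁ s u) v = algebraMap ℂ ((X.coverYY d).O ((X.p d).pre V)) c •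
      X.aSec d β₃ s (mulLine he u v) := by
  have hm : X.eYY d g' * X.eYY d h = X.eYY d k := by rw [← map_mul, hk]
  have h1 := X.theta_tmulLine d (k := g') (s := 1) (X.eQ_one_mul d g') (X.eQ_mul_one d) β₁ (l := h)
    (s₁ := h) (e₁ := X.eQ d * X.eYY d k) (e₁' := X.eQ d * X.eYY d h) (by rw [mul_comm h, hk]) rfl
    (by rw [mul_assoc, hm]) rfl (tmulLine rfl s (X.pLine d u)) (X.pLine d v)
  have h2 := X.theta_theta d hk (s := 1) (s' := h) (e := X.eQ d * X.eYY d k)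
    (e' := X.eQ d * X.eYY d h) (e'' := X.eQ d) (by rw [mul_comm h, hk]) rfl (X.eQ_one_mul d h)
    (X.eQ_mul_one d) (X.eQ_one_mul d k) c hβ
    (tmulLine (by rw [mul_assoc, hm]) (tmulLine rfl s (X.pLine d u)) (X.pLine d v))
  have h3 := tmulLine_tmulLine (C := X.coverYY d) (e := X.eQ d) (e' := X.eYY d g')
    (e'' := X.eYY d h) rfl (d' := X.eQ d * X.eYY d k) (by rw [mul_assoc, hm]) hm rfl s
    (X.pLine d u) (X.pLine d v)
  refine (congrArg (papp (X.theta d h 1 (X.eQ_one_mul d h) (X.eQ_mul_one d) β₂) _) h1.symm).trans ?_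
  refine h2.trans ?_
  rw [h3]
  exact congrArg (fun x : MSec (lineTensor (X.eQ d) F'') ((X.p d).pre V) =>
    algebraMap ℂ ((X.coverYY d).O ((X.p d).pre V)) c • x) (mres_self _ _)

end aSec

/-- The family of the maps `aSec`, as a morphism of sheaves. -/
def aHom (k : d.Kh) {F F' : (X.coverYY d).space.Mod} (β : F ⟶ (X.tr d k).toRHom.push.obj F') :
    (X.p d).toRHom.push.obj (lineTensor (X.eQ d) F) ⟶
      homMod (X.eY d k) ((X.p d).toRHom.push.obj (lineTensor (X.eQ d) F')) :=
  RSpace.Mod.mkHom (X := (X.coverY d).space) _ _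
    (fun U => AddMonoidHom.mk' (fun s => mkSec
      { ev := fun V h u => X.aSec d β (mres (lineTensor (X.eQ d) F) ((X.p d).pre_mono h) s) u
        map_add := fun V h u v => X.aSec_add' d β _ u v
        map_smul := fun V h r u => X.aSec_smul' d β r _ u
        nat := fun {V V'} h k u => by
          refine Eq.trans ?_ (X.aSec_res d β k _ u)
          exact congrArg (fun x => X.aSec d β x _) (mres_mres (lineTensor (X.eQ d) F)
            ((X.p d).pre_mono k) ((X.p d).pre_mono h) s).symm })
      (fun s s' => hom_sec_ext fun V h u => by
        refine (congrArg (fun x => X.aSec d β x u) (mres_add (lineTensor (X.eQ d) F)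
          ((X.p d).pre_mono h) s s')).trans ?_
        exact X.aSec_add d β _ _ u))
    (fun U r s => hom_sec_ext fun V h u => by
      refine (congrArg (fun x => X.aSec d β x u) (Cover.res_smul
        ((X.p d).pre_mono h) ((X.p d).onO U r) (show MSec (lineTensor (X.eQ d) F) _ from s))).trans
          ?_
      exact X.aSec_smul d β (resO h r) _ u)
    (fun {U U'} h s => hom_sec_ext fun V k u => congrArg (fun x => X.aSec d β x u)
      (mres_mres (lineTensor (X.eQ d) F) ((X.p d).pre_mono k) ((X.p d).pre_mono h) s))

end Torus

namespace Torus

open Cover CoverHom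

variable {g : ℕ} (X : Torus g) (d : DefParam g)

/-- The canonical morphisms `FM(R_k^* M) → Hom(L k, FM(M))`. -/
def aNat (k : d.Kh) : (X.actYh d).act k ⋙ X.FMQ d ⟶ X.FMQ d ⋙ (X.actY d).act k where
  app M := X.aHom d k (X.bc d k M)
  naturality M M' f := RSpace.Mod.hom_ext (X := (X.coverY d).space) fun U s =>
    hom_sec_ext fun V h u => by
      have h1 := X.aSec_naturality d (X.bc d k M) (X.bc_naturality d k f)
        (mres (lineTensor (X.eQ d) _) ((X.p d).pre_mono h)
          (show MSec (lineTensor (X.eQ d) _) ((X.p d).pre U) from s)) u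
      refine Eq.trans ?_ h1
      exact congrArg (fun x => X.aSec d (X.bc d k M') x u)
        (mapp_mres (lineTensorMap (X.eQ d) _) ((X.p d).pre_mono h)
          (show MSec (lineTensor (X.eQ d) _) ((X.p d).pre U) from s)).symm

theorem aNat_comp {g' h k : d.Kh} (hk : g' * h = k) (M : (X.coverYh d).space.Mod) :
    (X.aNat d g').app (((X.actYh d).act h).obj M) ≫
      ((X.actY d).act g').map ((X.aNat d h).app M) =
    (X.FMQ d).map (((X.actYh d).c hk).hom.app M) ≫ (X.aNat d k).app M ≫
      split (C := X.coverY d) (e := X.eY d g') (e' := X.eY d h) (e'' := X.eY d k)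
        (by rw [← map_mul, hk]) ((X.FMQ d).obj M) := by
  refine RSpace.Mod.hom_ext (X := (X.coverY d).space) fun U s => hom_sec_ext fun V h₁ u =>
    hom_sec_ext fun V' h₂ v => ?_
  have he : X.eY d g' * X.eY d h = X.eY d k := by rw [← map_mul, hk]
  let s₁ : MSec (lineTensor (X.eQ d) ((X.q d).toRHom.pull.obj
    ((X.tau d g').toRHom.push.obj ((X.tau d h).toRHom.push.obj M)))) ((X.p d).pre U) := s
  have h3 : X.aSec d (X.bc d h M) (mres _ ((X.p d).pre_mono h₂)
      (X.aSec d (X.bc d g' ((X.tau d h).toRHom.push.obj M))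
        (mres _ ((X.p d).pre_mono h₁) s₁) u)) v =
      X.aSec d (X.bc d k M) (mapp (lineTensorMap (X.eQ d) ((X.q d).toRHom.pull.map (X.cYh d hk M)))
        _ (mres _ ((X.p d).pre_mono (h₂.trans h₁)) s₁)) (mulLine he (resLine h₂ u) v) := by
    rw [← aSec_res, mres_mres]
    have h4 := X.aSec_aSec d hk (β₁ := X.bc d g' ((X.tau d h).toRHom.push.obj M))
      (β₂ := X.bc d h M) (β₃ := (X.q d).toRHom.pull.map (X.cYh d hk M) ≫ X.bc d k M) 1
      (fun W n => by
        rw [map_one, one_smul]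
        exact X.bc_bc d hk M n) (mres _ ((X.p d).pre_mono (h₂.trans h₁)) s₁) (resLine h₂ u) v he
    rw [map_one, one_smul] at h4
    refine h4.trans ?_
    have h5 := X.aSec_naturality d ((X.q d).toRHom.pull.map (X.cYh d hk M) ≫ X.bc d k M)
      (β₁ := X.bc d k M) (φ := (X.q d).toRHom.pull.map (X.cYh d hk M)) (φ' := 𝟙 _)
      (by rw [CategoryTheory.Functor.map_id, Category.comp_id])
      (mres _ ((X.p d).pre_mono (h₂.trans h₁)) s₁) (mulLine he (resLine h₂ u) v)
    refine Eq.trans ?_ h5.symm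
    have h6 : lineTensorMap (X.eQ d) (𝟙 ((X.q d).toRHom.pull.obj M)) = 𝟙 _ :=
      ((X.coverYY d).lineBi (X.eQ d)).tensor.map_id _
    rw [h6]
    rfl
  refine h3.trans ?_
  exact congrArg (fun x => X.aSec d (X.bc d k M) x (mulLine he (resLine h₂ u) v))
    (mapp_mres (lineTensorMap (X.eQ d) ((X.q d).toRHom.pull.map (X.cYh d hk M)))
      ((X.p d).pre_mono (h₂.trans h₁)) s₁)

theorem pentagon {g' h k : d.Kh} (hk : g' * h = k) (M : (X.coverYh d).space.Mod) :
    (X.aNat d g').app (((X.actYh d).act h).obj M) ≫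
      ((X.actY d).act g').map ((X.aNat d h).app M) ≫
        ((X.actY d).c hk).hom.app ((X.FMQ d).obj M) =
    (X.FMQ d).map (((X.actYh d).c hk).hom.app M) ≫ (X.aNat d k).app M := by
  have h1 := X.aNat_comp d hk M
  have h2 : split (C := X.coverY d) (e := X.eY d g') (e' := X.eY d h) (e'' := X.eY d k)
        (by rw [← map_mul, hk]) ((X.FMQ d).obj M) ≫
          ((X.actY d).c hk).hom.app ((X.FMQ d).obj M) = 𝟙 _ :=
    ((X.actY d).c hk).inv_hom_id_app ((X.FMQ d).obj M)
  refine (Category.assoc _ _ _).symm.trans ?_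
  refine (congrArg (fun F => F ≫ ((X.actY d).c hk).hom.app ((X.FMQ d).obj M)) h1).trans ?_
  refine (Category.assoc _ _ _).trans ?_
  refine congrArg (fun F => (X.FMQ d).map (((X.actYh d).c hk).hom.app M) ≫ F) ?_
  refine (Category.assoc _ _ _).trans ?_
  refine (congrArg (fun F => (X.aNat d k).app M ≫ F) h2).trans ?_
  exact Category.comp_id _

theorem FMQ_map_smul {M M' : (X.coverYh d).space.Mod} (z : ℂ) (f : M ⟶ M') :
    (X.FMQ d).map (z • f) = z • (X.FMQ d).map f := by
  have h1 := (X.q d).pull_map_smul z f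
  have h2 : lineTensorMap (X.eQ d) ((X.q d).toRHom.pull.map (z • f)) =
      z • lineTensorMap (X.eQ d) ((X.q d).toRHom.pull.map f) := by
    rw [h1]
    refine BiPresheaf.tensor_hom_ext _ fun W b n => ?_
    refine (map_ltmul (z • (X.q d).toRHom.pull.map f) b n).trans ?_
    refine Eq.trans ?_ (congrArg (fun x => algebraMap ℂ ((X.coverYY d).O W) z • x)
      (map_ltmul ((X.q d).toRHom.pull.map f) b n)).symm
    exact ltmul_smul _ _ _
  exact congrArg (X.p d).toRHom.push.map h2

end Torus

namespace Cover

theorem tmulLine_one {C : Cover} {e e' : C.I → C.P → ℂ} {F : C.space.Mod} (he : e * e' = e)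
    {W : Opens C.base} (s : MSec (lineTensor e F) W) (u : C.Line e' W) (hu : u.1 = 1) :
    tmulLine he s u = s := by
  refine line_induction (P := fun V hV s => tmulLine he s (resLine hV u) = s) ?_ ?_ ?_ ?_ s
  · intro W hW s hs
    refine eq_of_local _ fun y hy => ?_
    obtain ⟨V, h, hV, hP⟩ := hs y hy
    exact ⟨V, h, hV, (res_tmulLine he h s _).trans hP⟩
  · intro W hW
    exact map_zero (tmulLineHom he _)
  · intro W hW s t h h'
    rw [add_tmulLine, h, h']
  · intro W hW b n
    rw [ltmul_tmulLine]
    refine congrArg (fun x => ltmul x n) (Subtype.ext ?_)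
    change b.1 * resUp hW u.1 = b.1
    rw [hu, map_one, mul_one]

end Cover

namespace Torus

open Cover CoverHom

variable {g : ℕ} (X : Torus g) (d : DefParam g)

/-- The constant section `1` of the trivial line bundle `L 1`. -/
def oneLine (V : Opens (X.coverY d).base) : (X.coverY d).Line (X.eY d 1) V :=
  ⟨1, fun i z z' _ => by
    change (1 : ℂ) = X.eY d 1 i z * 1
    rw [map_one]
    exact (mul_one 1).symm⟩

theorem exists_smul_oneLine {V : Opens (X.coverY d).base} (u : (X.coverY d).Line (X.eY d 1) V) :
    ∃ a : (X.coverY d).O V, u = a • X.oneLine d V := by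
  obtain ⟨a, ha⟩ := (X.exact_coverY d).descend (W := V) ⟨u.1, by rw [← map_one (X.eY d)]; exact u.2⟩
  refine ⟨a, Subtype.ext (Subtype.ext (funext fun z => (ha z).trans ?_))⟩
  change _ = a.1 _ * 1
  rw [mul_one]

theorem aSec_one {F F' : (X.coverYY d).space.Mod} (β : F ⟶ (X.tr d 1).toRHom.push.obj F')
    {V : Opens (X.coverY d).base} (s : MSec (lineTensor (X.eQ d) F) ((X.p d).pre V)) :
    X.aSec d β s (X.oneLine d V) = papp (X.theta d 1 1
      (by rw [one_mul]; exact X.eQ_mul_one d) (X.eQ_mul_one d) β) ((X.p d).pre V) s := by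
  refine (X.theta_tmulLine d (by rw [one_mul]; exact X.eQ_mul_one d) (X.eQ_mul_one d) β
    (X.eQ_one_mul d 1) (X.eQ_mul_one d) rfl (X.eQ_mul_one d).symm s _).trans ?_
  exact tmulLine_one _ _ _ rfl

/-- The isomorphism `Q ⊗ q^* R_1^* M ≅ Q ⊗ q^* M`. -/
def lineTensorOne (M : (X.coverYh d).space.Mod) :
    lineTensor (X.eQ d) ((X.q d).toRHom.pull.obj ((X.tau d 1).toRHom.push.obj M)) ≅
      lineTensor (X.eQ d) ((X.q d).toRHom.pull.obj M) :=
  ((X.coverYY d).lineBi (X.eQ d)).tensor.mapIso ((X.q d).toRHom.pull.mapIso (X.tauOne d M))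

theorem aSec_bc_one (M : (X.coverYh d).space.Mod) {V : Opens (X.coverY d).base}
    (s : MSec (lineTensor (X.eQ d) ((X.q d).toRHom.pull.obj ((X.tau d 1).toRHom.push.obj M)))
      ((X.p d).pre V)) :
    X.aSec d (X.bc d 1 M) s (X.oneLine d V) = mapp (X.lineTensorOne d M).hom _ s := by
  rw [aSec_one]
  refine (X.theta_one d _ (X.eQ_mul_one d) (fun W n => X.bc_one d M n) s).trans ?_
  exact mres_self _ _

theorem aNat_one_bijective (M : (X.coverYh d).space.Mod) (U : Opens (X.coverY d).base) :
    Function.Bijective (mapp ((X.aNat d 1).app M) U) := by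
  have inv : ∀ t, mapp (X.lineTensorOne d M).hom ((X.p d).pre U)
      (mapp (X.lineTensorOne d M).inv ((X.p d).pre U) t) = t := fun t =>
    congrArg (fun f => mapp f ((X.p d).pre U) t) (X.lineTensorOne d M).inv_hom_id
  have inv' : ∀ t, mapp (X.lineTensorOne d M).inv ((X.p d).pre U)
      (mapp (X.lineTensorOne d M).hom ((X.p d).pre U) t) = t := fun t =>
    congrArg (fun f => mapp f ((X.p d).pre U) t) (X.lineTensorOne d M).hom_inv_id
  have val : ∀ s, hev (e := X.eY d 1) (M := (X.FMQ d).obj M) (mapp ((X.aNat d 1).app M) U s)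
      le_rfl (X.oneLine d U) = mapp (X.lineTensorOne d M).hom ((X.p d).pre U) s := fun s =>
    (congrArg (fun x => X.aSec d (X.bc d 1 M) x (X.oneLine d U)) (mres_self _ _)).trans
      (X.aSec_bc_one d M s)
  refine ⟨fun s s' h => ?_, fun f => ?_⟩
  · have h1 := congrArg (fun f => hev (e := X.eY d 1) (M := (X.FMQ d).obj M) f
      le_rfl (X.oneLine d U)) h
    have h2 := (val s).symm.trans (h1.trans (val s'))
    exact (inv' s).symm.trans ((congrArg _ h2).trans (inv' s'))
  · refine ⟨mapp (X.lineTensorOne d M).inv ((X.p d).pre U) (hev (e := X.eY d 1)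
      (M := (X.FMQ d).obj M) f le_rfl (X.oneLine d U)), ?_⟩
    refine hom_sec_ext (e := X.eY d 1) (M := (X.FMQ d).obj M) fun V k u => ?_
    obtain ⟨a, rfl⟩ := X.exists_smul_oneLine d u
    refine (hev_map_smul (e := X.eY d 1) (M := (X.FMQ d).obj M) _ k a _).trans (Eq.trans ?_
      (hev_map_smul (e := X.eY d 1) (M := (X.FMQ d).obj M) f k a _).symm)
    refine congrArg (fun x => a • x) ?_
    refine (hev_nat (e := X.eY d 1) (M := (X.FMQ d).obj M) _ le_rfl k (X.oneLine d U)).trans ?_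
    refine Eq.trans ?_ (hev_nat (e := X.eY d 1) (M := (X.FMQ d).obj M) f le_rfl k
      (X.oneLine d U)).symm
    exact congrArg (mres ((X.FMQ d).obj M) k) ((val _).trans (inv _))

theorem isIso_aNat_one (M : (X.coverYh d).space.Mod) : IsIso ((X.aNat d 1).app M) :=
  (RSpace.Mod.isoOfBij (X := (X.coverY d).space) ((X.aNat d 1).app M)
    (X.aNat_one_bijective d M)).isIso_hom

/-- The compatibility with compositions for `k`, `k⁻¹` exhibits the canonical morphism as both a
split monomorphism and a split epimorphism. -/
theorem isIso_aNat (k : d.Kh) (M : (X.coverYh d).space.Mod) : IsIso ((X.aNat d k).app M) := by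
  have := X.isIso_aNat_one d
  have := (X.actYh d).isEquivalence
  have := (X.actY d).isEquivalence
  have key : ∀ {g' h : d.Kh}, g' * h = 1 → ∀ M, Mono ((X.aNat d g').app M) ∧
      IsSplitEpi ((X.aNat d h).app M) := by
    intro g' h hk M
    have iso : ∀ M, IsIso ((X.aNat d g').app (((X.actYh d).act h).obj M) ≫
        ((X.actY d).act g').map ((X.aNat d h).app M) ≫
          ((X.actY d).c hk).hom.app ((X.FMQ d).obj M)) := fun M => by
      rw [X.pentagon d hk M]
      infer_instance
    constructor
    · have : ∀ M, Mono ((X.aNat d g').app (((X.actYh d).act h).obj M)) := fun M => by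
        have := iso M
        exact mono_of_mono _ (((X.actY d).act g').map ((X.aNat d h).app M) ≫
          ((X.actY d).c hk).hom.app ((X.FMQ d).obj M))
      let i := ((X.actYh d).act h).objObjPreimageIso M
      have h1 := (X.aNat d g').naturality i.inv
      have h2 : (X.aNat d g').app M = (((X.actYh d).act g') ⋙ X.FMQ d).map i.inv ≫
          (X.aNat d g').app _ ≫ (X.FMQ d ⋙ (X.actY d).act g').map i.hom := by
        rw [← Category.assoc, h1, Category.assoc, ← Functor.map_comp, i.inv_hom_id,
          CategoryTheory.Functor.map_id, Category.comp_id]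
      rw [h2]
      infer_instance
    · have : IsSplitEpi (((X.actY d).act g').map ((X.aNat d h).app M)) := by
        have := iso M
        refine IsSplitEpi.mk' ⟨((X.actY d).c hk).hom.app ((X.FMQ d).obj M) ≫
          inv ((X.aNat d g').app (((X.actYh d).act h).obj M) ≫
            ((X.actY d).act g').map ((X.aNat d h).app M) ≫
              ((X.actY d).c hk).hom.app ((X.FMQ d).obj M)) ≫
          (X.aNat d g').app (((X.actYh d).act h).obj M), ?_⟩
        rw [← cancel_mono (((X.actY d).c hk).hom.app ((X.FMQ d).obj M))]
        simp only [Category.assoc, Category.id_comp]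
        rw [IsIso.inv_hom_id]
        exact Category.comp_id _
      exact (((X.actY d).act g').isSplitEpi_iff _).1 this
  have := (key (mul_inv_cancel k) M).1
  have := (key (inv_mul_cancel k) M).2
  exact isIso_of_mono_of_isSplitEpi _

/-- The canonical equivariant structure of the Fourier–Mukai functor. -/
def equivariantStructure : EquivariantStructure (X.actYh d) (X.actY d) (X.FMQ d) where
  a k := have := X.isIso_aNat d k
    NatIso.ofComponents (fun M => asIso ((X.aNat d k).app M)) fun f => (X.aNat d k).naturality f
  pentagon hk M := X.pentagon d hk M
  linear z f := X.FMQ_map_smul d z f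

theorem isCanonical_equivariantStructure : X.IsCanonical (X.equivariantStructure d) := by
  intro k M U s u W hW hW' m ψ n hs
  have h1 : hev (e := X.eY d k) (M := (X.FMQ d).obj M)
      (mapp (((X.equivariantStructure d).a k).hom.app M) U s) le_rfl u =
        X.aSec d (X.bc d k M) s u :=
    congrArg (fun x => X.aSec d (X.bc d k M) x u) (mres_self _ _)
  rw [h1]
  have h2 := X.theta_res d (X.eQ_one_mul d k) (X.eQ_mul_one d) (X.bc d k M) hW
    (tmulLine rfl s (X.pLine d u))
  refine h2.symm.trans ?_
  refine (congrArg _ (res_tmulLine rfl hW s (X.pLine d u))).trans ?_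
  have h3 : tmulLine rfl (mres (lineTensor (X.eQ d) _) hW s) (resLine hW (X.pLine d u)) =
      ∑ i, ltmul (mulLine rfl (ψ i) (resLine hW (X.pLine d u))) (n i) := by
    refine (congrArg (fun x => tmulLine rfl x (resLine hW (X.pLine d u))) hs).trans ?_
    refine (map_sum (tmulLineHom rfl (resLine hW (X.pLine d u))) _ _).trans ?_
    exact Finset.sum_congr rfl fun i _ => ltmul_tmulLine rfl (ψ i) (n i) _
  refine (congrArg _ h3).trans ?_
  refine (map_sum (papp (X.theta d k 1 (X.eQ_one_mul d k) (X.eQ_mul_one d) (X.bc d k M)) W)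
    _ _).trans ?_
  refine Finset.sum_congr rfl fun i _ => (X.theta_ltmul d _ _ _ _ _).trans ?_
  refine congrArg (fun x => ltmul x (papp (X.bc d k M) W (n i))) (Subtype.ext ?_)
  have h4 : X.shift d k (mulLine rfl (ψ i) (resLine hW (X.pLine d u))).1 =
      resUp hW' ((X.p d).onUp U u.1) * X.shift d k (ψ i).1 := by
    refine (congrArg (fun x => X.monoInv d k _ * x) (map_mul ((X.tr d k).onUp W) _ _)).trans ?_
    refine (mul_assoc _ _ _).symm.trans ?_
    exact mul_comm _ _
  exact h4

end Torus

/-! ### Components of the tensor product with the deformed Poincaré bundle -/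

namespace Cover

variable {C : Cover} {G : Type} [CommGroup G] [Fintype G] {l : Bilin G}
  {e : G →* (C.I → C.P → ℂ)} {q q' : C.I → C.P → ℂ} {F F' : C.space.Mod}

/-- The component at `s` of a section of `⨁ k, Q ⊗ L k`. -/
def StarModSec.comp {W : Opens C.base} (b : C.StarModSec l e q W) (s : G) (hq : q' = q * e s) :
    C.Line q' W := ⟨b.1 s, by rw [hq]; exact b.2 s⟩

open Classical in
/-- The section of `⨁ k, Q ⊗ L k` with component `b` at `s`, and all other components zero. -/
def StarModSec.single {W : Opens C.base} (s : G) (hq : q' = q * e s) (b : C.Line q' W) :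
    C.StarModSec l e q W :=
  ⟨fun k => if k = s then b.1 else 0, fun k => by
    change (if k = s then b.1 else 0) ∈ _
    split_ifs with h
    · rw [h, ← hq]
      exact b.2
    · exact Submodule.zero_mem _⟩

theorem StarModSec.single_same {W : Opens C.base} (s : G) (hq : q' = q * e s) (b : C.Line q' W) :
    (StarModSec.single (l := l) s hq b).comp s hq = b := Subtype.ext (if_pos rfl)

theorem StarModSec.single_ne {W : Opens C.base} {q'' : C.I → C.P → ℂ} {s t : G} (hst : t ≠ s)
    (hq : q' = q * e s) (hq' : q'' = q * e t) (b : C.Line q' W) :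
    (StarModSec.single (l := l) s hq b).comp t hq' = 0 := Subtype.ext (if_neg hst)

variable (l e q F) in
/-- The sheaf `(⨁ k, Q ⊗ L k) ⊗ F` of right modules over the twisted algebra `⨁ k, L k`. -/
abbrev starTensor : (C.starSpace l e).Mod := (C.starBi l e q).tensorObj F

/-- The sections of `(⨁ k, Q ⊗ L k) ⊗ F` over `W`. -/
abbrev StSec (l : Bilin G) (e : G →* (C.I → C.P → ℂ)) (q : C.I → C.P → ℂ) (F : C.space.Mod)
    (W : Opens C.base) : Type := RSpace.Mod.Sec (X := C.starSpace l e) (starTensor l e q F) W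

/-- The restriction of sections of `(⨁ k, Q ⊗ L k) ⊗ F`. -/
abbrev stres {V W : Opens C.base} (h : V ≤ W) (m : StSec l e q F W) : StSec l e q F V :=
  RSpace.Mod.res (X := C.starSpace l e) (starTensor l e q F) h m

/-- The section `b ⊗ n` of `(⨁ k, Q ⊗ L k) ⊗ F`. -/
def stmul {W : Opens C.base} (b : C.StarModSec l e q W) (n : MSec F W) : StSec l e q F W :=
  (C.starBi l e q).toTensor F W ((show (C.starBi l e q).sec W from b) ⊗ₜ n)

instance stSecModule (W : Opens C.base) : Module (C.StarOp l e W) (StSec l e q F W) :=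
  inferInstanceAs (Module ((C.starSpace l e).sh.obj.obj (op W))
    (RSpace.Mod.Sec (X := C.starSpace l e) (starTensor l e q F) W))

theorem add_stmul {W : Opens C.base} (b b' : C.StarModSec l e q W) (n : MSec F W) :
    stmul (b + b') n = stmul b n + stmul b' n :=
  (congrArg ((C.starBi l e q).toTensor F W) (TensorProduct.add_tmul _ _ _)).trans
    (map_add ((C.starBi l e q).toTensor F W) _ _)

theorem stmul_add {W : Opens C.base} (b : C.StarModSec l e q W) (n n' : MSec F W) :
    stmul b (n + n') = stmul b n + stmul b n' :=
  (congrArg ((C.starBi l e q).toTensor F W) (TensorProduct.tmul_add _ _ _)).trans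
    (map_add ((C.starBi l e q).toTensor F W) _ _)

theorem smul_stmul {W : Opens C.base} (r : C.O W) (b : C.StarModSec l e q W) (n : MSec F W) :
    stmul (r • b) n = stmul b (r • n) :=
  congrArg ((C.starBi l e q).toTensor F W) (BiPresheaf.smul_tmul' (C.starBi l e q) r b n)

theorem star_smul_stmul {W : Opens C.base} (a : C.StarOp l e W) (b : C.StarModSec l e q W)
    (n : MSec F W) : a • stmul b n =
      stmul (a • b) n :=
  ((C.starBi l e q).toTensor_smul F a (b ⊗ₜ n)).symm

/-- A property of sections of `(⨁ k, Q ⊗ L k) ⊗ F` over the open subsets of `W₀` which is local and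
additive holds if it holds for the sections `b ⊗ n`. -/
theorem star_induction {W₀ : Opens C.base}
    {P : ∀ W : Opens C.base, W ≤ W₀ → StSec l e q F W → Prop}
    (loc : ∀ W hW s, (∀ y ∈ W, ∃ (V : Opens C.base) (h : V ≤ W), y ∈ V ∧
      P V (h.trans hW) (stres h s)) → P W hW s)
    (zero : ∀ W hW, P W hW 0)
    (add : ∀ W hW s t, P W hW s → P W hW t → P W hW (s + t))
    (tmul : ∀ W hW b n, P W hW (stmul b n)) (s : StSec l e q F W₀) : P W₀ le_rfl s := by
  refine (C.starBi l e q).tensor_induction (P := fun W s => ∀ hW : W ≤ W₀, P W hW s)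
    ?_ ?_ ?_ ?_ W₀ s le_rfl
  · intro W s hs hW
    refine loc W hW s fun y hy => ?_
    obtain ⟨V, h, hV, hP⟩ := hs y hy
    exact ⟨V, h, hV, hP _⟩
  · exact fun W hW => zero W hW
  · exact fun W s t h h' hW => add W hW s t (h hW) (h' hW)
  · exact fun W b n hW => tmul W hW b n

/-- The balanced maps `(b, n) ↦ b s ⊗ n`. -/
def prBalanced (F : C.space.Mod) (s : G) (hq : q' = q * e s) :
    (C.starBi l e q).AddBalanced (D' := C.ringData) F (lineTensor q' F) where
  φ W := AddMonoidHom.mk' (fun b => AddMonoidHom.mk'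
      (fun n => ltmul (StarModSec.comp (l := l) b s hq) n) (fun n n' => ltmul_add _ _ _))
    (fun b b' => by
      ext n
      exact add_ltmul (StarModSec.comp (l := l) b s hq) (StarModSec.comp (l := l) b' s hq) n)
  hO W r b n := by
    refine (smul_ltmul r (StarModSec.comp (l := l) b s hq) n).trans ?_
    exact (ltmul_smul r (StarModSec.comp (l := l) b s hq) n).symm
  hn h b n := (res_ltmul h (StarModSec.comp (l := l) b s hq) n).symm

/-- The projection of `(⨁ k, Q ⊗ L k) ⊗ F` to the summand `Q ⊗ L s ⊗ F`, on sections. -/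
def starPr (s : G) (hq : q' = q * e s) (W : Opens C.base) :
    StSec l e q F W →+ MSec (lineTensor q' F) W := (prBalanced F s hq).desc W

theorem starPr_stmul (s : G) (hq : q' = q * e s) {W : Opens C.base} (b : C.StarModSec l e q W)
    (n : MSec F W) : starPr s hq W (stmul b n) = ltmul (b.comp s hq) n :=
  (prBalanced F s hq).desc_toTensor W b n

theorem starPr_res (s : G) (hq : q' = q * e s) {V W : Opens C.base} (h : V ≤ W)
    (m : StSec l e q F W) : starPr s hq V (stres h m) = mres _ h (starPr s hq W m) :=
  (prBalanced F s hq).desc_res h m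

theorem starPr_congr {s t : G} (h : s = t) (hq : q' = q * e s) (hq' : q' = q * e t)
    {W : Opens C.base} (m : StSec l e q F W) : starPr s hq W m = starPr t hq' W m := by
  subst h
  rfl

open Classical in
/-- The balanced maps which send `(b, n)` to `b ⊗ n`, with `b` placed in the summand `Q ⊗ L s`. -/
def incBalanced (l : Bilin G) (F : C.space.Mod) (s : G) (hq : q' = q * e s) :
    (C.lineBi q').AddBalanced (D' := C.starData l e) F (starTensor l e q F) where
  φ W := AddMonoidHom.mk' (fun b => AddMonoidHom.mk'
      (fun n => stmul (StarModSec.single (l := l) s hq b) n) (fun n n' => stmul_add _ _ _))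
    (fun b b' => by
      ext n
      refine Eq.trans (congrArg (fun x => stmul x n) (Subtype.ext (funext fun k => ?_)))
        (add_stmul _ _ _)
      change (if k = s then b.1 + b'.1 else 0) =
        (if k = s then b.1 else 0) + (if k = s then b'.1 else 0)
      split_ifs
      · rfl
      · exact (add_zero _).symm)
  hO W r b n := by
    refine Eq.trans (congrArg (fun x => stmul x n) (Subtype.ext (funext fun k => ?_)))
      (smul_stmul r (StarModSec.single (l := l) s hq b) n)
    change (if k = s then r • b.1 else 0) = r • (if k = s then b.1 else 0)
    split_ifs
    · rfl
    · exact (smul_zero r).symm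
  hn {U V} h b n := by
    refine Eq.trans ?_ ((C.starBi l e q).toTensor_res F h
      ((StarModSec.single (l := l) s hq b : (C.starBi l e q).sec V) ⊗ₜ n))
    refine congrArg (fun x => stmul x (mres F h n)) (Subtype.ext (funext fun k => ?_))
    change (if k = s then resUp h b.1 else 0) = resUp h (if k = s then b.1 else 0)
    split_ifs
    · rfl
    · exact (map_zero (resUp h)).symm

variable (l) in
/-- The inclusion of the summand `Q ⊗ L s ⊗ F`, on sections. -/
def starInc (s : G) (hq : q' = q * e s) (W : Opens C.base) :
    MSec (lineTensor q' F) W →+ StSec l e q F W := (incBalanced l F s hq).desc W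

theorem starInc_ltmul (s : G) (hq : q' = q * e s) {W : Opens C.base} (b : C.Line q' W)
    (n : MSec F W) : starInc l s hq W (ltmul b n) = stmul (StarModSec.single s hq b) n :=
  (incBalanced l F s hq).desc_toTensor W b n

theorem starInc_res (s : G) (hq : q' = q * e s) {V W : Opens C.base} (h : V ≤ W)
    (x : MSec (lineTensor q' F) W) : starInc l s hq V (mres _ h x) = stres h (starInc l s hq W x) :=
  (incBalanced l F s hq).desc_res h x

theorem starPr_starInc (s : G) (hq : q' = q * e s) {W : Opens C.base}
    (x : MSec (lineTensor q' F) W) : starPr s hq W (starInc l s hq W x) = x := by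
  refine line_induction (P := fun W _ x => starPr s hq W (starInc l s hq W x) = x) ?_ ?_ ?_ ?_ x
  · intro W _ x hx
    refine eq_of_local _ fun y hy => ?_
    obtain ⟨V, h, hV, hP⟩ := hx y hy
    exact ⟨V, h, hV, by rw [← starPr_res, ← starInc_res]; exact hP⟩
  · intro W _
    rw [map_zero, map_zero]
  · intro W _ x y hx hy
    rw [map_add, map_add, hx, hy]
  · intro W _ b n
    rw [starInc_ltmul, starPr_stmul, StarModSec.single_same]

theorem zero_ltmul {W : Opens C.base} (n : MSec F W) : ltmul (0 : C.Line q W) n = 0 :=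
  (congrArg ((C.lineBi q).toTensor F W) (TensorProduct.zero_tmul _ _)).trans
    (map_zero ((C.lineBi q).toTensor F W))

theorem starPr_starInc_ne {q'' : C.I → C.P → ℂ} {s t : G} (hst : t ≠ s) (hq : q' = q * e s)
    (hq' : q'' = q * e t) {W : Opens C.base} (x : MSec (lineTensor q' F) W) :
    starPr t hq' W (starInc l s hq W x) = 0 := by
  refine line_induction (P := fun W _ x => starPr t hq' W (starInc l s hq W x) = 0)
    ?_ ?_ ?_ ?_ x
  · intro W _ x hx
    refine eq_of_local _ fun y hy => ?_
    obtain ⟨V, h, hV, hP⟩ := hx y hy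
    exact ⟨V, h, hV, by rw [← starPr_res, ← starInc_res, mres_zero]; exact hP⟩
  · intro W _
    rw [map_zero, map_zero]
  · intro W _ x y hx hy
    rw [map_add, map_add, hx, hy, add_zero]
  · intro W _ b n
    rw [starInc_ltmul, starPr_stmul, StarModSec.single_ne hst, zero_ltmul]

theorem star_eq_of_local {W : Opens C.base} {s t : StSec l e q F W}
    (h : ∀ y ∈ W, ∃ (V : Opens C.base) (k : V ≤ W), y ∈ V ∧ stres k s = stres k t) : s = t := by
  choose V hV hy hP using h
  exact RSpace.Mod.eq_of_res (X := C.starSpace l e) _ (fun y : W => V y.1 y.2)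
    (fun y => hV y.1 y.2) (fun y hy' => Opens.mem_iSup.2 ⟨⟨y, hy'⟩, hy y hy'⟩) _ _
    fun y => hP y.1 y.2

theorem sum_starInc_starPr {W : Opens C.base} (m : StSec l e q F W) :
    ∑ s, starInc l s rfl W (starPr s rfl W m) = m := by
  refine star_induction (P := fun W _ m => ∑ s, starInc l s rfl W (starPr s rfl W m) = m)
    ?_ ?_ ?_ ?_ m
  · intro W _ m hm
    refine star_eq_of_local fun y hy => ?_
    obtain ⟨V, h, hV, hP⟩ := hm y hy
    refine ⟨V, h, hV, Eq.trans ?_ hP⟩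
    refine (map_sum (AddMonoidHom.mk' (fun m : StSec l e q F W => stres h m)
      fun m n => RSpace.Mod.res_add (X := C.starSpace l e) h m n) _ _).trans ?_
    refine Finset.sum_congr rfl fun s _ => ?_
    rw [starPr_res, starInc_res]
    rfl
  · intro W _
    refine Finset.sum_eq_zero fun s _ => ?_
    rw [map_zero, map_zero]
  · intro W _ m m' h h'
    simp only [map_add, Finset.sum_add_distrib]
    rw [h, h']
  · intro W _ b n
    have h1 : ∀ t : Finset G, ∑ s ∈ t, starInc l s rfl W (starPr s rfl W (stmul b n)) =
        stmul (∑ s ∈ t, StarModSec.single s rfl (b.comp s rfl)) n := by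
      intro t
      refine Eq.trans ?_ (map_sum (AddMonoidHom.mk' (fun b : C.StarModSec l e q W => stmul b n)
        fun b b' => add_stmul b b' n) _ _).symm
      refine Finset.sum_congr rfl fun s _ => ?_
      rw [starPr_stmul, starInc_ltmul]
      rfl
    rw [h1]
    refine congrArg (fun x => stmul x n) (Subtype.ext (funext fun k => ?_))
    classical
    have h2 : ∀ t : Finset G, (∑ s ∈ t, StarModSec.single (l := l) s rfl (b.comp s rfl)).1 k =
        ∑ s ∈ t, (if k = s then b.1 s else 0) := by
      intro t
      refine (map_sum (AddMonoidHom.mk' (fun b : C.StarModSec l e q W => b.1 k)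
        fun b b' => rfl) _ _).trans ?_
      refine Finset.sum_congr rfl fun s _ => ?_
      change (@ite _ (k = s) (Classical.propDecidable _) _ _) = _
      split_ifs <;> rfl
    rw [h2]
    exact (Finset.sum_ite_eq Finset.univ k _).trans (if_pos (Finset.mem_univ k))

/-- A section of `(⨁ k, Q ⊗ L k) ⊗ F` is determined by its components. -/
theorem starPr_ext {W : Opens C.base} {m m' : StSec l e q F W}
    (h : ∀ s, starPr s rfl W m = starPr s rfl W m') : m = m' := by
  rw [← sum_starInc_starPr m, ← sum_starInc_starPr m']
  exact Finset.sum_congr rfl fun s _ => congrArg _ (h s)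

variable (l) in
theorem exists_starPr_eq {W : Opens C.base} (x : ∀ s, MSec (lineTensor (q * e s) F) W) :
    ∃ m : StSec l e q F W, ∀ s, starPr s rfl W m = x s := by
  refine ⟨∑ s, starInc l s rfl W (x s), fun s => ?_⟩
  rw [map_sum, Finset.sum_eq_single s]
  · exact starPr_starInc s rfl (x s)
  · exact fun t _ ht => starPr_starInc_ne ht.symm rfl rfl (x t)
  · exact fun h => (h (Finset.mem_univ s)).elim

theorem stres_smul {V W : Opens C.base} (h : V ≤ W) (a : C.StarOp l e W) (m : StSec l e q F W) :
    stres h (a • m) =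
      (show C.StarOp l e V from (C.starData l e).res h a) • stres h m :=
  RSpace.Mod.res_smul (X := C.starSpace l e) h a m

/-- The component at `1` of the product of a section with a section of the twisted algebra. -/
theorem starPr_one_smul (hq : q' = q * e 1) (he : ∀ k, q * e k⁻¹ * e k = q') {W : Opens C.base}
    (a : C.StarOp l e W) (m : StSec l e q F W) :
    starPr 1 hq W (a • m) =
      ∑ k, algebraMap ℂ (C.O W) (l.toFun k⁻¹ k) •
        tmulLine (he k) (starPr k⁻¹ rfl W m) (a.comp k) := by
  refine star_induction (P := fun V hV m =>
    starPr 1 hq V ((show C.StarOp l e V from (C.starData l e).res hV a) • m) =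
      ∑ k, algebraMap ℂ (C.O V) (l.toFun k⁻¹ k) •
        tmulLine (he k) (starPr k⁻¹ rfl V m) (resLine hV (a.comp k))) ?_ ?_ ?_ ?_ m
  · intro V hV m hm
    refine eq_of_local _ fun y hy => ?_
    obtain ⟨V', h, hV', hP⟩ := hm y hy
    refine ⟨V', h, hV', ?_⟩
    rw [← starPr_res, stres_smul]
    refine hP.trans ?_
    refine Eq.trans ?_ (map_sum (AddMonoidHom.mk' (fun x : MSec (lineTensor q' F) V => mres _ h x)
      fun x y => mres_add _ h x y) _ _).symm
    refine Finset.sum_congr rfl fun k _ => ?_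
    rw [starPr_res]
    refine Eq.trans ?_ (Cover.res_smul h (algebraMap ℂ (C.O V) (l.toFun k⁻¹ k)) _).symm
    exact congrArg (fun x => algebraMap ℂ (C.O V') (l.toFun k⁻¹ k) • x)
      (res_tmulLine (he k) h (starPr k⁻¹ rfl V m) (resLine hV (a.comp k))).symm
  · intro V hV
    rw [smul_zero, map_zero]
    refine (Finset.sum_eq_zero fun k _ => ?_).symm
    rw [map_zero]
    refine (congrArg _ (map_zero (tmulLineHom (he k) _))).trans ?_
    exact smul_zero _
  · intro V hV m m' h h'
    rw [smul_add, map_add, h, h', ← Finset.sum_add_distrib]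
    refine Finset.sum_congr rfl fun k _ => ?_
    rw [map_add, add_tmulLine, smul_add]
  · intro V hV b n
    rw [star_smul_stmul, starPr_stmul]
    have h1 : ∀ k, algebraMap ℂ (C.O V) (l.toFun k⁻¹ k) •
        tmulLine (he k) (starPr k⁻¹ rfl V (stmul b n)) (resLine hV (a.comp k)) =
        ltmul (algebraMap ℂ (C.O V) (l.toFun k⁻¹ k) •
          mulLine (he k) (b.comp k⁻¹ rfl) (resLine hV (a.comp k))) n := fun k => by
      rw [starPr_stmul, ltmul_tmulLine, smul_ltmul]
    simp only [h1]
    refine Eq.trans ?_ (map_sum (AddMonoidHom.mk' (fun b : C.Line q' V => ltmul b n)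
      fun b b' => add_ltmul b b' n) _ _)
    refine congrArg (fun x => ltmul x n) (Subtype.ext ?_)
    refine Eq.trans ?_ (map_sum (AddMonoidHom.mk' (fun b : C.Line q' V => b.1)
      fun b b' => rfl) _ _).symm
    change (∑ j : G, (l.toFun j (j⁻¹ * 1) : ℂ) • (b.1 j * resUp hV (a.val (j⁻¹ * 1)))) = _
    rw [← Equiv.sum_comp (Equiv.inv G)]
    refine Finset.sum_congr rfl fun k _ => ?_
    simp only [Equiv.inv_apply, inv_inv, mul_one]
    rfl

variable (l e q) in
/-- Functoriality of `(⨁ k, Q ⊗ L k) ⊗ F` in `F`. -/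
def starTensorMap (f : F ⟶ F') : starTensor l e q F ⟶ starTensor l e q F' :=
  (C.starBi l e q).tensor.map f

/-- The morphism `starTensorMap`, on sections. -/
abbrev stapp (f : F ⟶ F') (W : Opens C.base) : StSec l e q F W →+ StSec l e q F' W :=
  RSpace.Mod.app (X := C.starSpace l e) (starTensorMap l e q f) W

theorem starPr_map (s : G) (hq : q' = q * e s) (f : F ⟶ F') {W : Opens C.base}
    (m : StSec l e q F W) :
    starPr s hq W (stapp f W m) =
      mapp (lineTensorMap q' f) W (starPr s hq W m) := by
  refine star_induction (P := fun W _ m =>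
    starPr s hq W (stapp f W m) = mapp (lineTensorMap q' f) W (starPr s hq W m))
    ?_ ?_ ?_ ?_ m
  · intro W _ m hm
    refine eq_of_local _ fun y hy => ?_
    obtain ⟨V, h, hV, hP⟩ := hm y hy
    refine ⟨V, h, hV, ?_⟩
    rw [← starPr_res, ← mapp_mres, ← starPr_res]
    refine Eq.trans (congrArg _ ?_) hP
    exact (RSpace.Mod.app_res (X := C.starSpace l e) (starTensorMap l e q f) h m).symm
  · intro W _
    rw [map_zero, map_zero, map_zero, map_zero]
  · intro W _ m m' h h'
    rw [map_add, map_add, map_add, map_add, h, h']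
  · intro W _ b n
    have h1 : stapp f W (stmul b n) =
        stmul b (mapp f W n) :=
      BiPresheaf.Balanced.desc_toTensor (C.starBi l e q) ((C.starBi l e q).mapBalanced f) W
        (b ⊗ₜ n)
    rw [h1, starPr_stmul, starPr_stmul, map_ltmul]

end Cover

/-! ### Invariant sections of the deformed kernel -/

namespace Torus

open Cover CoverHom

variable {g : ℕ} (X : Torus g) (d : DefParam g) {lam : Bilin d.Kh} (E : X.ModXhLam d lam)

/-- The linearizations of the pull-back to `Y × Ŷ` of a twisted equivariant sheaf compose up to the
values of `λ`. -/
theorem rhoPull_rhoPull {g' h k : d.Kh} (hk : g' * h = k) (W : Opens (X.coverYY d).base)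
    (n : MSec (X.pullObj d E) W) :
    papp (X.rhoPull d E h) _ (papp (X.rhoPull d E g') W n) =
      algebraMap ℂ ((X.coverYY d).O ((X.tr d h).pre ((X.tr d g').pre W))) (lam.toFun g' h) •
        mres (X.pullObj d E) (X.tr_pre_tr_pre d hk W).le (papp (X.rhoPull d E k) W n) := by
  let ρ : ∀ k, E.obj ⟶ (X.tau d k).toRHom.push.obj E.obj := fun k => (E.rho k).hom
  let n₁ := mapp ((X.q d).toRHom.pull.map (ρ g')) W n
  have h1 := congrArg (fun f => RSpace.Mod.app (X := (X.coverYY d).space) f W n₁)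
    (X.bc_naturality d g' (ρ h))
  have h2 := X.bc_bc d hk E.obj (mapp ((X.q d).toRHom.pull.map
    ((X.tau d g').toRHom.push.map (ρ h))) W n₁)
  refine (congrArg (papp (X.bc d h E.obj) ((X.tr d g').pre W)) h1.symm).trans ?_
  refine h2.trans ?_
  have h3 : (X.q d).toRHom.pull.map (ρ g') ≫ (X.q d).toRHom.pull.map
      ((X.tau d g').toRHom.push.map (ρ h)) ≫ (X.q d).toRHom.pull.map (X.cYh d hk E.obj) =
      (lam.toFun g' h : ℂ) • (X.q d).toRHom.pull.map (ρ k) := by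
    rw [← (X.q d).pull_map_smul, ← Functor.map_comp, ← Functor.map_comp]
    exact congrArg (X.q d).toRHom.pull.map (E.rho_rho hk)
  have h4 := congrArg (fun f => mapp f W n) h3
  have h5 : papp (X.bc d k E.obj) W (mapp ((X.q d).toRHom.pull.map (X.cYh d hk E.obj)) W
      (mapp ((X.q d).toRHom.pull.map ((X.tau d g').toRHom.push.map (ρ h))) W n₁)) =
      algebraMap ℂ ((X.coverYY d).O ((X.tr d k).pre W)) (lam.toFun g' h) •
        papp (X.rhoPull d E k) W n :=
    (congrArg (papp (X.bc d k E.obj) W) h4).trans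
      (papp_smul (X.bc d k E.obj) (algebraMap ℂ ((X.coverYY d).O W) (lam.toFun g' h)) _)
  refine (congrArg (mres (X.pullObj d E) (X.tr_pre_tr_pre d hk W).le) h5).trans ?_
  exact Cover.res_smul _ _ _

theorem aSec_comp {k : d.Kh} {F F' F'' : (X.coverYY d).space.Mod} (φ : F ⟶ F')
    (β : F' ⟶ (X.tr d k).toRHom.push.obj F'') {V : Opens (X.coverY d).base}
    (s : MSec (lineTensor (X.eQ d) F) ((X.p d).pre V)) (u : (X.coverY d).Line (X.eY d k) V) :
    X.aSec d (φ ≫ β) s u = X.aSec d β (mapp (lineTensorMap (X.eQ d) φ) _ s) u := by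
  have h5 := X.aSec_naturality d (φ ≫ β) (β₁ := β) (φ := φ) (φ' := 𝟙 _)
    (by rw [CategoryTheory.Functor.map_id, Category.comp_id]) s u
  refine Eq.trans ?_ h5.symm
  have h6 : lineTensorMap (X.eQ d) (𝟙 F'') = 𝟙 _ :=
    ((X.coverYY d).lineBi (X.eQ d)).tensor.map_id _
  rw [h6]
  rfl

/-- The linearizations of the image of `E` under the functor induced by the Fourier–Mukai functor.
-/
theorem rhoEv_induced (k : d.Kh) {U : Opens (X.coverY d).base}
    (x : MSec (((X.equivariantStructure d).induced lam.toFun).obj E).obj U)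
    (u : (X.coverY d).Line (X.eY d k) U) :
    rhoEv (((X.equivariantStructure d).induced lam.toFun).obj E) k x u =
      X.aSec d (X.rhoPull d E k) x u := by
  refine Eq.trans ?_ (X.aSec_comp d _ _ _ _).symm
  exact congrArg (fun x => X.aSec d (X.bc d k E.obj) x u) (mres_self (lineTensor (X.eQ d) _) _)

/-- The morphism `theta` for the linearization of `q^* E`, on sections. -/
abbrev thetaE (k s : d.Kh) {e e' : (X.coverYY d).I → (X.coverYY d).P → ℂ}
    (he : e = X.eQ d * X.eYY d (s * k)) (he' : e' = X.eQ d * X.eYY d s)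
    (W : Opens (X.coverYY d).base) : MSec (lineTensor e (X.pullObj d E)) W →+
      MSec (lineTensor e' (X.pullObj d E)) ((X.tr d k).pre W) :=
  papp (X.theta d k s he he' (X.rhoPull d E k)) W

/-- The linearization of `q^* E ⊗ P_λ`, on sections. -/
def linSec (k : d.Kh) (W : Opens (X.coverYY d).base) :
    StSec lam (X.eYY d) (X.eQ d) (X.pullObj d E) W →+
      StSec lam (X.eYY d) (X.eQ d) (X.pullObj d E) ((X.tr d k).pre W) :=
  RSpace.Mod.app (X := (X.coverYY d).starSpace lam (X.eYY d)) (X.linKernel d E k) W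

theorem linSec_res (k : d.Kh) {V W : Opens (X.coverYY d).base} (h : V ≤ W)
    (m : StSec lam (X.eYY d) (X.eQ d) (X.pullObj d E) W) :
    X.linSec d E k V (stres h m) = stres ((X.tr d k).pre_mono h) (X.linSec d E k W m) :=
  RSpace.Mod.app_res (X := (X.coverYY d).starSpace lam (X.eYY d)) (X.linKernel d E k) h m

theorem linSec_stmul (k : d.Kh) {W : Opens (X.coverYY d).base}
    (b : (X.coverYY d).StarModSec lam (X.eYY d) (X.eQ d) W) (n : MSec (X.pullObj d E) W) :
    X.linSec d E k W (stmul b n) = stmul (X.sigma d lam k b) (papp (X.rhoPull d E k) W n) :=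
  X.linKernel_app d E k W b n

/-- The linearization of `q^* E ⊗ P_λ` in terms of components. -/
theorem starPr_linSec (k s : d.Kh) {e e' : (X.coverYY d).I → (X.coverYY d).P → ℂ}
    (he : e = X.eQ d * X.eYY d (s * k)) (he' : e' = X.eQ d * X.eYY d s)
    {W : Opens (X.coverYY d).base} (m : StSec lam (X.eYY d) (X.eQ d) (X.pullObj d E) W) :
    starPr s he' ((X.tr d k).pre W) (X.linSec d E k W m) =
      algebraMap ℂ ((X.coverYY d).O ((X.tr d k).pre W)) ((lam.toFun k s)⁻¹ : ℂˣ) •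
        X.thetaE d E k s he he' W (starPr (s * k) he W m) := by
  refine star_induction (P := fun W _ m =>
    starPr s he' ((X.tr d k).pre W) (X.linSec d E k W m) =
      algebraMap ℂ ((X.coverYY d).O ((X.tr d k).pre W)) ((lam.toFun k s)⁻¹ : ℂˣ) •
        X.thetaE d E k s he he' W (starPr (s * k) he W m)) ?_ ?_ ?_ ?_ m
  · intro W _ m hm
    refine eq_of_local_pre (X.tr d k) _ fun y hy => ?_
    obtain ⟨V, h, hV, hP⟩ := hm _ hy
    refine ⟨V, h, hV, ?_⟩
    rw [linSec_res, starPr_res, starPr_res, theta_res] at hP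
    refine hP.trans ?_
    exact (Cover.res_smul ((X.tr d k).pre_mono h) (algebraMap ℂ
      ((X.coverYY d).O ((X.tr d k).pre W)) ((lam.toFun k s)⁻¹ : ℂˣ)) _).symm
  · intro W _
    rw [map_zero, map_zero, map_zero, map_zero, smul_zero]
  · intro W _ m m' h h'
    rw [map_add, map_add, map_add, map_add, smul_add, h, h']
  · intro W _ b n
    rw [linSec_stmul, starPr_stmul, starPr_stmul, theta_ltmul, ← smul_ltmul]
    rfl

theorem actPush_app (k : d.Kh) {U : Opens (X.coverY d).base}
    (m : StSec lam (X.eYY d) (X.eQ d) (X.pullObj d E) ((X.p d).pre U)) :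
    RSpace.Mod.app (X := (X.coverY d).starSpace lam (X.eY d)) (X.actPush d E k) U m =
      X.linSec d E k ((X.p d).pre U) m :=
  RSpace.Mod.res_self (X := (X.coverYY d).starSpace lam (X.eYY d))
    (M := starTensor lam (X.eYY d) (X.eQ d) (X.pullObj d E)) _

/-- The invariance of a section of the direct image of `q^* E ⊗ P_λ` to `Y`, in terms of its
components. -/
theorem actPush_eq_iff {U : Opens (X.coverY d).base}
    (m : StSec lam (X.eYY d) (X.eQ d) (X.pullObj d E) ((X.p d).pre U)) :
    (∀ k, RSpace.Mod.app (X := (X.coverY d).starSpace lam (X.eY d)) (X.actPush d E k) U m = m) ↔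
      ∀ k s, algebraMap ℂ ((X.coverYY d).O ((X.p d).pre U)) ((lam.toFun k s)⁻¹ : ℂˣ) •
        (show MSec (lineTensor _ _) ((X.p d).pre U) from
          X.thetaE d E k s rfl rfl _ (starPr (s * k) rfl _ m)) = starPr s rfl _ m := by
  refine forall_congr' fun k => ⟨fun h s => ?_, fun h => ?_⟩
  · refine (X.starPr_linSec d E k s rfl rfl m).symm.trans ?_
    exact congrArg (starPr s rfl ((X.p d).pre U)) ((X.actPush_app d E k m).symm.trans h)
  · refine (X.actPush_app d E k m).trans ?_
    refine starPr_ext fun s => ?_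
    exact (X.starPr_linSec d E k s rfl rfl m).trans (h s)

end Torus

/-! ### Comparison of the two functors -/

namespace Torus

open Cover CoverHom

variable {g : ℕ} (X : Torus g) (d : DefParam g) {lam : Bilin d.Kh} (E : X.ModXhLam d lam)

/-- The sections of `q^* E ⊗ P_λ` over the preimage of `U`. -/
abbrev KerSec (U : Opens (X.coverY d).base) : Type :=
  StSec lam (X.eYY d) (X.eQ d) (X.pullObj d E) ((X.p d).pre U)

/-- The component at `1` of a section of `q^* E ⊗ P_λ`, a section of the image of `E` under the
Fourier–Mukai functor of `Q`. -/
def prOne (U : Opens (X.coverY d).base) :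
    X.KerSec d E U →+ MSec (lineTensor (X.eQ d) (X.pullObj d E)) ((X.p d).pre U) :=
  starPr 1 (X.eQ_mul_one d) ((X.p d).pre U)

/-- The component at `k⁻¹` of an invariant section is determined by its component at `1`. -/
theorem starPr_inv_of_invariant {U : Opens (X.coverY d).base} {m : X.KerSec d E U}
    (hm : ∀ k, RSpace.Mod.app (X := (X.coverY d).starSpace lam (X.eY d)) (X.actPush d E k) U m = m)
    {k s : d.Kh} (hks : s * k = 1) {e' : (X.coverYY d).I → (X.coverYY d).P → ℂ}
    (he' : e' = X.eQ d * X.eYY d s) :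
    starPr s he' _ m = algebraMap ℂ ((X.coverYY d).O ((X.p d).pre U)) ((lam.toFun k s)⁻¹ : ℂˣ) •
      (show MSec (lineTensor e' _) ((X.p d).pre U) from
        X.thetaE d E k s (by rw [hks]; exact X.eQ_mul_one d) he' _ (X.prOne d E U m)) := by
  have h1 := X.starPr_linSec d E k s (e := X.eQ d) (by rw [hks]; exact X.eQ_mul_one d) he' m
  have h2 : starPr (s * k) (by rw [hks]; exact X.eQ_mul_one d) _ m = X.prOne d E U m :=
    starPr_congr hks _ _ m
  rw [h2] at h1
  refine Eq.trans ?_ h1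
  exact congrArg (starPr s he' ((X.p d).pre U)) ((hm k).symm.trans (X.actPush_app d E k m))

/-- The linearization at `1` is the identity, since the linearizations of a twisted equivariant
object for a bilinear `λ` are normalized. -/
theorem thetaE_one {k : d.Kh} (hk : k = 1) {U : Opens (X.coverY d).base}
    (he : X.eQ d = X.eQ d * X.eYY d (1 * k))
    (x : MSec (lineTensor (X.eQ d) (X.pullObj d E)) ((X.p d).pre U)) :
    X.thetaE d E k 1 he (X.eQ_mul_one d) ((X.p d).pre U) x = x := by
  subst hk
  have h1 := rhoEv_one (((X.equivariantStructure d).induced lam.toFun).obj E) x (X.oneLine d U)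
    (fun z => rfl)
  refine Eq.trans ?_ h1
  exact ((X.rhoEv_induced d E 1 x _).trans (X.aSec_one d _ x)).symm

/-- A section of the Fourier–Mukai image of `E` is the component at `1` of a unique invariant
section of `q^* E ⊗ P_λ`. -/
theorem prOne_bijective (U : Opens (X.coverY d).base) :
    Function.Bijective fun m : RSpace.Mod.invSub (X := (X.coverY d).starSpace lam (X.eY d))
      ((X.pushLam d lam).obj ((X.kernelFunctor d lam).obj E)) (X.actPush d E) U =>
        X.prOne d E U m.1 := by
  constructor
  · intro m m' h
    refine Subtype.ext (starPr_ext fun s => ?_)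
    have h1 := X.starPr_inv_of_invariant d E m.2 (mul_inv_cancel s) rfl
    have h2 := X.starPr_inv_of_invariant d E m'.2 (mul_inv_cancel s) rfl
    refine h1.trans (Eq.trans ?_ h2.symm)
    have h3 : X.prOne d E U m.1 = X.prOne d E U m'.1 := h
    rw [h3]
  · intro x
    have he : ∀ s : d.Kh, X.eQ d = X.eQ d * X.eYY d (s * s⁻¹) := fun s => by
      rw [mul_inv_cancel]; exact X.eQ_mul_one d
    obtain ⟨m, hm⟩ := exists_starPr_eq (C := X.coverYY d) lam (e := X.eYY d) (q := X.eQ d)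
      (F := X.pullObj d E) (W := (X.p d).pre U) fun s =>
        algebraMap ℂ ((X.coverYY d).O ((X.p d).pre U)) ((lam.toFun s⁻¹ s)⁻¹ : ℂˣ) •
          (show MSec (lineTensor (X.eQ d * X.eYY d s) (X.pullObj d E)) ((X.p d).pre U) from
            X.thetaE d E s⁻¹ s (he s) rfl _ x)
    have hm' : ∀ (s : d.Kh) {e' : (X.coverYY d).I → (X.coverYY d).P → ℂ}
        (he' : e' = X.eQ d * X.eYY d s), starPr s he' _ m =
          algebraMap ℂ ((X.coverYY d).O ((X.p d).pre U)) ((lam.toFun s⁻¹ s)⁻¹ : ℂˣ) •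
            (show MSec (lineTensor e' (X.pullObj d E)) ((X.p d).pre U) from
              X.thetaE d E s⁻¹ s (he s) he' _ x) := by
      rintro s e' rfl
      exact hm s
    refine ⟨⟨m, (X.actPush_eq_iff d E m).2 fun k s => ?_⟩, ?_⟩
    · have hk : (s * k)⁻¹ * k = s⁻¹ := by rw [mul_inv, inv_mul_cancel_right]
      have h1 := X.theta_theta d hk (s := s) (s' := s * k) (he (s * k)) rfl rfl rfl (he s)
        (lam.toFun (s * k)⁻¹ k : ℂ) (X.rhoPull_rhoPull d E hk) x
      have h2 : X.thetaE d E k s rfl rfl ((X.p d).pre U) (starPr (s * k) rfl _ m) =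
          algebraMap ℂ ((X.coverYY d).O ((X.p d).pre U)) ((lam.toFun (s * k)⁻¹ (s * k))⁻¹ : ℂˣ) •
            (algebraMap ℂ ((X.coverYY d).O ((X.p d).pre U)) (lam.toFun (s * k)⁻¹ k : ℂ) •
              (show MSec (lineTensor (X.eQ d * X.eYY d s) (X.pullObj d E)) ((X.p d).pre U) from
                X.thetaE d E s⁻¹ s (he s) rfl _ x)) := by
        rw [hm' (s * k) rfl]
        refine (papp_smul _ _ _).trans ?_
        refine congrArg (fun y : MSec (lineTensor (X.eQ d * X.eYY d s) (X.pullObj d E))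
          ((X.p d).pre U) => algebraMap ℂ ((X.coverYY d).O ((X.p d).pre U))
            ((lam.toFun (s * k)⁻¹ (s * k))⁻¹ : ℂˣ) • y) ?_
        refine h1.trans ?_
        exact congrArg (fun y : MSec (lineTensor (X.eQ d * X.eYY d s) (X.pullObj d E))
          ((X.p d).pre U) => algebraMap ℂ ((X.coverYY d).O ((X.p d).pre U))
            (lam.toFun (s * k)⁻¹ k : ℂ) • y) (mres_self _ _)
      rw [hm' s rfl]
      refine (congrArg (fun y : MSec (lineTensor (X.eQ d * X.eYY d s) (X.pullObj d E))
          ((X.p d).pre U) => algebraMap ℂ ((X.coverYY d).O ((X.p d).pre U))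
            ((lam.toFun k s)⁻¹ : ℂˣ) • y) h2).trans ?_
      rw [smul_smul, smul_smul, ← map_mul, ← map_mul, ← Units.val_mul, ← Units.val_mul]
      -- the cocycle identity for the values of `λ`
      have h3 : (lam.toFun k s)⁻¹ * ((lam.toFun (s * k)⁻¹ (s * k))⁻¹ * lam.toFun (s * k)⁻¹ k) =
          (lam.toFun s⁻¹ s)⁻¹ := by
        have h4 : lam.toFun (s * k)⁻¹ (s * k) = lam.toFun (s * k)⁻¹ s * lam.toFun (s * k)⁻¹ k :=
          lam.mul_right _ _ _
        have h5 : lam.toFun (s * k)⁻¹ s * lam.toFun k s = lam.toFun s⁻¹ s := by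
          rw [← lam.mul_left, hk]
        rw [h4, ← h5, mul_inv_rev (lam.toFun (s * k)⁻¹ s) (lam.toFun k s),
          mul_inv (lam.toFun (s * k)⁻¹ s) (lam.toFun (s * k)⁻¹ k), inv_mul_cancel_right]
      rw [← mul_assoc] at h3
      rw [h3]
    · refine (hm' 1 (X.eQ_mul_one d)).trans ?_
      have h1 : ((lam.toFun (1 : d.Kh)⁻¹ 1)⁻¹ : ℂˣ) = 1 := by rw [lam.one_right, inv_one]
      rw [h1, Units.val_one, map_one, one_smul]
      exact X.thetaE_one d E inv_one _ x

/-- The component at `1` of an invariant section is compatible with the right actions of the twisted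
algebra. -/
theorem prOne_smul {U : Opens (X.coverY d).base} {m : X.KerSec d E U}
    (hm : ∀ k, RSpace.Mod.app (X := (X.coverY d).starSpace lam (X.eY d)) (X.actPush d E k) U m = m)
    (a : (X.coverY d).StarOp lam (X.eY d) U) :
    X.prOne d E U ((X.p d).onStar lam (X.p_compat d) U a • m) =
      starAct (((X.equivariantStructure d).induced lam.toFun).obj E) a (X.prOne d E U m) := by
  have he : ∀ k, X.eQ d * X.eYY d k⁻¹ * X.eYY d k = X.eQ d := fun k => by
    rw [mul_assoc, ← map_mul, inv_mul_cancel, map_one, mul_one]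
  refine (starPr_one_smul (X.eQ_mul_one d) he _ m).trans ?_
  refine Finset.sum_congr rfl fun k _ => ?_
  rw [X.starPr_inv_of_invariant d E hm (inv_mul_cancel k) rfl]
  refine (congrArg (fun y : MSec (lineTensor (X.eQ d) (X.pullObj d E)) ((X.p d).pre U) =>
    algebraMap ℂ ((X.coverYY d).O ((X.p d).pre U)) (lam.toFun k⁻¹ k : ℂ) • y)
    (smul_tmulLine (he k) _ _ _)).trans ?_
  rw [smul_smul, ← map_mul, ← Units.val_mul]
  have h1 : lam.toFun k⁻¹ k * (lam.toFun k k⁻¹)⁻¹ = 1 := by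
    have h2 : lam.toFun k⁻¹ k * lam.toFun k k = 1 := by
      rw [← lam.mul_left, inv_mul_cancel, lam.one_left]
    have h3 : lam.toFun k k⁻¹ * lam.toFun k k = 1 := by
      rw [← lam.mul_right, inv_mul_cancel, lam.one_right]
    rw [mul_inv_eq_one]
    exact mul_right_cancel (h2.trans h3.symm)
  rw [h1, Units.val_one, map_one, one_smul]
  refine Eq.trans ?_ (X.rhoEv_induced d E k (X.prOne d E U m) (StarOp.comp a k)).symm
  exact (X.theta_tmulLine d (k := k) (s := k⁻¹) (by rw [inv_mul_cancel]; exact X.eQ_mul_one d) rfl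
    (X.rhoPull d E k) (X.eQ_one_mul d k) (X.eQ_mul_one d) rfl (he k) (X.prOne d E U m)
    (X.pLine d (StarOp.comp a k))).symm

/-- The isomorphism between the image of `E` under the deformed Fourier–Mukai functor and the module
over the twisted algebra given by its image under the Fourier–Mukai functor of `Q`. -/
def FMLamIso : (X.FMLam d lam).obj E ≅
    (X.toXLam d lam).obj (((X.equivariantStructure d).induced lam.toFun).obj E) :=
  RSpace.Mod.isoOfBij (X := (X.coverY d).starSpace lam (X.eY d))
    (RSpace.Mod.mkHom (X := (X.coverY d).starSpace lam (X.eY d)) _ _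
      (fun U => AddMonoidHom.mk' (fun m : RSpace.Mod.invSub _ (X.actPush d E) U =>
        X.prOne d E U m.1) fun m m' => map_add (X.prOne d E U) m.1 m'.1)
      (fun U a m => X.prOne_smul d E (Subtype.property (show RSpace.Mod.invSub _
        (X.actPush d E) U from m)) a)
      (fun h m => starPr_res 1 (X.eQ_mul_one d) ((X.p d).pre_mono h) (Subtype.val
        (show RSpace.Mod.invSub _ (X.actPush d E) _ from m))))
    (X.prOne_bijective d E)

/-- The functor induced by the Fourier–Mukai functor of `Q` is isomorphic to the deformed
Fourier–Mukai functor. -/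
def inducedIso (lam : Bilin d.Kh) : (X.equivariantStructure d).induced lam.toFun ⋙ X.toXLam d lam ≅
    X.FMLam d lam :=
  Iso.symm (NatIso.ofComponents (F := X.FMLam d lam)
    (G := (X.equivariantStructure d).induced lam.toFun ⋙ X.toXLam d lam) (fun E => X.FMLamIso d E)
    fun {E E'} f => RSpace.Mod.hom_ext (X := (X.coverY d).starSpace lam (X.eY d)) fun U m =>
      starPr_map 1 (X.eQ_mul_one d) ((X.q d).toRHom.pull.map f.hom) (Subtype.val
        (show RSpace.Mod.invSub _ (X.actPush d E) U from m)))

end Torus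

/-! ### Coherence for families indexed by finite types -/

section Coh

variable {T : TopCat.{0}} {R : Opens T → Type} [∀ W, Ring (R W)]
  (rr : ∀ U V : Opens T, U ≤ V → R V → R U) {S : Opens T → Type} [∀ W, AddCommGroup (S W)]
  [∀ W, Module (R W) (S W)] (sr : ∀ U V : Opens T, U ≤ V → S V → S U)

/-- Near `x`, the elements of `R^ι` which satisfy `N` are the linear combinations of finitely many
of them. -/
def FinGen {ι : Type} {U : Opens T} (N : ∀ W : Opens T, W ≤ U → (ι → R W) → Prop) (x : T) : Prop :=
  ∃ (V : Opens T) (hV : V ≤ U) (κ : Type) (_ : Fintype κ) (r : κ → ι → R V), x ∈ V ∧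
    (∀ j, N V hV (r j)) ∧ ∀ (W : Opens T) (hW : W ≤ V) (b : ι → R W), N W (hW.trans hV) b →
      ∀ y ∈ W, ∃ (W' : Opens T) (h : W' ≤ W) (c : κ → R W'), y ∈ W' ∧
        ∀ i, rr W' W h (b i) = ∑ j, c j * rr W' V (h.trans hW) (r j i)

/-- Near every point, the sections of `S` are the linear combinations of finitely many of them. -/
def FinType : Prop :=
  ∀ x : T, ∃ (V : Opens T) (κ : Type) (_ : Fintype κ) (s : κ → S V), x ∈ V ∧
    ∀ (W : Opens T) (hW : W ≤ V) (t : S W), ∀ y ∈ W, ∃ (W' : Opens T) (h : W' ≤ W) (a : κ → R W'),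
      y ∈ W' ∧ sr W' W h t = ∑ i, a i • sr W' V (h.trans hW) (s i)

/-- The sheaf of relations between finitely many sections is locally finitely generated. -/
def FinRel : Prop :=
  ∀ (U : Opens T) (ι : Type) [Fintype ι] (s : ι → S U), ∀ x ∈ U,
    FinGen rr (fun W hW (b : ι → R W) => ∑ i, b i • sr W U hW (s i) = 0) x

end Coh

namespace RSpace.Mod

variable {X : RSpace}

/-- Coherence in terms of families indexed by arbitrary finite types. -/
theorem isCoherent_iff (M : X.Mod) : M.IsCoherent ↔
    FinType (R := fun W => X.sh.obj.obj (op W)) (S := fun W => M.Sec W) (fun U V h m => M.res h m) ∧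
    FinRel (R := fun W => X.sh.obj.obj (op W)) (fun U V h r => X.sh.obj.map (homOfLE h).op r)
      (S := fun W => M.Sec W) (fun U V h m => M.res h m) := by
  refine and_congr ⟨fun H x => ?_, fun H x => ?_⟩ ⟨fun H U ι _ s x hx => ?_, fun H U m s x hx => ?_⟩
  · obtain ⟨V, m, s, hx, h⟩ := H x
    refine ⟨V, Fin m, inferInstance, s, hx, fun W hW t y hy => ?_⟩
    obtain ⟨W', hW', hV, a, hy', e⟩ := h W hW t y hy
    exact ⟨W', hW', a, hy', e⟩
  · obtain ⟨V, κ, _, s, hx, h⟩ := H x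
    refine ⟨V, _, s ∘ (Fintype.equivFin κ).symm, hx, fun W hW t y hy => ?_⟩
    obtain ⟨W', hW', a, hy', e⟩ := h W hW t y hy
    refine ⟨W', hW', hW'.trans hW, a ∘ (Fintype.equivFin κ).symm, hy', e.trans ?_⟩
    exact ((Fintype.equivFin κ).symm.sum_comp
      (fun i => a i • M.res (hW'.trans hW) (s i))).symm
  · let ε := Fintype.equivFin ι
    obtain ⟨V, hV, n, r, hx', h0, h⟩ := H U _ (s ∘ ε.symm) x hx
    refine ⟨V, hV, Fin n, inferInstance, fun j i => r j (ε i), hx', fun j => ?_,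
      fun W hW b hb y hy => ?_⟩
    · refine Eq.trans ?_ (h0 j)
      refine ((ε.symm.sum_comp (fun i => r j (ε i) • M.res hV (s i))).symm).trans ?_
      exact Finset.sum_congr rfl fun i _ => by rw [Equiv.apply_symm_apply]; rfl
    · obtain ⟨W', hW', c, hy', e⟩ := h W hW (b ∘ ε.symm)
        ((ε.symm.sum_comp (fun i => b i • M.res (hW.trans hV) (s i))).trans hb) y hy
      refine ⟨W', hW', c, hy', fun i => ?_⟩
      refine Eq.trans ?_ (e (ε i))
      rw [Function.comp_apply, Equiv.symm_apply_apply]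
  · obtain ⟨V, hV, κ, _, r, hx', h0, h⟩ := H U (Fin m) s x hx
    refine ⟨V, hV, _, r ∘ (Fintype.equivFin κ).symm, hx', fun j => h0 _,
      fun W hW b hb y hy => ?_⟩
    obtain ⟨W', hW', c, hy', e⟩ := h W hW b hb y hy
    refine ⟨W', hW', c ∘ (Fintype.equivFin κ).symm, hy', fun i => (e i).trans ?_⟩
    exact ((Fintype.equivFin κ).symm.sum_comp (fun j => c j *
      (X.sh.obj.map (homOfLE (hW'.trans hW)).op (r j i) : X.sh.obj.obj (op W')))).symm

theorem app_comb {M N : X.Mod} (f : M ⟶ N) {U V : Opens X.top} (h : V ≤ U) {m : ℕ}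
    (s : Fin m → M.Sec U) (a : Fin m → X.sh.obj.obj (op V)) :
    app f V (comb h s a) = comb h (fun i => app f U (s i)) a := by
  refine (map_sum (app f V) _ _).trans (Finset.sum_congr rfl fun i _ => ?_)
  rw [app_smul, app_res]

theorem IsCoherent.of_iso {M N : X.Mod} (i : M ≅ N) (H : M.IsCoherent) : N.IsCoherent := by
  have e1 : ∀ (U : Opens X.top) (t : N.Sec U), app i.hom U (app i.inv U t) = t := fun U t =>
    congrArg (fun f => app f U t) i.inv_hom_id
  refine ⟨fun x => ?_, fun U m s x hx => ?_⟩
  · obtain ⟨V, m, s, hx, h⟩ := H.1 x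
    refine ⟨V, m, fun j => app i.hom V (s j), hx, fun W hW t y hy => ?_⟩
    obtain ⟨W', hW', hV, a, hy', e⟩ := h W hW (app i.inv W t) y hy
    refine ⟨W', hW', hV, a, hy', ?_⟩
    rw [← app_comb, ← e, app_res, e1]
  · obtain ⟨V, hV, n, r, hx', h0, h⟩ := H.2 U m (fun j => app i.inv U (s j)) x hx
    refine ⟨V, hV, n, r, hx', fun j => ?_, fun W hW b hb => h W hW b ?_⟩
    · have h1 := congrArg (app i.hom V) (h0 j)
      rw [app_comb, map_zero] at h1
      simpa only [e1] using h1
    · rw [← app_comb, hb, map_zero]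

end RSpace.Mod

/-! ### Coherence over the twisted algebra -/

namespace Cover

variable {C : Cover} {G : Type} [CommGroup G] [Fintype G] {l : Bilin G}
  {e : G →* (C.I → C.P → ℂ)}

variable (C e) in
/-- Nowhere vanishing sections of all the line bundles `L k`, with their inverses. -/
structure Frames (V : Opens C.base) where
  u : ∀ k, C.Line (e k) V
  v : ∀ k, C.Line (e k⁻¹) V
  inv : ∀ k z, (u k).1.1 z * (v k).1.1 z = 1

theorem exists_frames (ht : ∀ k, C.LocTriv (e k)) {x : C.base} {U : Opens C.base} (hx : x ∈ U) :
    ∃ V : Opens C.base, V ≤ U ∧ x ∈ V ∧ Nonempty (C.Frames e V) := by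
  choose V hV F using fun k => ht k x
  let V₀ : Opens C.base := ⟨U ∩ ⋂ k, V k, U.2.inter (isOpen_iInter_of_finite fun k => (V k).2)⟩
  have hk : ∀ k, V₀ ≤ V k := fun k y hy => Set.mem_iInter.1 hy.2 k
  have hinv : ∀ k, (e k)⁻¹ = e k⁻¹ := fun k => by
    funext i z
    have h1 : e k * e k⁻¹ = 1 := by rw [← map_mul, mul_inv_cancel, map_one]
    exact (eq_inv_of_mul_eq_one_right (congrFun (congrFun h1 i) z)).symm
  refine ⟨V₀, fun y hy => hy.1, ⟨hx, Set.mem_iInter.2 hV⟩, ⟨?_⟩⟩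
  let F' : ∀ k, C.Frame (e k) V₀ := fun k => (F k).some.res (hk k)
  exact ⟨fun k => (F' k).u, fun k => ⟨(F' k).v.1, by rw [← hinv]; exact (F' k).v.2⟩,
    fun k z => (F' k).inv z⟩

namespace Frames

variable {V : Opens C.base} (Φ : C.Frames e V)

/-- The restriction of frames. -/
def res {W : Opens C.base} (h : W ≤ V) : C.Frames e W :=
  ⟨fun k => resLine h (Φ.u k), fun k => resLine h (Φ.v k), fun k z => Φ.inv k ⟨z.1, h z.2⟩⟩

theorem exists_smul_eq (hC : C.Exact) {k : G} (w : C.Line (e k) V) :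
    ∃ r : C.O V, w = r • Φ.u k := by
  obtain ⟨a, ha⟩ := hC.descend (mulLine (e := e k) (e' := e k⁻¹) (e'' := 1)
    (by rw [← map_mul, mul_inv_cancel, map_one]) w (Φ.v k))
  refine ⟨a, Subtype.ext (Subtype.ext (funext fun z => ?_))⟩
  have h1 : w.1.1 z * (Φ.v k).1.1 z = a.1 ⟨C.π z, z.2⟩ := ha z
  change w.1.1 z = a.1 ⟨C.π z, z.2⟩ * (Φ.u k).1.1 z
  rw [← h1, mul_assoc, mul_comm ((Φ.v k).1.1 z), Φ.inv, mul_one]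

end Frames

/-- Nowhere vanishing sections of line bundles can be cancelled. -/
theorem smul_injective_of_ne_zero (hC : C.Exact) {e' : C.I → C.P → ℂ} {W : Opens C.base}
    {w : C.Line e' W} (hw : ∀ z, w.1.1 z ≠ 0) {a b : C.O W} (h : a • w = b • w) : a = b := by
  refine Subtype.ext (funext fun y => ?_)
  obtain ⟨z, hz⟩ := hC.surj y.1
  have hz' : C.π z ∈ W := by rw [hz]; exact y.2
  have h1 : a.1 ⟨C.π z, hz'⟩ * w.1.1 ⟨z, hz'⟩ = b.1 ⟨C.π z, hz'⟩ * w.1.1 ⟨z, hz'⟩ :=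
    congrArg (fun u : C.Line e' W => u.1.1 ⟨z, hz'⟩) h
  have h2 := mul_right_cancel₀ (hw ⟨z, hz'⟩) h1
  have hy : (⟨C.π z, hz'⟩ : W) = y := Subtype.ext hz
  rwa [hy] at h2

namespace StarOp

variable {W : Opens C.base}

theorem ext_comp {a b : C.StarOp l e W} (h : ∀ k, a.comp k = b.comp k) : a = b :=
  MulOpposite.unop_injective (Subtype.ext (funext fun k => congrArg Subtype.val (h k)))

variable (l) in
/-- The section of the twisted algebra with given components. -/
def ofComp (f : ∀ k, C.Line (e k) W) : C.StarOp l e W :=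
  MulOpposite.op (⟨fun k => (f k).1, fun k => (f k).2⟩ : C.Star l e W)

theorem comp_ofComp (f : ∀ k, C.Line (e k) W) (k : G) : (ofComp l f).comp k = f k := rfl

theorem comp_sum {ι : Type} (s : Finset ι) (a : ι → C.StarOp l e W) (k : G) :
    (∑ i ∈ s, a i).comp k = ∑ i ∈ s, (a i).comp k :=
  map_sum (AddMonoidHom.mk' (fun a : C.StarOp l e W => a.comp k) fun _ _ => rfl) a s

variable (C e) in
/-- The constant section `1` of `L 1`. -/
def one₁ (W : Opens C.base) : C.Line (e 1) W :=
  ⟨1, fun i z z' _ => by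
    change (1 : ℂ) = e 1 i z * 1
    rw [map_one]
    exact (mul_one 1).symm⟩

open Classical in
variable (l e) in
/-- The functions, as the sections of the twisted algebra which are concentrated in degree `1`. -/
def ofO (r : C.O W) : C.StarOp l e W :=
  ofComp l fun k => if h : k = 1 then ⟨(r • one₁ C e W).1, by rw [h]; exact (r • one₁ C e W).2⟩
    else 0

theorem comp_ofO_one (r : C.O W) : (ofO l e r).comp 1 = r • one₁ C e W := dif_pos rfl

theorem comp_ofO_ne (r : C.O W) {k : G} (hk : k ≠ 1) : (ofO l e r).comp k = 0 := dif_neg hk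

theorem comp_ofO_mul (r : C.O W) (a : C.StarOp l e W) (k : G) :
    (ofO l e r * a).comp k = r • a.comp k := by
  rw [comp_mul, Finset.sum_eq_single k]
  · have key : ∀ (k' : G) (hk' : k' = 1) (h : e k * e k' = e k),
        algebraMap ℂ (C.O W) (l.toFun k k') • mulLine h (a.comp k) ((ofO l e r).comp k') =
          r • a.comp k := by
      rintro k' rfl h
      rw [l.one_right, Units.val_one, map_one, one_smul, comp_ofO_one, mulLine_smul]
      refine congrArg (fun w => r • w) (Subtype.ext ?_)
      exact mul_one _
    exact key _ (inv_mul_cancel k) _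
  · intro j _ hj
    rw [comp_ofO_ne r fun h => hj (inv_mul_eq_one.1 h)]
    exact (congrArg (fun w : C.Line (e k) W => algebraMap ℂ (C.O W) (l.toFun j (j⁻¹ * k)) • w)
      (Subtype.ext (mul_zero (a.comp j).1))).trans (smul_zero _)
  · exact fun h => (h (Finset.mem_univ k)).elim

end StarOp

section Act

variable {hC : C.Exact} {ht : ∀ k, C.LocTriv (e k)}
  (A : TwistedEquivariant (homAction e hC ht) l.toFun) {W : Opens C.base}

theorem rhoEv_smul_left (k : G) (r : C.O W) (m : MSec A.obj W) (u : C.Line (e k) W) :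
    rhoEv A k (r • m) u = r • rhoEv A k m u :=
  (congrArg (fun f => hev (e := e k) (M := A.obj) f le_rfl u)
    (app_smul (A.rho k).hom r m)).trans (hev_smul _ _ _ _)

theorem res_rhoEv {V : Opens C.base} (h : V ≤ W) (k : G) (m : MSec A.obj W)
    (u : C.Line (e k) W) :
    mres A.obj h (rhoEv A k m u) = rhoEv A k (mres A.obj h m) (resLine h u) := by
  refine (hev_nat (e := e k) (M := A.obj) (mapp (A.rho k).hom W m) le_rfl h u).symm.trans ?_
  exact congrArg (fun f => hev (e := e k) (M := A.obj) f le_rfl (resLine h u))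
    (RSpace.Mod.app_res (X := C.space) (A.rho k).hom h m).symm

/-- Evaluating `ρ_k m` at a nowhere vanishing section of `L k` loses no information, since `m` is
recovered up to a constant by applying `ρ_{k⁻¹}`. -/
theorem eq_zero_of_rhoEv (Φ : C.Frames e W) (k : G) {m : MSec A.obj W}
    (h : rhoEv A k m (Φ.u k) = 0) : m = 0 := by
  have h1 := rhoEv_rhoEv A (mul_inv_cancel k) m (Φ.u k) (Φ.v k)
  rw [h, rhoEv_zero] at h1
  have h2 := rhoEv_one A m (mulLine (by rw [← map_mul, mul_inv_cancel]) (Φ.u k) (Φ.v k)) (Φ.inv k)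
  rw [h2] at h1
  have h3 := congrArg (fun x : MSec A.obj W =>
    algebraMap ℂ (C.O W) ((l.toFun k k⁻¹)⁻¹ : ℂˣ) • x) h1
  simp only [smul_zero, smul_smul, ← map_mul, ← Units.val_mul] at h3
  rw [inv_mul_cancel, Units.val_one, map_one, one_smul] at h3
  exact h3.symm

theorem ofO_smul (r : C.O W) (m : MSec A.obj W) : StarOp.ofO l e r • m = r • m := by
  rw [star_smul_def, Finset.sum_eq_single 1]
  · rw [StarOp.comp_ofO_one, rhoEv_smul, rhoEv_one A m _ fun z => rfl]
  · intro k _ hk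
    rw [StarOp.comp_ofO_ne r hk]
    have := rhoEv_add' A k m 0 0
    rw [add_zero] at this
    exact left_eq_add.1 this
  · exact fun h => (h (Finset.mem_univ _)).elim

theorem star_smul_frames (Φ : C.Frames e W) (a : C.StarOp l e W) (α : G → C.O W)
    (h : ∀ k, a.comp k = α k • Φ.u k) (m : MSec A.obj W) :
    a • m = ∑ k, α k • rhoEv A k m (Φ.u k) := by
  rw [star_smul_def]
  exact Finset.sum_congr rfl fun k _ => by rw [h, rhoEv_smul]

/-- The restriction maps of the twisted algebra. -/
abbrev starRes (l : Bilin G) (e : G →* (C.I → C.P → ℂ)) (U V : Opens C.base) (h : U ≤ V) :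
    C.StarOp l e V → C.StarOp l e U := (C.starData l e).res h

/-- A sheaf has finite type over the functions. -/
abbrev FinTypeO (M : C.space.Mod) : Prop :=
  FinType (R := fun W => C.O W) (S := fun W => MSec M W) fun U V h m => mres M h m

/-- The relations over the functions between sections of a sheaf are locally finitely generated. -/
abbrev FinRelO (M : C.space.Mod) : Prop :=
  FinRel (R := fun W => C.O W) (fun U V h r => resO h r) (S := fun W => MSec M W)
    fun U V h m => mres M h m

/-- The module over the twisted algebra given by `A` has finite type. -/
abbrev FinTypeStar : Prop :=
  FinType (R := fun W => C.StarOp l e W) (S := fun W => MSec A.obj W) fun U V h m => mres A.obj h m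

/-- The relations over the twisted algebra between sections of the module given by `A` are locally
finitely generated. -/
abbrev FinRelStar : Prop :=
  FinRel (R := fun W => C.StarOp l e W) (starRes l e) (S := fun W => MSec A.obj W)
    fun U V h m => mres A.obj h m

theorem finTypeStar_of_finTypeO (H : FinTypeO A.obj) : FinTypeStar A := by
  intro x
  obtain ⟨V, κ, _, s, hx, h⟩ := H x
  refine ⟨V, κ, inferInstance, s, hx, fun W hW t y hy => ?_⟩
  obtain ⟨W', hW', a, hy', e1⟩ := h W hW t y hy
  refine ⟨W', hW', fun i => StarOp.ofO l e (a i), hy', e1.trans ?_⟩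
  exact Finset.sum_congr rfl fun i _ => (ofO_smul A (a i) _).symm

/-- If `s i` are generators over the twisted algebra, then their images under the linearizations,
evaluated at frames of the line bundles, are generators over the functions. -/
theorem finTypeO_of_finTypeStar (H : FinTypeStar A) : FinTypeO A.obj := by
  intro x
  obtain ⟨V, κ, _, s, hx, h⟩ := H x
  obtain ⟨V', hV', hx', ⟨Φ⟩⟩ := exists_frames (e := e) ht hx
  refine ⟨V', κ × G, inferInstance, fun j => rhoEv A j.2 (mres A.obj hV' (s j.1)) (Φ.u j.2), hx',
    fun W hW t y hy => ?_⟩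
  obtain ⟨W', hW', a, hy', e1⟩ := h W (hW.trans hV') t y hy
  choose α hα using fun i k => (Φ.res (hW'.trans hW)).exists_smul_eq hC ((a i).comp k)
  refine ⟨W', hW', fun j => α j.1 j.2, hy', e1.trans ?_⟩
  rw [Fintype.sum_prod_type]
  refine Finset.sum_congr rfl fun i _ => ?_
  refine (star_smul_frames A (Φ.res (hW'.trans hW)) (a i) (α i) (hα i) _).trans ?_
  refine Finset.sum_congr rfl fun k _ => congrArg (fun x => α i k • x) ?_
  refine Eq.trans ?_ (res_rhoEv A (hW'.trans hW) k _ _).symm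
  exact congrArg (fun m => rhoEv A k m ((Φ.res (hW'.trans hW)).u k)) (mres_mres _ _ _ _).symm

/-- The relations over the twisted algebra between sections `s i` are the relations over the
functions between their images under the linearizations, evaluated at frames of the line bundles. -/
theorem finRelStar_of_finRelO (H : FinRelO A.obj) : FinRelStar A := by
  intro U ι _ s x hx
  obtain ⟨V, hV, hx', ⟨Φ⟩⟩ := exists_frames (e := e) ht hx
  obtain ⟨V', hV', κ, _, r, hx'', h0, h⟩ := H V (ι × G)
    (fun j => rhoEv A j.2 (mres A.obj hV (s j.1)) (Φ.u j.2)) x hx'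
  -- the relation over the functions corresponding to a relation over the twisted algebra
  have key : ∀ {W : Opens C.base} (hW : W ≤ V) (b : ι → C.StarOp l e W) (β : ι → G → C.O W),
      (∀ i k, (b i).comp k = β i k • (Φ.res hW).u k) →
      ∑ i, b i • mres A.obj (hW.trans hV) (s i) = ∑ j : ι × G, β j.1 j.2 •
        mres A.obj hW (rhoEv A j.2 (mres A.obj hV (s j.1)) (Φ.u j.2)) := by
    intro W hW b β hβ
    rw [Fintype.sum_prod_type]
    refine Finset.sum_congr rfl fun i _ => ?_
    refine (star_smul_frames A (Φ.res hW) (b i) (β i) (hβ i) _).trans ?_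
    refine Finset.sum_congr rfl fun k _ => congrArg (fun x => β i k • x) ?_
    refine Eq.trans ?_ (res_rhoEv A hW k _ _).symm
    exact congrArg (fun m => rhoEv A k m ((Φ.res hW).u k)) (mres_mres _ _ _ _).symm
  refine ⟨V', hV'.trans hV, κ, inferInstance,
    fun j i => StarOp.ofComp l fun k => r j (i, k) • (Φ.res hV').u k, hx'', fun j => ?_,
    fun W hW b hb y hy => ?_⟩
  · exact (key hV' _ (fun i k => r j (i, k)) fun i k => rfl).trans (h0 j)
  · choose β hβ using fun i k => (Φ.res (hW.trans hV')).exists_smul_eq hC ((b i).comp k)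
    obtain ⟨W', hW', c, hy', e1⟩ := h W hW (fun j => β j.1 j.2)
      ((key (hW.trans hV') b β hβ).symm.trans hb) y hy
    refine ⟨W', hW', fun j => StarOp.ofO l e (c j), hy', fun i => StarOp.ext_comp fun k => ?_⟩
    rw [StarOp.comp_sum]
    refine (congrArg (resLine hW') (hβ i k)).trans ((resLine_smul hW' _ _).trans ?_)
    refine (congrArg (fun r : C.O W' => r • (Φ.res (hW'.trans (hW.trans hV'))).u k)
      (e1 (i, k))).trans ?_
    rw [Finset.sum_smul]
    refine Finset.sum_congr rfl fun j _ => ?_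
    rw [StarOp.comp_ofO_mul, mul_smul]
    rfl

end Act

end Cover

/-! ### Intersections of twisted sheaves of relations -/

section Coh

variable {T : TopCat.{0}} {R : Opens T → Type} [∀ W, Ring (R W)]
  (rr : ∀ U V : Opens T, U ≤ V → R V →+* R U) {S : Opens T → Type} [∀ W, AddCommGroup (S W)]
  [∀ W, Module (R W) (S W)] (sr : ∀ U V : Opens T, U ≤ V → S V →+ S U)

/-- Let `θ` be automorphisms of the sheaf of rings `R`. If the sheaves of relations in `S` are
locally finitely generated, then so are the intersections of their images under finitely many of the
`θ j`: the elements `∑ b p * r p` of the sheaf generated by the `r p` which, after applying `θ j`,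
are relations between the `s i`, correspond to the relations between the sections `∑ θ j (r p i) • s
i`. -/
theorem FinRel.finGen_twist
    (rr_rr : ∀ {U V W : Opens T} (h : U ≤ V) (h' : V ≤ W) (a : R W),
      rr U V h (rr V W h' a) = rr U W (h.trans h') a)
    (sr_sr : ∀ {U V W : Opens T} (h : U ≤ V) (h' : V ≤ W) (a : S W),
      sr U V h (sr V W h' a) = sr U W (h.trans h') a)
    (sr_smul : ∀ {U V : Opens T} (h : U ≤ V) (a : R V) (m : S V),
      sr U V h (a • m) = rr U V h a • sr U V h m)
    {J : Type} (θ : J → ∀ W, R W ≃+* R W)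
    (rr_θ : ∀ {U V : Opens T} (h : U ≤ V) (j : J) (a : R V),
      rr U V h (θ j V a) = θ j U (rr U V h a))
    (H : FinRel (R := R) (fun U V h a => rr U V h a) (S := S) (fun U V h m => sr U V h m))
    (F : Finset J) {ι : Type} [Fintype ι] {U : Opens T} (s : ι → S U) {x : T} (hx : x ∈ U) :
    FinGen (R := R) (fun U V h a => rr U V h a) (fun W hW (b : ι → R W) =>
      ∀ j ∈ F, ∑ i, θ j W (b i) • sr W U hW (s i) = 0) x := by
  classical
  induction F using Finset.induction_on with
  | empty =>
    refine ⟨U, le_rfl, ι, inferInstance, fun j => Pi.single j 1, hx, fun _ _ h => by simp at h,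
      fun W hW b _ y hy => ⟨W, le_rfl, fun i => rr W W le_rfl (b i), hy, fun i => ?_⟩⟩
    rw [Finset.sum_eq_single i]
    · beta_reduce
      rw [Pi.single_eq_same, map_one, mul_one]
    · intro j _ hj
      beta_reduce
      rw [Pi.single_eq_of_ne hj.symm, map_zero, mul_zero]
    · exact fun h => (h (Finset.mem_univ i)).elim
  | insert j F _ ih =>
    obtain ⟨V, hV, κ, _, r, hx', h0, h⟩ := ih
    -- the relations among the combinations `∑ θ j (r p i) • s i` single out, after `(θ j)⁻¹`, the
    -- elements of the sheaf generated by the `r p` which are relations for `j`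
    obtain ⟨V', hV', κ', _, q, hx'', h0', h'⟩ :=
      H V κ (fun p => ∑ i, θ j V (r p i) • sr V U hV (s i)) x hx'
    have key : ∀ (j' : J) {W : Opens T} (hW : W ≤ V) (c : κ → R W),
        ∑ i, θ j' W (∑ p, c p * rr W V hW (r p i)) • sr W U (hW.trans hV) (s i) =
          ∑ p, θ j' W (c p) • sr W V hW (∑ i, θ j' V (r p i) • sr V U hV (s i)) := by
      intro j' W hW c
      simp only [map_sum, map_mul, sr_smul, sr_sr, rr_θ, Finset.sum_smul, Finset.smul_sum, mul_smul]
      exact Finset.sum_comm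
    refine ⟨V', hV'.trans hV, κ', inferInstance,
      fun m i => ∑ p, (θ j V').symm (q m p) * rr V' V hV' (r p i), hx'', fun m j' hj' => ?_,
      fun W hW b hb y hy => ?_⟩
    · rw [key]
      rcases Finset.mem_insert.1 hj' with rfl | hj'
      · refine Eq.trans (Finset.sum_congr rfl fun p _ => ?_) (h0' m)
        rw [RingEquiv.apply_symm_apply]
      · refine Finset.sum_eq_zero fun p _ => ?_
        rw [h0 p j' hj', map_zero, smul_zero]
    · obtain ⟨W₁, hW₁, c, hy₁, e₁⟩ := h W (hW.trans hV') b
        (fun j' hj' => hb j' (Finset.mem_insert_of_mem hj')) y hy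
      have e₂ : ∑ p, θ j W₁ (c p) • sr W₁ V (hW₁.trans (hW.trans hV'))
          (∑ i, θ j V (r p i) • sr V U hV (s i)) = 0 := by
        rw [← key]
        have h1 := congrArg (sr W₁ W hW₁) (hb j (Finset.mem_insert_self j F))
        rw [map_sum, map_zero] at h1
        refine Eq.trans (Finset.sum_congr rfl fun i _ => ?_) h1
        rw [← e₁, sr_smul, sr_sr, rr_θ]
      obtain ⟨W₂, hW₂, c', hy₂, e₃⟩ := h' W₁ (hW₁.trans hW) _ e₂ y hy₁
      refine ⟨W₂, hW₂.trans hW₁, fun m => (θ j W₂).symm (c' m), hy₂, fun i => ?_⟩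
      have θ_symm : ∀ (a : R V'), rr W₂ V' ((hW₂.trans hW₁).trans hW) ((θ j V').symm a) =
          (θ j W₂).symm (rr W₂ V' ((hW₂.trans hW₁).trans hW) a) := fun a => by
        rw [RingEquiv.eq_symm_apply, ← rr_θ, RingEquiv.apply_symm_apply]
      have e₄ : ∀ p, rr W₂ W₁ hW₂ (c p) =
          ∑ m, (θ j W₂).symm (c' m) *
            rr W₂ V' ((hW₂.trans hW₁).trans hW) ((θ j V').symm (q m p)) := by
        intro p
        have h1 := congrArg (θ j W₂).symm ((rr_θ hW₂ j (c p)).symm.trans (e₃ p))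
        rw [RingEquiv.symm_apply_apply] at h1
        simp only [map_sum, map_mul] at h1
        simpa only [θ_symm] using h1
      change rr W₂ W _ (b i) = _
      rw [← rr_rr hW₂ hW₁]
      refine (congrArg (rr W₂ W₁ hW₂) (e₁ i)).trans ?_
      simp only [map_sum, map_mul, rr_rr, e₄, Finset.sum_mul, Finset.mul_sum, mul_assoc]
      exact Finset.sum_comm

end Coh

/-- If all the sums `∑ χ k • y k` for characters `χ` vanish, then all the `y k` vanish. -/
theorem eq_zero_of_sum_characters {G : Type} [CommGroup G] [Fintype G] {R M : Type} [CommRing R]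
    [Algebra ℂ R] [AddCommGroup M] [Module R M] (y : G → M)
    (H : ∀ χ : G →* ℂˣ, ∑ k, algebraMap ℂ R (χ k) • y k = 0) (h : G) : y h = 0 := by
  classical
  let D := G →* ℂˣ
  have : Fintype D := Fintype.ofFinite D
  -- orthogonality of characters
  have orth : ∀ k : G, k ≠ 1 → ∑ χ : D, (χ k : ℂ) = 0 := by
    intro k hk
    obtain ⟨χ₀, hχ₀⟩ := CommGroup.exists_apply_ne_one_of_hasEnoughRootsOfUnity G ℂ hk
    have h1 : ((χ₀ k : ℂˣ) : ℂ) * ∑ χ : D, (χ k : ℂ) = ∑ χ : D, (χ k : ℂ) := by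
      rw [Finset.mul_sum]
      exact (Finset.sum_congr rfl fun χ _ => (Units.val_mul (χ₀ k) (χ k)).symm).trans
        (Equiv.sum_comp (Equiv.mulLeft χ₀) fun χ : D => (χ k : ℂ))
    by_contra h2
    exact hχ₀ (Units.ext (mul_right_cancel₀ h2 (h1.trans (one_mul _).symm)))
  have h1 : ∑ χ : D, algebraMap ℂ R (χ h⁻¹) • ∑ k, algebraMap ℂ R (χ k) • y k = 0 :=
    Finset.sum_eq_zero fun χ _ => by rw [H, smul_zero]
  simp only [Finset.smul_sum, smul_smul, ← map_mul, ← Units.val_mul] at h1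
  rw [Finset.sum_comm] at h1
  simp only [← Finset.sum_smul, ← map_sum] at h1
  rw [Finset.sum_eq_single h] at h1
  · have hD : (Fintype.card D : ℂ) ≠ 0 := Nat.cast_ne_zero.2 Fintype.card_ne_zero
    simp only [inv_mul_cancel, map_one, Units.val_one, Finset.sum_const, Finset.card_univ,
      nsmul_eq_mul, mul_one] at h1
    have h2 := congrArg (fun m : M => algebraMap ℂ R (Fintype.card D : ℂ)⁻¹ • m) h1
    simp only [smul_zero, smul_smul, ← map_mul] at h2
    rwa [inv_mul_cancel₀ hD, map_one, one_smul] at h2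
  · intro k _ hk
    rw [orth _ fun h2 => hk (inv_mul_eq_one.1 h2).symm, map_zero, zero_smul]
  · exact fun h2 => (h2 (Finset.mem_univ h)).elim

/-! ### Coherence of twisted equivariant sheaves and of the corresponding modules -/

namespace Cover

variable {C : Cover} {G : Type} [CommGroup G] [Fintype G] {l : Bilin G}
  {e : G →* (C.I → C.P → ℂ)}

/-- The sections of `L 1` are the functions. -/
theorem exists_smul_one₁ (hC : C.Exact) {W : Opens C.base} (w : C.Line (e 1) W) :
    ∃ r : C.O W, w = r • StarOp.one₁ C e W := by
  obtain ⟨a, ha⟩ := hC.descend (⟨w.1, by rw [← map_one e]; exact w.2⟩ : C.Line 1 W)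
  exact ⟨a, Subtype.ext (Subtype.ext (funext fun z => (ha z).trans (mul_one _).symm))⟩

namespace StarOp

/-- The automorphism of the twisted algebra which multiplies the sections of `L k` by `χ k`. -/
def twist (χ : G →* ℂˣ) (W : Opens C.base) : C.StarOp l e W ≃+* C.StarOp l e W where
  toFun a := ofComp l fun k => algebraMap ℂ (C.O W) (χ k) • a.comp k
  invFun a := ofComp l fun k => algebraMap ℂ (C.O W) (χ k)⁻¹ • a.comp k
  left_inv a := ext_comp fun k => by
    rw [comp_ofComp, comp_ofComp, smul_smul, ← map_mul, inv_mul_cancel₀ (χ k).ne_zero, map_one,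
      one_smul]
  right_inv a := ext_comp fun k => by
    rw [comp_ofComp, comp_ofComp, smul_smul, ← map_mul, mul_inv_cancel₀ (χ k).ne_zero, map_one,
      one_smul]
  map_add' a b := ext_comp fun k => smul_add (algebraMap ℂ (C.O W) (χ k)) (a.comp k) (b.comp k)
  map_mul' a b := ext_comp fun k => by
    rw [comp_ofComp, comp_mul, comp_mul, Finset.smul_sum]
    refine Finset.sum_congr rfl fun j _ => ?_
    rw [comp_ofComp, comp_ofComp, mulLine_smul, smul_mulLine]
    simp only [smul_smul, ← map_mul, ← Units.val_mul]
    refine congrArg (fun c : ℂˣ => algebraMap ℂ (C.O W) c •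
      mulLine _ (b.comp j) (a.comp (j⁻¹ * k))) ?_
    rw [mul_comm (j⁻¹ * k) j, mul_inv_cancel_left, mul_comm]

variable {W : Opens C.base}

theorem comp_twist (χ : G →* ℂˣ) (a : C.StarOp l e W) (k : G) :
    (twist χ W a).comp k = algebraMap ℂ (C.O W) (χ k) • a.comp k := rfl

theorem twist_ofO (χ : G →* ℂˣ) (r : C.O W) : twist χ W (ofO l e r) = ofO l e r := by
  refine ext_comp fun k => ?_
  rw [comp_twist]
  by_cases hk : k = 1
  · have h1 : algebraMap ℂ (C.O W) (χ k) = 1 := by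
      rw [hk, map_one, Units.val_one, map_one]
    rw [h1, one_smul]
  · rw [comp_ofO_ne r hk, smul_zero]

end StarOp

section Act

variable {hC : C.Exact} {ht : ∀ k, C.LocTriv (e k)}
  (A : TwistedEquivariant (homAction e hC ht) l.toFun)

/-- If all the twists of a family `a i` by characters are relations between the sections `s i`, then
so are its homogeneous components. -/
theorem sum_rhoEv_eq_zero {W : Opens C.base} {ι : Type} [Fintype ι] (a : ι → C.StarOp l e W)
    (s : ι → MSec A.obj W) (H : ∀ χ : G →* ℂˣ, ∑ i, StarOp.twist χ W (a i) • s i = 0) (k : G) :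
    ∑ i, rhoEv A k (s i) ((a i).comp k) = 0 := by
  refine eq_zero_of_sum_characters (R := C.O W) (M := MSec A.obj W)
    (fun k => ∑ i, rhoEv A k (s i) ((a i).comp k)) (fun χ => ?_) k
  refine Eq.trans ?_ (H χ)
  simp only [star_smul_def, StarOp.comp_twist, rhoEv_smul, Finset.smul_sum]
  exact Finset.sum_comm

/-- A relation over the functions, placed in degree `1`, is a relation over the twisted algebra all
of whose twists by characters are relations. The relations over the twisted algebra with this
property are locally generated by finitely many of them. Their components in degree `k`, divided by
a frame of `L k`, are relations over the functions, and these generate all relations over the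
functions. -/
theorem finRelO_of_finRelStar (H : FinRelStar A) : FinRelO A.obj := by
  have : Fintype (G →* ℂˣ) := Fintype.ofFinite _
  intro U ι _ s x hx
  obtain ⟨V₀, hV₀, κ, _, R, hx₀, h0, h⟩ := FinRel.finGen_twist (R := fun W => C.StarOp l e W)
    (fun U V h => (C.starData l e).res h) (S := fun W => MSec A.obj W)
    (fun U V h => AddMonoidHom.mk' (fun m => mres A.obj h m)
      fun m n => RSpace.Mod.res_add (X := C.space) h m n)
    (fun _ _ _ => rfl) (fun h h' m => mres_mres _ _ _ _)
    (fun h a m => (toStarData A).res_smul h a m) (fun χ : G →* ℂˣ => StarOp.twist χ)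
    (fun _ _ _ => rfl) H Finset.univ s hx
  -- generators of the families all of whose homogeneous components are relations, with components
  -- written in terms of frames of the line bundles
  obtain ⟨V, hV, hx', ⟨Φ⟩⟩ := exists_frames (e := e) ht hx₀
  choose ρ hρ using fun j i k => Φ.exists_smul_eq hC (resLine hV ((R j i).comp k))
  refine ⟨V, hV.trans hV₀, κ × G, inferInstance, fun p i => ρ p.1 i p.2, hx', fun p => ?_,
    fun W hW c hc y hy => ?_⟩
  · refine eq_zero_of_rhoEv A Φ p.2 ?_
    have h1 := congrArg (fun m => mres A.obj hV m) (sum_rhoEv_eq_zero A (R p.1)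
      (fun i => mres A.obj hV₀ (s i)) (fun χ => h0 p.1 χ (Finset.mem_univ χ)) p.2)
    refine Eq.trans ?_ (h1.trans (RSpace.Mod.res_zero (X := C.space) hV))
    rw [rhoEv_sum]
    refine Eq.trans ?_ (map_sum (AddMonoidHom.mk' (fun m => mres A.obj hV m)
      fun m n => RSpace.Mod.res_add (X := C.space) hV m n) _ _).symm
    refine Finset.sum_congr rfl fun i _ => ?_
    refine Eq.trans ?_ (res_rhoEv A hV p.2 _ _).symm
    rw [rhoEv_smul_left, hρ, rhoEv_smul]
    exact congrArg (fun m => ρ p.1 i p.2 • rhoEv A p.2 m (Φ.u p.2)) (mres_mres _ _ _ _).symm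
  · obtain ⟨W', hW', δ, hy', e₁⟩ := h W (hW.trans hV) (fun i => StarOp.ofO l e (c i))
      (fun χ _ => Eq.trans (Finset.sum_congr rfl fun i _ => by
        rw [StarOp.twist_ofO, ofO_smul]; rfl) hc) y hy
    have hV' := hW'.trans hW
    -- the products of the frames of `L k` with the components of the coefficients in `L k⁻¹` are
    -- functions
    choose ε hε using fun j k => exists_smul_one₁ hC (mulLine (e'' := e 1)
      (by rw [← map_mul, mul_inv_cancel_left]) ((Φ.res hV').u k) ((δ j).comp (k⁻¹ * 1)))
    refine ⟨W', hW', fun p => algebraMap ℂ (C.O W') (l.toFun p.2 (p.2⁻¹ * 1)) * ε p.1 p.2, hy',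
      fun i => ?_⟩
    refine smul_injective_of_ne_zero hC (w := StarOp.one₁ C e W') (fun z => one_ne_zero) ?_
    -- compare the components in degree `1`
    have e₂ := congrArg (fun a : C.StarOp l e W' => a.comp 1) (e₁ i)
    refine Eq.trans ?_ (e₂.trans ?_)
    · exact (congrArg (fun w => resLine hW' w) (StarOp.comp_ofO_one (l := l) (c i))).symm
    · refine (StarOp.comp_sum _ _ _).trans ?_
      rw [Fintype.sum_prod_type, Finset.sum_smul]
      refine Finset.sum_congr rfl fun j _ => ?_
      refine (comp_mul _ _ _).trans ?_
      rw [Finset.sum_smul]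
      refine Finset.sum_congr rfl fun k _ => ?_
      have e₃ : ((C.starData l e).res (hV'.trans hV) (R j i)).comp k =
          resO hV' (ρ j i k) • (Φ.res hV').u k := congrArg (fun w => resLine hV' w) (hρ j i k)
      refine (congrArg (fun w => algebraMap ℂ (C.O W') (l.toFun k (k⁻¹ * 1)) • mulLine _ w
        ((δ j).comp (k⁻¹ * 1))) e₃).trans ?_
      rw [smul_mulLine, hε, smul_smul, smul_smul]
      refine congrArg (fun r : C.O W' => r • StarOp.one₁ C e W') ?_
      exact mul_right_comm _ _ _

/-- A `λ`-twisted equivariant sheaf is coherent over the twisted algebra if and only if it is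
coherent over the functions. -/
theorem isCoherent_toStar_iff :
    RSpace.Mod.IsCoherent (X := C.starSpace l e) ((C.toStar l e hC ht).obj A) ↔
      RSpace.Mod.IsCoherent (X := C.space) A.obj := by
  refine (RSpace.Mod.isCoherent_iff (X := C.starSpace l e) _).trans
    (Iff.trans ?_ (RSpace.Mod.isCoherent_iff (X := C.space) A.obj).symm)
  exact ⟨fun H => ⟨finTypeO_of_finTypeStar A H.1, finRelO_of_finRelStar A H.2⟩,
    fun H => ⟨finTypeStar_of_finTypeO A H.1, finRelStar_of_finRelO A H.2⟩⟩

end Act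

end Cover

namespace Torus

variable {g : ℕ} (X : Torus g) (d : DefParam g) {lam : Bilin d.Kh}

theorem isCoherent_FMLam_iff (E : X.ModXhLam d lam) :
    RSpace.Mod.IsCoherent ((X.FMLam d lam).obj E) ↔
      RSpace.Mod.IsCoherent ((X.FMQ d).obj E.obj) := by
  let i := (X.inducedIso d lam).app E
  refine ⟨fun H => ?_, fun H => ?_⟩
  · exact (Cover.isCoherent_toStar_iff _).1 (RSpace.Mod.IsCoherent.of_iso i.symm H)
  · exact RSpace.Mod.IsCoherent.of_iso i ((Cover.isCoherent_toStar_iff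
      (((X.equivariantStructure d).induced lam.toFun).obj E)).2 H)

end Torus

end NCTorus

end

theorem mainTheorem7 (g : ℕ) (X : NCTorus.Torus g) (d : NCTorus.DefParam g)
    (lam : NCTorus.Bilin d.Kh)
    (hN : ∀ k k' : d.Kh, lam.toFun k k' ^ d.N = 1)
    (hrep : ∃ α : NCTorus.That g → ℂˣ, (∀ t, ‖(α t : ℂ)‖ = 1) ∧
      ∀ s t : NCTorus.That g, lam.toFun (s : d.Kh) (t : d.Kh) * α (s * t) =
        d.coc s t * α s * α t) :
    ∃ a : NCTorus.EquivariantStructure (X.actYh d) (X.actY d) (X.FMQ d),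
      X.IsCanonical a ∧
      Nonempty (CategoryTheory.Functor.comp (a.induced lam.toFun) (X.toXLam d lam) ≅
        X.FMLam d lam) ∧
      ∀ E : X.ModXhLam d lam,
        NCTorus.RSpace.Mod.IsCoherent ((X.FMLam d lam).obj E) ↔
          NCTorus.RSpace.Mod.IsCoherent ((X.FMQ d).obj E.obj) := by
  exact ⟨X.equivariantStructure d, X.isCanonical_equivariantStructure d, ⟨X.inducedIso d lam⟩,
    fun E => X.isCoherent_FMLam_iff d E⟩
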